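/- **Theorem (Schur–Sergeev duality).** Let $m,n,d\ge 0$ be integers, let $V=\mathbb C^{m|n}$ be the superspace with standard basis $e_{\bar 1},\dots,e_{\bar m}$ (even), $e_1,\dots,e_n$ (odd), and let $\mathfrak g=\mathfrak{gl}(m|n)$ be the Lie superalgebra of matrices indexed by $I(m|n)=\{\bar 1<\dots<\bar m<1<\dots<n\}$, with $[x,y]=xy-(-1)^{|x||y|}yx$ for homogeneous $x,y$. Let $U(\mathfrak g)$ act on $V^{\otimes d}$ by the algebra homomorphism $\Phi_d$ with $$\Phi_d(g)(v_1\otimes\cdots\otimes v_d)=\sum_{k=1}^d(-1)^{|g|(|v_1|+\cdots+|v_{k-1}|)}\,v_1\otimes\cdots\otimes g v_k\otimes\cdots\otimes v_d$$ for homogeneous $g\in\mathfrak g$, $v_i\in V$, and let $\mathbb C\mathfrak S_d$ act by the algebra homomorphism $\Psi_d$ with $$\Psi_d((i,i+1))(v_1\otimes\cdots\otimes v_d)=(-1)^{|v_i||v_{i+1}|}\,v_1\otimes\cdots\otimes v_{i+1}\otimes v_i\otimes\cdots\otimes v_d .$$ 1. The images of $\Phi_d$ and $\Psi_d$ are each other's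 centralizers in $\operatorname{End}_{\mathbb C}(V^{\otimes d})$: $$\Phi_d(U(\mathfrak g))=\operatorname{End}_{\mathfrak S_d}(V^{\otimes d}),\qquad \operatorname{End}_{U(\mathfrak g)}(V^{\otimes d})=\Psi_d(\mathbb C\mathfrak S_d).$$ 2. Let $\mathcal P(d,m|n)$ be the set of partitions $\lambda$ of $d$ with $\lambda_{m+1}\le n$. As $U(\mathfrak g)\otimes\mathbb C\mathfrak S_d$-modules, $$V^{\otimes d}\;\cong\bigoplus_{\lambda\in\mathcal P(d,m|n)}L(\lambda^\natural)\otimes S^\lambda ,$$ and this decomposition is multiplicity-free: for $\lambda\in\mathcal P(d,m|n)$ the modules $L(\lambda^\natural)$ are simple and pairwise non-isomorphic, and so are the modules $S^\lambda$. Here $S^\lambda$ is the Specht module of $\mathfrak S_d$ (so $S^{(d)}$ is trivial and $S^{(1^d)}$ is the sign module). Let $\delta_1,\dots,\delta_m,\epsilon_1,\dots,\epsilon_n$ be the basis dual to the diagonal matrix units $E_{\bar1\bar1},\dots,E_{\bar m\bar m},E_{11},\dots,E_{nn}$, and let $\nu$ be the transpose of the partition $(\lambda_{m+1},\lambda_{m+2},\dots)$;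 then $\lambda^\natural=\sum_{i=1}^m\lambda_i\delta_i+\sum_{j=1}^n\nu_j\epsilon_j$, and $L(\lambda^\natural)$ is the simple $\mathfrak g$-module of highest weight $\lambda^\natural$ with respect to the Borel subalgebra of upper triangular matrices, i.e. the unique simple quotient of the Verma module of highest weight $\lambda^\natural$. -/

import Mathlib

open scoped TensorProduct DirectSum

noncomputable section

namespace SchurSergeev

/-! ### The superspace `ℂ^{m|n}` and the Lie superalgebra `gl(m|n)` -/

/-- The index set `I(m|n)`: `m` even indices followed by `n` odd ones. Its total order is that of
`Fin m ⊕ₗ Fin n`, i.e. `toLex i < toLex j`. -/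
abbrev Idx (m n : ℕ) : Type := Fin m ⊕ Fin n

/-- The parity of an index, hence of the standard basis vector it labels. -/
def par {m n : ℕ} : Idx m n → ZMod 2
  | .inl _ => 0
  | .inr _ => 1

/-- The Koszul sign `(-1)^{p q}`. -/
def ksign (p q : ZMod 2) : ℂ := (-1) ^ (p.val * q.val)

/-- The natural module `ℂ^{m|n}`. -/
abbrev V (m n : ℕ) : Type := Idx m n → ℂ

/-- The underlying vector space of `gl(m|n)`: matrices indexed by `I(m|n)`. -/
abbrev SuperGL (m n : ℕ) : Type := Matrix (Idx m n) (Idx m n) ℂ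

/-- `x` is homogeneous of parity `p`: its entries `x i j` vanish unless `|i| + |j| = p`. -/
def IsHomog {m n : ℕ} (p : ZMod 2) (x : SuperGL m n) : Prop :=
  ∀ i j, par i + par j ≠ p → x i j = 0

/-- The homogeneous component of parity `p` of a matrix. -/
def homPart {m n : ℕ} (p : ZMod 2) : SuperGL m n →ₗ[ℂ] SuperGL m n where
  toFun x := Matrix.of fun i j => if par i + par j = p then x i j else 0
  map_add' x y := by ext i j; simp only [Matrix.of_apply, Matrix.add_apply]; split_ifs <;> simp
  map_smul' c x := by ext i j; simp

/-- The Lie superbracket `[x, y] = x y - (-1)^{p q} y x` of two homogeneous elements of parities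
`p` and `q`. -/
def superBracket {m n : ℕ} (p q : ZMod 2) (x y : SuperGL m n) : SuperGL m n :=
  x * y - ksign p q • (y * x)

/-! ### The universal enveloping algebra -/

/-- The defining relations `x y = [x, y] + (-1)^{|x||y|} y x` (`x`, `y` homogeneous) of the
enveloping algebra of `gl(m|n)`, on the tensor algebra. -/
inductive UEA.Rel (m n : ℕ) :
    TensorAlgebra ℂ (SuperGL m n) → TensorAlgebra ℂ (SuperGL m n) → Prop
  | bracket (p q : ZMod 2) (x y : SuperGL m n) (hx : IsHomog p x) (hy : IsHomog q y) :
      UEA.Rel m n (TensorAlgebra.ι ℂ x * TensorAlgebra.ι ℂ y)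
        (TensorAlgebra.ι ℂ (superBracket p q x y) +
          ksign p q • (TensorAlgebra.ι ℂ y * TensorAlgebra.ι ℂ x))

/-- The universal enveloping algebra `U(gl(m|n))`. -/
def UEA (m n : ℕ) : Type := RingQuot (UEA.Rel m n)

instance (m n : ℕ) : Ring (UEA m n) := inferInstanceAs (Ring (RingQuot (UEA.Rel m n)))

instance (m n : ℕ) : Algebra ℂ (UEA m n) :=
  inferInstanceAs (Algebra ℂ (RingQuot (UEA.Rel m n)))

/-- The canonical map `gl(m|n) → U(gl(m|n))`. -/
def UEA.ι (m n : ℕ) : SuperGL m n →ₗ[ℂ] UEA m n :=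
  (RingQuot.mkAlgHom ℂ (UEA.Rel m n)).toLinearMap ∘ₗ TensorAlgebra.ι ℂ

/-- The universal property of `U(gl(m|n))`: a linear map into an associative algebra that respects
superbrackets of homogeneous elements extends to an algebra homomorphism. -/
def UEA.lift {m n : ℕ} {A : Type*} [Semiring A] [Algebra ℂ A] (f : SuperGL m n →ₗ[ℂ] A)
    (hf : ∀ (p q : ZMod 2) (x y : SuperGL m n), IsHomog p x → IsHomog q y →
      f x * f y = f (superBracket p q x y) + ksign p q • (f y * f x)) :
    UEA m n →ₐ[ℂ] A :=
  RingQuot.liftAlgHom ℂ ⟨TensorAlgebra.lift ℂ f, by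
    rintro _ _ ⟨p, q, x, y, hx, hy⟩
    simpa using hf p q x y hx hy⟩

theorem UEA.lift_ι {m n : ℕ} {A : Type*} [Semiring A] [Algebra ℂ A] (f : SuperGL m n →ₗ[ℂ] A)
    (hf : ∀ (p q : ZMod 2) (x y : SuperGL m n), IsHomog p x → IsHomog q y →
      f x * f y = f (superBracket p q x y) + ksign p q • (f y * f x)) (x : SuperGL m n) :
    UEA.lift f hf (UEA.ι m n x) = f x := by
  simp only [UEA.lift, UEA.ι]
  erw [RingQuot.liftAlgHom_mkAlgHom_apply]
  simp

/-! ### The two actions on `V^{⊗ d}` -/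

/-- The tensor space `(ℂ^{m|n})^{⊗ d}`. -/
abbrev W (m n d : ℕ) : Type := ⨂[ℂ] _ : Fin d, V m n

/-- The sign operator `v ↦ (-1)^{p |v|} v` on `ℂ^{m|n}`. -/
def signOp (m n : ℕ) (p : ZMod 2) : Module.End ℂ (V m n) :=
  Matrix.toLin' (Matrix.diagonal fun i => ksign p (par i))

/-- `v₁ ⊗ ⋯ ⊗ v_d ↦ (-1)^{p(|v₁| + ⋯ + |v_{k-1}|)} v₁ ⊗ ⋯ ⊗ x v_k ⊗ ⋯ ⊗ v_d`, as a linear function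
of `x`. -/
def slot (m n d : ℕ) (p : ZMod 2) (k : Fin d) : SuperGL m n →ₗ[ℂ] Module.End ℂ (W m n d) :=
  (PiTensorProduct.mapMultilinear ℂ (fun _ : Fin d => V m n) (fun _ : Fin d => V m n)).toLinearMap
    (fun j => if j < k then signOp m n p else LinearMap.id) k ∘ₗ
    (Matrix.toLin' : SuperGL m n ≃ₗ[ℂ] (V m n →ₗ[ℂ] V m n)).toLinearMap

/-- The action of `gl(m|n)` on `V^{⊗ d}`: an element of parity `p` acts by the sum over all tensor
slots `k` of `slot p k`; an arbitrary element acts through its homogeneous components. -/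
def glAct (m n d : ℕ) : SuperGL m n →ₗ[ℂ] Module.End ℂ (W m n d) :=
  ∑ p : ZMod 2, ∑ k : Fin d, slot m n d p k ∘ₗ homPart p

theorem ksign_mul_self (p q : ZMod 2) : ksign p q * ksign p q = 1 := by
  simp [ksign, ← mul_pow]

theorem ksign_comm (p q : ZMod 2) : ksign p q = ksign q p := by
  simp [ksign, mul_comm]

theorem ksign_add_left (p q r : ZMod 2) : ksign (p + q) r = ksign p r * ksign q r := by
  have h : ∀ p q r : ZMod 2, (-1 : ℤ) ^ ((p + q).val * r.val) =
      (-1) ^ (p.val * r.val) * (-1) ^ (q.val * r.val) := by decide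
  have := congrArg (Int.cast : ℤ → ℂ) (h p q r)
  push_cast at this
  exact this

theorem homPart_of_isHomog {m n : ℕ} {p : ZMod 2} {x : SuperGL m n} (hx : IsHomog p x) (q : ZMod 2) :
    homPart q x = if q = p then x else 0 := by
  ext i j
  by_cases h : q = p
  · subst h
    by_cases h' : par i + par j = q
    · simp [homPart, h']
    · simp [homPart, h', hx i j h']
  · by_cases h' : par i + par j = q
    · simp [homPart, h', h, hx i j (h' ▸ h)]
    · simp [homPart, h', h]

theorem glAct_of_isHomog {m n : ℕ} (d : ℕ) {p : ZMod 2} {x : SuperGL m n} (hx : IsHomog p x) :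
    glAct m n d x = ∑ k : Fin d, slot m n d p k x := by
  simp only [glAct, LinearMap.sum_apply, LinearMap.comp_apply, homPart_of_isHomog hx]
  rw [Finset.sum_eq_single p] <;> simp +contextual

theorem IsHomog.mul {m n : ℕ} {p q : ZMod 2} {x y : SuperGL m n} (hx : IsHomog p x)
    (hy : IsHomog q y) : IsHomog (p + q) (x * y) := by
  intro i j hij
  rw [Matrix.mul_apply]
  refine Finset.sum_eq_zero fun k _ => ?_
  by_cases h1 : par i + par k = p
  · by_cases h2 : par k + par j = q
    · exfalso
      apply hij
      have h3 : par k + par k = 0 := CharTwo.add_self_eq_zero _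
      rw [← h1, ← h2]
      linear_combination -h3
    · rw [hy k j h2, mul_zero]
  · rw [hx i k h1, zero_mul]

theorem IsHomog.superBracket {m n : ℕ} {p q : ZMod 2} {x y : SuperGL m n} (hx : IsHomog p x)
    (hy : IsHomog q y) : IsHomog (p + q) (superBracket p q x y) := by
  intro i j hij
  simp [SchurSergeev.superBracket, hx.mul hy i j hij, hy.mul hx i j (by rwa [add_comm q p])]

theorem slot_eq {m n : ℕ} (d : ℕ) (p : ZMod 2) (k : Fin d) (x : SuperGL m n) :
    slot m n d p k x = PiTensorProduct.map (fun j =>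
      if j < k then signOp m n p else if j = k then Matrix.toLin' x else LinearMap.id) := by
  simp only [slot, LinearMap.comp_apply, MultilinearMap.toLinearMap_apply,
    PiTensorProduct.mapMultilinear_apply, LinearEquiv.coe_coe]
  congr 1
  funext j
  by_cases h : j = k
  · subst h; simp
  · simp [h]

theorem signOp_mul (m n : ℕ) (p q : ZMod 2) :
    signOp m n p * signOp m n q = signOp m n (p + q) := by
  rw [signOp, signOp, signOp, Module.End.mul_eq_comp, ← Matrix.toLin'_mul,
    Matrix.diagonal_mul_diagonal]
  simp only [ksign_add_left]

theorem signOp_mul_toLin' {m n : ℕ} {p : ZMod 2} (q : ZMod 2) {x : SuperGL m n} (hx : IsHomog p x) :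
    signOp m n q * Matrix.toLin' x = ksign p q • (Matrix.toLin' x * signOp m n q) := by
  rw [signOp, Module.End.mul_eq_comp, Module.End.mul_eq_comp, ← Matrix.toLin'_mul,
    ← Matrix.toLin'_mul, ← map_smul]
  congr 1
  ext i j
  rw [Matrix.smul_apply, Matrix.diagonal_mul, Matrix.mul_diagonal, smul_eq_mul]
  by_cases h : par i + par j = p
  · have h3 : par j + par j = 0 := CharTwo.add_self_eq_zero _
    have : par i = p + par j := by rw [← h]; linear_combination -h3
    rw [this, ksign_comm q, ksign_add_left, ksign_comm q]
    ring
  · simp [hx i j h]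

theorem slot_mul_self {m n d : ℕ} (p q : ZMod 2) (k : Fin d) (x y : SuperGL m n) :
    slot m n d p k x * slot m n d q k y = slot m n d (p + q) k (x * y) := by
  rw [slot_eq, slot_eq, slot_eq, ← PiTensorProduct.map_mul]
  congr 1
  funext j
  rcases lt_trichotomy j k with h | h | h
  · simp [h, signOp_mul]
  · subst h; simp [Module.End.mul_eq_comp, Matrix.toLin'_mul]
  · simp [h.not_gt, h.ne', Module.End.mul_eq_comp]

theorem slot_comm_of_lt {m n d : ℕ} {p q : ZMod 2} {k l : Fin d} (hkl : k < l) {x y : SuperGL m n}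
    (hx : IsHomog p x) :
    slot m n d q l y * slot m n d p k x = ksign p q • (slot m n d p k x * slot m n d q l y) := by
  rw [slot_eq, slot_eq, ← PiTensorProduct.map_mul, ← PiTensorProduct.map_mul]
  set F : Fin d → Module.End ℂ (V m n) := fun j =>
    (if j < k then signOp m n p else if j = k then Matrix.toLin' x else LinearMap.id) *
    (if j < l then signOp m n q else if j = l then Matrix.toLin' y else LinearMap.id) with hF
  have hupd : (fun j =>
      (if j < l then signOp m n q else if j = l then Matrix.toLin' y else LinearMap.id) *
      (if j < k then signOp m n p else if j = k then Matrix.toLin' x else LinearMap.id)) =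
      Function.update F k (ksign p q • F k) := by
    funext j
    rcases lt_trichotomy j k with h | h | h
    · rw [Function.update_of_ne h.ne]
      simp [hF, h, h.trans hkl, signOp_mul, add_comm]
    · subst h
      simp [hF, hkl, signOp_mul_toLin' q hx]
    · rw [Function.update_of_ne h.ne']
      simp [hF, h.not_gt, h.ne', Module.End.mul_eq_comp]
  rw [hupd, PiTensorProduct.map_update_smul, Function.update_eq_self]

theorem slot_comm_of_ne {m n d : ℕ} {p q : ZMod 2} {k l : Fin d} (hkl : k ≠ l) {x y : SuperGL m n}
    (hx : IsHomog p x) (hy : IsHomog q y) :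
    slot m n d p k x * slot m n d q l y = ksign p q • (slot m n d q l y * slot m n d p k x) := by
  rcases lt_or_gt_of_ne hkl with h | h
  · rw [slot_comm_of_lt h hx, smul_smul, ksign_mul_self, one_smul]
  · rw [slot_comm_of_lt h hy, ksign_comm]

/-- The action of `gl(m|n)` on `V^{⊗ d}` respects superbrackets. -/
theorem glAct_superBracket {m n : ℕ} (d : ℕ) (p q : ZMod 2) (x y : SuperGL m n) (hx : IsHomog p x)
    (hy : IsHomog q y) :
    glAct m n d x * glAct m n d y =
      glAct m n d (superBracket p q x y) + ksign p q • (glAct m n d y * glAct m n d x) := by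
  rw [glAct_of_isHomog d hx, glAct_of_isHomog d hy, glAct_of_isHomog d (hx.superBracket hy),
    Finset.sum_mul_sum, Finset.sum_mul_sum,
    Finset.sum_comm (f := fun i j => slot m n d q i y * slot m n d p j x),
    Finset.smul_sum, ← Finset.sum_add_distrib]
  refine Finset.sum_congr rfl fun k _ => ?_
  rw [← Finset.add_sum_erase _ _ (Finset.mem_univ k),
    ← Finset.add_sum_erase (a := k) (f := fun i => slot m n d q i y * slot m n d p k x) _
      (Finset.mem_univ k), smul_add, ← add_assoc, Finset.smul_sum]
  congr 1
  · rw [slot_mul_self, slot_mul_self, superBracket, map_sub, map_smul, add_comm q p,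
      sub_add_cancel]
  · refine Finset.sum_congr rfl fun l hl => ?_
    exact slot_comm_of_ne (Finset.ne_of_mem_erase hl).symm hx hy

/-- The algebra homomorphism `Φ_d : U(gl(m|n)) → End(V^{⊗ d})`. -/
def Φ (m n d : ℕ) : UEA m n →ₐ[ℂ] Module.End ℂ (W m n d) :=
  UEA.lift (glAct m n d) (glAct_superBracket d)

/-- The basis `e_{f 1} ⊗ ⋯ ⊗ e_{f d}` of `V^{⊗ d}`, where `f : Fin d → I(m|n)`. -/
def tensorBasis (m n d : ℕ) : Module.Basis (Fin d → Idx m n) ℂ (W m n d) :=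
  Basis.piTensorProduct fun _ => Pi.basisFun ℂ (Idx m n)

/-- The sign picked up when `σ` permutes the factors of `e_{f 1} ⊗ ⋯ ⊗ e_{f d}`: the product of
`(-1)^{|e_{f i}| |e_{f j}|}` over all inversions `i < j`, `σ j < σ i`. -/
def permSign {m n d : ℕ} (σ : Equiv.Perm (Fin d)) (f : Fin d → Idx m n) : ℂ :=
  ∏ ij : Fin d × Fin d with ij.1 < ij.2 ∧ σ ij.2 < σ ij.1, ksign (par (f ij.1)) (par (f ij.2))

/-- The operator on `V^{⊗ d}` by which `σ` permutes the tensor factors (the factor in place `i`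
moves to place `σ i`), with the Koszul sign. -/
def permOp (m n : ℕ) {d : ℕ} (σ : Equiv.Perm (Fin d)) : Module.End ℂ (W m n d) :=
  (tensorBasis m n d).constr ℂ fun f => permSign σ f • tensorBasis m n d (f ∘ σ.symm)

theorem permOp_basis {m n d : ℕ} (σ : Equiv.Perm (Fin d)) (f : Fin d → Idx m n) :
    permOp m n σ (tensorBasis m n d f) = permSign σ f • tensorBasis m n d (f ∘ σ.symm) := by
  rw [permOp, Module.Basis.constr_basis]

theorem prod_pairs_perm {d : ℕ} (τ : Equiv.Perm (Fin d)) (G : Fin d → Fin d → ℂ)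
    (hG : ∀ i j, G i j = G j i) :
    ∏ ij : Fin d × Fin d with ij.1 < ij.2, G (τ ij.1) (τ ij.2) =
      ∏ ij : Fin d × Fin d with ij.1 < ij.2, G ij.1 ij.2 := by
  have key : ∀ (ρ : Equiv.Perm (Fin d)) (ij : Fin d × Fin d), ij.1 < ij.2 →
      (if ρ ij.1 < ρ ij.2 then (ρ ij.1, ρ ij.2) else (ρ ij.2, ρ ij.1)).1 <
      (if ρ ij.1 < ρ ij.2 then (ρ ij.1, ρ ij.2) else (ρ ij.2, ρ ij.1)).2 := by
    intro ρ ij h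
    split_ifs with h'
    · exact h'
    · exact lt_of_le_of_ne (not_lt.mp h') fun h'' => h.ne' (ρ.injective h'')
  refine Finset.prod_nbij'
    (fun ij => if τ ij.1 < τ ij.2 then (τ ij.1, τ ij.2) else (τ ij.2, τ ij.1))
    (fun ij => if τ.symm ij.1 < τ.symm ij.2 then (τ.symm ij.1, τ.symm ij.2)
      else (τ.symm ij.2, τ.symm ij.1)) ?_ ?_ ?_ ?_ ?_
  · intro ij h
    simpa using key τ ij (by simpa using h)
  · intro ij h
    simpa using key τ.symm ij (by simpa using h)
  · rintro ⟨i, j⟩ h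
    have h : i < j := by simpa using h
    dsimp only
    split_ifs <;> simp_all [h.not_gt]
  · rintro ⟨i, j⟩ h
    have h : i < j := by simpa using h
    dsimp only
    split_ifs <;> simp_all [h.not_gt]
  · rintro ⟨i, j⟩ _
    dsimp only
    split_ifs
    · rfl
    · exact hG _ _

theorem permSign_eq {m n d : ℕ} (σ : Equiv.Perm (Fin d)) (f : Fin d → Idx m n) :
    permSign σ f = ∏ ij : Fin d × Fin d with ij.1 < ij.2,
      if ij.1 < ij.2 ↔ σ ij.1 < σ ij.2 then 1 else ksign (par (f ij.1)) (par (f ij.2)) := by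
  rw [permSign, ← Finset.filter_filter, Finset.prod_filter]
  refine Finset.prod_congr rfl ?_
  rintro ⟨i, j⟩ h
  have h : i < j := by simpa using h
  have h2 : σ i ≠ σ j := fun h' => h.ne (σ.injective h')
  rcases lt_or_gt_of_ne h2 with h3 | h3
  · simp [h, h3, h3.not_gt]
  · simp [h, h3, h3.not_gt]

theorem permSign_mul {m n d : ℕ} (σ τ : Equiv.Perm (Fin d)) (f : Fin d → Idx m n) :
    permSign (σ * τ) f = permSign σ (f ∘ τ.symm) * permSign τ f := by
  rw [permSign_eq, permSign_eq, permSign_eq,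
    ← prod_pairs_perm τ (fun i j => if i < j ↔ σ i < σ j then 1 else
      ksign (par ((f ∘ τ.symm) i)) (par ((f ∘ τ.symm) j))), ← Finset.prod_mul_distrib]
  · refine Finset.prod_congr rfl ?_
    rintro ⟨i, j⟩ h
    have h : i < j := by simpa using h
    simp only [Equiv.Perm.mul_apply, Function.comp_apply, Equiv.symm_apply_apply]
    have := ksign_mul_self (par (f i)) (par (f j))
    by_cases h1 : τ i < τ j <;> by_cases h2 : σ (τ i) < σ (τ j) <;> simp [h, h1, h2, this]
  · intro i j
    rw [ksign_comm]
    rcases eq_or_ne i j with h | h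
    · subst h; rfl
    · have h' : σ i ≠ σ j := fun h' => h (σ.injective h')
      congr 1
      rw [eq_iff_iff]
      constructor <;> intro hh <;> omega

/-- The representation `Ψ_d` of `𝔖_d` on `V^{⊗ d}`. -/
def permRep (m n d : ℕ) : Representation ℂ (Equiv.Perm (Fin d)) (W m n d) where
  toFun := permOp m n
  map_one' := by
    refine (tensorBasis m n d).ext fun f => ?_
    rw [permOp_basis, permSign, Finset.filter_false_of_mem]
    · rw [Finset.prod_empty, one_smul]
      rfl
    · rintro ⟨i, j⟩ _ ⟨h1, h2⟩
      exact lt_asymm h1 h2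
  map_mul' σ τ := by
    refine (tensorBasis m n d).ext fun f => ?_
    rw [Module.End.mul_apply, permOp_basis, permOp_basis, map_smul, permOp_basis, smul_smul,
      permSign_mul, mul_comm]
    rfl

/-- The group algebra `ℂ𝔖_d`. -/
abbrev GroupAlg (d : ℕ) : Type := MonoidAlgebra ℂ (Equiv.Perm (Fin d))

/-- The algebra homomorphism `Ψ_d : ℂ𝔖_d → End(V^{⊗ d})`. -/
def Ψ (m n d : ℕ) : GroupAlg d →ₐ[ℂ] Module.End ℂ (W m n d) := (permRep m n d).asAlgebraHom

/-! ### Simple highest weight modules of `gl(m|n)` -/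

/-- The left ideal of `U(gl(m|n))` generated by the strictly upper triangular matrix units and by
the elements `E_ii - wt(E_ii)`. Weights are given by their coordinates in the basis of `𝔥*` dual to
the `E_ii`. -/
def vermaIdeal {m n : ℕ} (wt : Idx m n → ℂ) : Submodule (UEA m n) (UEA m n) :=
  Submodule.span (UEA m n)
    ({u | ∃ i j : Idx m n, toLex i < toLex j ∧ u = UEA.ι m n (Matrix.single i j 1)} ∪
     {u | ∃ i : Idx m n, u = UEA.ι m n (Matrix.single i i 1) - algebraMap ℂ (UEA m n) (wt i)})

/-- The Verma module of highest weight `wt` for the standard Borel subalgebra. -/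
abbrev Verma {m n : ℕ} (wt : Idx m n → ℂ) : Type := UEA m n ⧸ vermaIdeal wt

/-- `L(wt)`, the simple module of highest weight `wt`: the quotient of the Verma module by the sum
of all its proper submodules. -/
abbrev L {m n : ℕ} (wt : Idx m n → ℂ) : Type :=
  Verma wt ⧸ sSup {N : Submodule (UEA m n) (Verma wt) | N ≠ ⊤}

/-! ### Hook partitions -/

/-- The set `P(d, m|n)` of partitions `μ` of `d` with `μ_{m+1} ≤ n` (`rowLen` counts rows from
`0`). -/
abbrev HookPartition (d m n : ℕ) : Type :=
  {μ : YoungDiagram // μ.card = d ∧ μ.rowLen m ≤ n}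

/-- The partition `μ⁺ = (μ_{m+1}, μ_{m+2}, …)`. -/
def lowerPart (m : ℕ) (μ : YoungDiagram) : YoungDiagram where
  cells := (μ.cells.filter fun c => m ≤ c.1).image fun c => (c.1 - m, c.2)
  isLowerSet := by
    rintro ⟨i, j⟩ ⟨i', j'⟩ hle hmem
    obtain ⟨hi, hj⟩ := Prod.mk_le_mk.mp hle
    simp only [Finset.coe_image, Finset.coe_filter, Set.mem_image, Set.mem_ofPred_eq,
      Prod.exists, Prod.mk.injEq, YoungDiagram.mem_cells] at hmem ⊢
    obtain ⟨a, b, ⟨hab, hm⟩, rfl, rfl⟩ := hmem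
    exact ⟨m + i', j', ⟨μ.up_left_mem (by omega) hj hab, by omega⟩, by omega, rfl⟩

/-- The weight `μ^♮ = μ_1 δ_1 + ⋯ + μ_m δ_m + ν_1 ε_1 + ⋯ + ν_n ε_n`, where `ν` is the transpose
of `μ⁺`. -/
def natural (m n : ℕ) (μ : YoungDiagram) : Idx m n → ℂ
  | .inl i => (μ.rowLen i : ℂ)
  | .inr j => ((lowerPart m μ).transpose.rowLen j : ℂ)

/-! ### Specht modules -/

/-- A bijective filling of the boxes of a Young diagram with `d` boxes. -/
def tableau {d : ℕ} (μ : YoungDiagram) (hμ : μ.card = d) : Fin d ≃ μ.cells :=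
  (μ.cells.equivFinOfCardEq hμ).symm

/-- The row symmetrizer `∑ σ`, over the permutations `σ` that preserve the rows of the tableau. -/
def rowSymmetrizer {d : ℕ} {μ : YoungDiagram} (T : Fin d ≃ μ.cells) : GroupAlg d :=
  ∑ σ : Equiv.Perm (Fin d) with ∀ a, (T (σ a)).1.1 = (T a).1.1, MonoidAlgebra.of ℂ _ σ

/-- The column antisymmetrizer `∑ sgn(σ) σ`, over the permutations `σ` that preserve the columns of
the tableau. -/
def colAntisymmetrizer {d : ℕ} {μ : YoungDiagram} (T : Fin d ≃ μ.cells) : GroupAlg d :=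
  ∑ σ : Equiv.Perm (Fin d) with ∀ a, (T (σ a)).1.2 = (T a).1.2,
    (Equiv.Perm.sign σ : ℤ) • MonoidAlgebra.of ℂ _ σ

/-- The Specht module `S^μ`: the left ideal of `ℂ𝔖_d` generated by the Young symmetrizer. (The left
ideal generated by the row symmetrizer is the permutation module on tabloids, in which the Young
symmetrizer is the polytabloid of the tableau; so this is the span of all polytabloids.) -/
abbrev Specht {d : ℕ} (μ : YoungDiagram) (hμ : μ.card = d) : Type :=
  Submodule.span (GroupAlg d)
    {colAntisymmetrizer (tableau μ hμ) * rowSymmetrizer (tableau μ hμ)}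

/-! ### The bimodule `⨁ L(λ^♮) ⊗ S^λ` -/

/-- `⨁_{λ ∈ P(d, m|n)} L(λ^♮) ⊗ S^λ`. -/
abbrev Decomp (m n d : ℕ) : Type :=
  ⨁ μ : HookPartition d m n, L (natural m n μ.1) ⊗[ℂ] Specht μ.1 μ.2.1

/-- The action of `u ⊗ s ∈ U(gl(m|n)) ⊗ ℂ𝔖_d` on `⨁ L(λ^♮) ⊗ S^λ`: on each summand
`l ⊗ t ↦ u l ⊗ s t`. -/
def decompAct (m n d : ℕ) (u : UEA m n) (s : GroupAlg d) : Module.End ℂ (Decomp m n d) :=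
  DirectSum.lmap fun μ : HookPartition d m n =>
    TensorProduct.map (Algebra.lsmul ℂ ℂ (L (natural m n μ.1)) u)
      (Algebra.lsmul ℂ ℂ (Specht μ.1 μ.2.1) s)

end SchurSergeev

end

open scoped TensorProduct DirectSum

noncomputable section

namespace SchurSergeev

/-! ### The matrix units acting on the tensor basis -/

/-! The core is that `Φ` maps onto the commutant of `𝔖_d` (`mem_range_Φ_of_commute`); the rest uses
this, the semisimplicity of `ℂ𝔖_d` and the weights of tensor space. An operator commuting with `𝔖_d`
is its own average, and the average of a product of matrix units, one in each slot, is a sum over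
all injective placements of the factors. Such sums lie in the image of `Φ` by induction on the
number of factors (`sum_slotProd_mem_range`). Jacobson density then gives the other centralizer.

Put `A = ℂ𝔖_d`, `U = U(gl(m|n))`, `W = V^{⊗ d}`. If `c ∈ A` satisfies `c A c = ℂ c` (`ScalarCorner`)
and acts on `W` by a nonzero operator, then `A c` is a simple `A`-module and, since `U` maps onto
the commutant, `c W` is a simple `U`-module. Young symmetrizers `c_λ` have scalar corners. For a
hook partition, `c_λ` sends a suitable word to a nonzero singular vector of weight `λ^♮`
(`isSingular_hookVector`, `hookVector_ne_zero`), so `c_λ W ≅ L(λ^♮)`. Distinct `λ` have distinct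
weights, and a nonzero element of `c_μ A c_ν` would induce an isomorphism `c_ν W ≅ c_μ W`; hence
`c_μ A c_ν = 0` for `μ ≠ ν`. Thus the Specht modules are separated by means of `gl(m|n)`, not by
comparing tableaux.

For completeness, every nonzero `U`-submodule of `W` contains a singular vector, and its weight is
some `λ^♮` because strings of lowering operators cannot reach negative weights. If the `c_λ W` did
not generate `W` over `A`, the complement would contain a singular vector whose span maps onto some
`c_λ W`; but an element of `U` acts by 1 on the complement and by 0 on `c_λ W`
(`span_hookSymm_smul_eq_top`). The sum of the `c_λ W ⊗ A c_λ` is then all of `W`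
(`exists_bimodule_decomposition`). The PBW theorem and the classification of simple `𝔖_d`-modules
are not needed. -/

theorem tensorBasis_apply {m n d : ℕ} (f : Fin d → Idx m n) :
    tensorBasis m n d f = PiTensorProduct.tprod ℂ fun j => Pi.single (f j) (1 : ℂ) := by
  simp [tensorBasis, Basis.piTensorProduct_apply]

theorem signOp_single {m n : ℕ} (p : ZMod 2) (i : Idx m n) :
    signOp m n p (Pi.single i 1) = ksign p (par i) • Pi.single i (1 : ℂ) := by
  ext j
  rcases eq_or_ne j i with rfl | h
  · simp [signOp, Matrix.mulVec_diagonal]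
  · simp [signOp, Matrix.mulVec_diagonal, h]

/-- The sign `(-1)^{p(|f 1| + ⋯ + |f (k-1)|)}`. -/
def slotSign {m n d : ℕ} (p : ZMod 2) (k : Fin d) (f : Fin d → Idx m n) : ℂ :=
  ∏ j : Fin d, if j < k then ksign p (par (f j)) else 1

theorem slot_basis {m n d : ℕ} (p : ZMod 2) (k : Fin d) (x : SuperGL m n) (f : Fin d → Idx m n) :
    slot m n d p k x (tensorBasis m n d f) =
      slotSign p k f • ∑ i, x i (f k) • tensorBasis m n d (Function.update f k i) := by
  have h1 : ∀ j : Fin d, (if j < k then signOp m n p else if j = k then Matrix.toLin' x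
      else LinearMap.id) (Pi.single (f j) (1 : ℂ)) =
      (if j < k then ksign p (par (f j)) else 1) •
        Function.update (fun j => Pi.single (f j) (1 : ℂ)) k
          (∑ i, x i (f k) • Pi.single i (1 : ℂ)) j := by
    intro j
    rcases lt_trichotomy j k with h | h | h
    · simp [h, h.ne, signOp_single]
    · subst h
      ext i
      simp [Finset.sum_apply, Pi.single_apply, -Fintype.sum_sum_type]
    · simp [h.not_gt, h.ne']
  rw [slot_eq, tensorBasis_apply, PiTensorProduct.map_tprod]
  simp_rw [h1]
  rw [MultilinearMap.map_smul_univ, MultilinearMap.map_update_sum, slotSign]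
  congr 1
  refine Finset.sum_congr rfl fun i _ => ?_
  rw [MultilinearMap.map_update_smul, tensorBasis_apply]
  congr 2
  funext j
  rcases eq_or_ne j k with rfl | h <;> simp [*]

theorem slotSign_ne_zero {m n d : ℕ} (p : ZMod 2) (k : Fin d) (f : Fin d → Idx m n) :
    slotSign p k f ≠ 0 := by
  refine Finset.prod_ne_zero_iff.mpr fun j _ => ?_
  split_ifs
  · exact left_ne_zero_of_mul (ksign_mul_self p (par (f j)) ▸ one_ne_zero)
  · exact one_ne_zero

theorem slot_single_basis {m n d : ℕ} (p : ZMod 2) (k : Fin d) (i j : Idx m n)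
    (f : Fin d → Idx m n) :
    slot m n d p k (Matrix.single i j 1) (tensorBasis m n d f) =
      if f k = j then slotSign p k f • tensorBasis m n d (Function.update f k i) else 0 := by
  rw [slot_basis]
  split_ifs with h
  · rw [Finset.sum_eq_single i]
    · simp [h]
    · intro l _ hl
      simp [hl.symm]
    · simp
  · rw [Finset.sum_eq_zero, smul_zero]
    intro l _
    simp [Ne.symm h]

theorem isHomog_single {m n : ℕ} (i j : Idx m n) (c : ℂ) :
    IsHomog (par i + par j) (Matrix.single i j c) := by
  intro a b h
  rw [Matrix.single_apply, if_neg]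
  rintro ⟨rfl, rfl⟩
  exact h rfl

/-! ### The actions of `gl(m|n)` and of `𝔖_d` commute -/

theorem ksign_zero_left (q : ZMod 2) : ksign 0 q = 1 := by simp [ksign]

/-- How the sign of a permutation of tensor factors changes with one of the factors. -/
theorem permSign_update {m n d : ℕ} (σ : Equiv.Perm (Fin d)) (f : Fin d → Idx m n) (k : Fin d)
    (p : ZMod 2) (i : Idx m n) (hi : par i = p + par (f k)) :
    permSign σ (Function.update f k i) * slotSign p k f =
      slotSign p (σ k) (f ∘ σ.symm) * permSign σ f := by
  have hL : slotSign p (σ k) (f ∘ σ.symm) =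
      ∏ j : Fin d, if σ j < σ k then ksign p (par (f j)) else 1 := by
    rw [slotSign, ← Equiv.prod_comp σ]
    simp
  -- Only inversions containing `k` feel the change of letter; each contributes one factor `ksign p
  -- (par (f j))`, where `j` is the other position.
  have hU : permSign σ (Function.update f k i) =
      (∏ j : Fin d, if j < k ∧ σ k < σ j ∨ k < j ∧ σ j < σ k then ksign p (par (f j)) else 1) *
        permSign σ f := by
    have hsplit : ∀ ij : Fin d × Fin d, ij.1 < ij.2 ∧ σ ij.2 < σ ij.1 →
        ksign (par (Function.update f k i ij.1)) (par (Function.update f k i ij.2)) =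
        ((if ij.2 = k then ksign p (par (f ij.1)) else 1) *
          (if ij.1 = k then ksign p (par (f ij.2)) else 1)) *
          ksign (par (f ij.1)) (par (f ij.2)) := by
      rintro ⟨a, b⟩ ⟨h1, -⟩
      have h1 : a < b := h1
      rcases eq_or_ne a k with rfl | ha
      · simp [h1.ne', hi, ksign_add_left]
      · rcases eq_or_ne b k with rfl | hb
        · simp [ha, hi, ksign_comm _ (p + _), ksign_add_left, ksign_comm (par (f b))]
        · simp [ha, hb]
    rw [permSign, permSign, Finset.prod_congr rfl (fun ij h => hsplit ij (by simpa using h)),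
      Finset.prod_mul_distrib]
    congr 1
    rw [Finset.prod_mul_distrib, Finset.prod_filter, Finset.prod_filter,
      Fintype.prod_prod_type, Fintype.prod_prod_type_right, ← Finset.prod_mul_distrib]
    refine Finset.prod_congr rfl fun j _ => ?_
    dsimp only
    rw [Finset.prod_eq_single k, Finset.prod_eq_single k]
    · rcases lt_trichotomy j k with h | h | h
      · simp [h, h.not_gt]
      · simp [h]
      · simp [h, h.not_gt]
    all_goals simp +contextual
  -- The conditions `j < k` and `σ j < σ k` disagree exactly when `j` and `k` form an inversion, and
  -- squares of signs are 1.
  rw [hU, hL, mul_right_comm, slotSign, ← Finset.prod_mul_distrib]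
  congr 1
  refine Finset.prod_congr rfl fun j _ => ?_
  have := ksign_mul_self p (par (f j))
  rcases eq_or_ne j k with rfl | hj
  · simp
  · have h' : σ j ≠ σ k := fun h' => hj (σ.injective h')
    rcases lt_or_gt_of_ne hj with h1 | h1 <;> rcases lt_or_gt_of_ne h' with h2 | h2 <;>
      simp [h1, h2, h1.not_gt, h2.not_gt, this]

/-- Homogeneity makes the entry `x i (f k)` vanish unless `i` has parity `p + |f k|`, which is the
case covered by `permSign_update`. -/
theorem permOp_mul_slot {m n d : ℕ} (σ : Equiv.Perm (Fin d)) {p : ZMod 2} (k : Fin d)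
    {x : SuperGL m n} (hx : IsHomog p x) :
    permOp m n σ * slot m n d p k x = slot m n d p (σ k) x * permOp m n σ := by
  refine (tensorBasis m n d).ext fun f => ?_
  simp only [Module.End.mul_apply]
  rw [slot_basis, permOp_basis, map_smul, map_smul, slot_basis, map_sum, smul_smul,
    Finset.smul_sum, Finset.smul_sum]
  refine Finset.sum_congr rfl fun i _ => ?_
  rw [map_smul, permOp_basis]
  simp only [Function.comp_apply, Equiv.symm_apply_apply]
  by_cases h : par i + par (f k) = p
  · have h' : par i = p + par (f k) := by
      have h3 : par (f k) + par (f k) = 0 := CharTwo.add_self_eq_zero _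
      rw [← h]; linear_combination -h3
    have hf : Function.update f k i ∘ σ.symm = Function.update (f ∘ σ.symm) (σ k) i := by
      funext j
      simp [Function.update_apply, Equiv.symm_apply_eq]
    rw [hf, smul_smul, smul_smul, smul_smul]
    congr 1
    have := permSign_update σ f k p i h'
    linear_combination (x i (f k)) * this
  · simp [hx i (f k) h]

theorem homPart_add (m n : ℕ) (x : SuperGL m n) : homPart 0 x + homPart 1 x = x := by
  ext i j
  have : ∀ a : ZMod 2, a = 0 ∨ a = 1 := by decide
  rcases this (par i + par j) with h | h <;> simp [homPart, h]

theorem isHomog_homPart {m n : ℕ} (p : ZMod 2) (x : SuperGL m n) : IsHomog p (homPart p x) := by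
  intro i j h
  simp [homPart, h]

theorem glAct_mul_permOp {m n d : ℕ} (x : SuperGL m n) (σ : Equiv.Perm (Fin d)) :
    permOp m n σ * glAct m n d x = glAct m n d x * permOp m n σ := by
  have key : ∀ p, permOp m n σ * glAct m n d (homPart p x) =
      glAct m n d (homPart p x) * permOp m n σ := by
    intro p
    rw [glAct_of_isHomog d (isHomog_homPart p x), Finset.mul_sum, Finset.sum_mul,
      ← Equiv.sum_comp σ (fun k => slot m n d p k (homPart p x) * permOp m n σ)]
    exact Finset.sum_congr rfl fun k _ => permOp_mul_slot σ k (isHomog_homPart p x)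
  rw [← homPart_add m n x, map_add, mul_add, add_mul, key, key]

theorem Φ_ι {m n d : ℕ} (x : SuperGL m n) : Φ m n d (UEA.ι m n x) = glAct m n d x :=
  UEA.lift_ι _ _ x

theorem Ψ_of {m n d : ℕ} (σ : Equiv.Perm (Fin d)) :
    Ψ m n d (MonoidAlgebra.of ℂ _ σ) = permOp m n σ := by
  simp [Ψ, permRep]

theorem UEA.adjoin_range_ι (m n : ℕ) : Algebra.adjoin ℂ (Set.range (UEA.ι m n)) = ⊤ := by
  have h := congrArg (Subalgebra.map (RingQuot.mkAlgHom ℂ (UEA.Rel m n)))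
    (TensorAlgebra.adjoin_range_ι (R := ℂ) (M := SuperGL m n))
  rw [AlgHom.map_adjoin, Algebra.map_top,
    (AlgHom.range_eq_top _).mpr (RingQuot.mkAlgHom_surjective ℂ _), ← Set.range_comp] at h
  exact h

theorem UEA.induction {m n : ℕ} {P : UEA m n → Prop} (hι : ∀ x, P (UEA.ι m n x))
    (halg : ∀ c : ℂ, P (algebraMap ℂ _ c)) (hadd : ∀ u v, P u → P v → P (u + v))
    (hmul : ∀ u v, P u → P v → P (u * v)) (u : UEA m n) : P u := by
  have hu : u ∈ Algebra.adjoin ℂ (Set.range (UEA.ι m n)) := by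
    rw [UEA.adjoin_range_ι]; trivial
  induction hu using Algebra.adjoin_induction with
  | mem x hx => obtain ⟨y, rfl⟩ := hx; exact hι y
  | algebraMap r => exact halg r
  | add x y _ _ hx hy => exact hadd x y hx hy
  | mul x y _ _ hx hy => exact hmul x y hx hy

theorem Φ_commute_Ψ {m n d : ℕ} (u : UEA m n) (s : GroupAlg d) :
    Commute (Ψ m n d s) (Φ m n d u) := by
  induction u using UEA.induction with
  | hι x =>
    induction s using MonoidAlgebra.induction_on with
    | of σ => rw [Ψ_of, Φ_ι]; exact glAct_mul_permOp x σ
    | add a b ha hb => rw [map_add]; exact ha.add_left hb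
    | smul r a ha => rw [map_smul]; exact ha.smul_left r
  | halg c => rw [AlgHom.commutes]; exact (Algebra.commutes c _).symm
  | hadd u v hu hv => rw [map_add]; exact hu.add_right hv
  | hmul u v hu hv => rw [map_mul]; exact hu.mul_right hv

/-! ### The image of `Φ_d` is the centralizer of `𝔖_d` -/

/-- The product over `l` of the matrices `x l` acting in the tensor slots `κ l`. -/
def slotProd {m n d r : ℕ} (p : Fin r → ZMod 2) (x : Fin r → SuperGL m n) (κ : Fin r → Fin d) :
    Module.End ℂ (W m n d) :=
  (List.ofFn fun l => slot m n d (p l) (κ l) (x l)).prod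

theorem slotProd_succ {m n d r : ℕ} (p : Fin (r + 1) → ZMod 2) (x : Fin (r + 1) → SuperGL m n)
    (κ : Fin (r + 1) → Fin d) :
    slotProd p x κ = slot m n d (p 0) (κ 0) (x 0) *
      slotProd (fun l => p l.succ) (fun l => x l.succ) (fun l => κ l.succ) := by
  simp [slotProd, List.ofFn_succ]

/-- The factor `y` passes the earlier factors, which sit in other slots as `κ` is injective, and
merges with `x l` in their common slot. The sign depends on parities only, so `c` is chosen before
`κ` and the identity can be summed over `κ`. -/
theorem slot_mul_slotProd {m n d : ℕ} (q : ZMod 2) (y : SuperGL m n) (hy : IsHomog q y) :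
    ∀ {r : ℕ} (p : Fin r → ZMod 2) (x : Fin r → SuperGL m n), (∀ l, IsHomog (p l) (x l)) →
    ∀ l : Fin r, ∃ c : ℂ, ∀ κ : Fin r → Fin d, Function.Injective κ →
      slot m n d q (κ l) y * slotProd p x κ =
        c • slotProd (Function.update p l (q + p l)) (Function.update x l (y * x l)) κ := by
  intro r
  induction r with
  | zero => intro p x _ l; exact l.elim0
  | succ r ih =>
    intro p x hx l
    induction l using Fin.cases with
    | zero =>
      refine ⟨1, fun κ _ => ?_⟩
      rw [slotProd_succ, slotProd_succ, ← mul_assoc, slot_mul_self]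
      simp
    | succ l =>
      obtain ⟨c, hc⟩ := ih (fun l => p l.succ) (fun l => x l.succ) (fun l => hx l.succ) l
      refine ⟨ksign q (p 0) * c, fun κ hκ => ?_⟩
      have hne : κ l.succ ≠ κ 0 := fun h => Fin.succ_ne_zero l (hκ h)
      have h1 : (fun i : Fin r => Function.update p l.succ (q + p l.succ) i.succ) =
          Function.update (fun i => p i.succ) l (q + p l.succ) := by
        funext i; simp [Function.update_apply]
      have h2 : (fun i : Fin r => Function.update x l.succ (y * x l.succ) i.succ) =
          Function.update (fun i => x i.succ) l (y * x l.succ) := by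
        funext i; simp [Function.update_apply]
      rw [slotProd_succ, slotProd_succ, ← mul_assoc, slot_comm_of_ne hne hy (hx 0), smul_mul_assoc,
        mul_assoc, hc (fun l => κ l.succ) (fun a b h => Fin.succ_injective r (hκ h)), h1, h2,
        mul_smul_comm, smul_smul,
        Function.update_of_ne (Fin.succ_ne_zero l).symm,
        Function.update_of_ne (Fin.succ_ne_zero l).symm]

theorem mem_of_add_mem_subalgebra {A : Type*} [Semiring A] [Algebra ℂ A] {S : Subalgebra ℂ A}
    {x y : A} (hxy : x + y ∈ S) (hy : y ∈ S) : x ∈ S := by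
  have h : x = x + y + (-1 : ℂ) • y := by
    have : y + (-1 : ℂ) • y = ((1 : ℂ) + -1) • y := by rw [add_smul, one_smul]
    rw [add_assoc, this, add_neg_cancel, zero_smul, add_zero]
  rw [h]
  exact S.add_mem hxy (S.smul_mem hy _)

/-- Multiply the sum for the last `r` factors by `glAct (x 0)`, which is a sum over slots `k`. Slots
outside the range of `κ` give the sum for `r + 1` factors; a slot `κ l` merges two factors, leaving
a sum for `r` factors. Both the product and the merged terms are in the image by induction. -/
theorem sum_slotProd_mem_range {m n d : ℕ} : ∀ {r : ℕ} (p : Fin r → ZMod 2)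
    (x : Fin r → SuperGL m n), (∀ l, IsHomog (p l) (x l)) →
    ∑ κ : Fin r → Fin d with Function.Injective κ, slotProd p x κ ∈ (Φ m n d).range := by
  classical
  intro r
  induction r with
  | zero =>
    intro p x _
    refine Subalgebra.sum_mem _ fun κ _ => ?_
    simp only [slotProd, List.ofFn_zero, List.prod_nil]
    exact Subalgebra.one_mem _
  | succ r ih =>
    intro p x hx
    set p' : Fin r → ZMod 2 := fun l => p l.succ
    set x' : Fin r → SuperGL m n := fun l => x l.succ
    have hx' : ∀ l, IsHomog (p' l) (x' l) := fun l => hx l.succ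
    have hprod : glAct m n d (x 0) * ∑ κ : Fin r → Fin d with Function.Injective κ,
        slotProd p' x' κ ∈ (Φ m n d).range :=
      Subalgebra.mul_mem _ ⟨_, Φ_ι (x 0)⟩ (ih p' x' hx')
    have hlow : ∑ l : Fin r, ∑ κ : Fin r → Fin d with Function.Injective κ,
        slot m n d (p 0) (κ l) (x 0) * slotProd p' x' κ ∈ (Φ m n d).range := by
      refine Subalgebra.sum_mem _ fun l _ => ?_
      obtain ⟨c, hc⟩ := slot_mul_slotProd (d := d) (p 0) (x 0) (hx 0) p' x' hx' l
      rw [Finset.sum_congr rfl fun κ hκ => hc κ (by simpa using hκ), ← Finset.smul_sum]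
      refine Subalgebra.smul_mem _ (ih _ _ fun a => ?_) c
      rcases eq_or_ne a l with rfl | h
      · simpa using (hx 0).mul (hx' a)
      · simpa [h] using hx' a
    refine mem_of_add_mem_subalgebra ?_ hlow
    convert hprod using 1
    rw [ glAct_of_isHomog d (hx 0), Finset.sum_mul_sum,
      Finset.sum_comm (s := (Finset.univ : Finset (Fin r))),
      Finset.sum_comm (s := (Finset.univ : Finset (Fin d))), Finset.sum_filter,
      ← (Fin.consEquiv fun _ : Fin (r + 1) => Fin d).sum_comp, Fintype.sum_prod_type_right,
      Finset.sum_filter (s := (Finset.univ : Finset (Fin r → Fin d))),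
      Finset.sum_filter (s := (Finset.univ : Finset (Fin r → Fin d))),
      ← Finset.sum_add_distrib]
    refine Finset.sum_congr rfl fun κ _ => ?_
    have hcons : ∀ k : Fin d, Function.Injective (Fin.consEquiv (fun _ => Fin d) (k, κ)) ↔
        k ∉ Set.range κ ∧ Function.Injective κ := fun k => Fin.cons_injective_iff
    simp only [hcons]
    by_cases hκ : Function.Injective κ
    · simp only [hκ, if_true, and_true]
      have hG : ∀ k : Fin d, slotProd p x (Fin.consEquiv (fun _ => Fin d) (k, κ)) =
          slot m n d (p 0) k (x 0) * slotProd p' x' κ := by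
        intro k
        rw [slotProd_succ]
        rfl
      simp only [hG]
      -- Injectivity turns the sum over `l` into a sum over the slots in the range of `κ`,
      -- complementing the slots outside it.
      rw [← Finset.sum_image (f := fun k => slot m n d (p 0) k (x 0) * slotProd p' x' κ)
        (fun a _ b _ h => hκ h), ← Finset.sum_filter, add_comm,
        ← Finset.sum_filter_add_sum_filter_not Finset.univ (fun k : Fin d => k ∈ Set.range κ)]
      congr 2
      ext k
      simp
    · simp [hκ]

/-- The elementary operator `e_g ↦ e_f`, all other basis vectors to zero. -/
def elemOp {m n d : ℕ} (f g : Fin d → Idx m n) : Module.End ℂ (W m n d) :=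
  (tensorBasis m n d).constr ℂ fun h => if h = g then tensorBasis m n d f else 0

theorem elemOp_basis {m n d : ℕ} (f g h : Fin d → Idx m n) :
    elemOp f g (tensorBasis m n d h) = if h = g then tensorBasis m n d f else 0 := by
  rw [elemOp, Module.Basis.constr_basis]

theorem eq_sum_elemOp {m n d : ℕ} (T : Module.End ℂ (W m n d)) :
    T = ∑ g, ∑ f, (tensorBasis m n d).repr (T (tensorBasis m n d g)) f • elemOp f g := by
  refine (tensorBasis m n d).ext fun h => ?_
  simp only [LinearMap.sum_apply, LinearMap.smul_apply, elemOp_basis]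
  rw [Finset.sum_eq_single h]
  · simp
  · intro g _ hg
    simp [hg.symm]
  · simp

/-- Without repetitions in `l`, each slot still carries its original letter when its matrix unit
acts. The scalar is a product of slot signs; only its being nonzero matters. -/
theorem prod_slot_single_basis {m n d : ℕ} (p : Fin d → ZMod 2) (f g h : Fin d → Idx m n)
    (l : List (Fin d)) (hl : l.Nodup) : ∃ c : ℂ, c ≠ 0 ∧
      (l.map fun k => slot m n d (p k) k (Matrix.single (f k) (g k) 1)).prod
        (tensorBasis m n d h) = if ∀ k ∈ l, h k = g k then
          c • tensorBasis m n d (fun k => if k ∈ l then f k else h k) else 0 := by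
  induction l with
  | nil => exact ⟨1, one_ne_zero, by simp⟩
  | cons a l ih =>
    rw [List.nodup_cons] at hl
    obtain ⟨c, hc, hcl⟩ := ih hl.2
    refine ⟨c * slotSign (p a) a (fun k => if k ∈ l then f k else h k),
      mul_ne_zero hc (slotSign_ne_zero _ _ _), ?_⟩
    rw [List.map_cons, List.prod_cons, Module.End.mul_apply, hcl]
    by_cases h1 : ∀ k ∈ l, h k = g k
    · rw [if_pos h1, map_smul, slot_single_basis]
      simp only [hl.1, if_false]
      by_cases h2 : h a = g a
      · rw [if_pos h2, if_pos (by simpa [h2] using h1), smul_smul]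
        congr 2
        funext k
        rcases eq_or_ne k a with rfl | hk <;> simp [*]
      · rw [if_neg h2, if_neg (by simp [h2]), smul_zero]
    · rw [if_neg h1, map_zero, if_neg]
      exact fun h2 => h1 fun k hk => h2 k (List.mem_cons_of_mem a hk)

/-- One matrix unit per slot tests every letter of a word against `g` and rewrites it as the letter
of `f`. -/
theorem exists_elemOp_eq {m n d : ℕ} (f g : Fin d → Idx m n) : ∃ c : ℂ,
    elemOp f g = c • slotProd (fun k => par (f k) + par (g k))
      (fun k => Matrix.single (f k) (g k) 1) id := by
  have key : ∀ h, ∃ c : ℂ, c ≠ 0 ∧ slotProd (fun k => par (f k) + par (g k))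
      (fun k => Matrix.single (f k) (g k) 1) id (tensorBasis m n d h) =
        if h = g then c • tensorBasis m n d f else 0 := by
    intro h
    obtain ⟨c, hc, h1⟩ := prod_slot_single_basis (fun k => par (f k) + par (g k)) f g h
      (List.finRange d) (List.nodup_finRange d)
    refine ⟨c, hc, ?_⟩
    rw [slotProd, List.ofFn_eq_map]
    simpa [← funext_iff] using h1
  obtain ⟨c, hc, h1⟩ := key g
  refine ⟨c⁻¹, (tensorBasis m n d).ext fun h => ?_⟩
  rw [elemOp_basis, LinearMap.smul_apply]
  rcases eq_or_ne h g with rfl | hh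
  · rw [h1, if_pos rfl, if_pos rfl, smul_smul, inv_mul_cancel₀ hc, one_smul]
  · obtain ⟨c', -, h2⟩ := key h
    rw [h2, if_neg hh, if_neg hh, smul_zero]

theorem permOp_mul_slotProd {m n d : ℕ} (σ : Equiv.Perm (Fin d)) : ∀ {r : ℕ} (p : Fin r → ZMod 2)
    (x : Fin r → SuperGL m n), (∀ l, IsHomog (p l) (x l)) → ∀ κ : Fin r → Fin d,
    permOp m n σ * slotProd p x κ = slotProd p x (σ ∘ κ) * permOp m n σ := by
  intro r
  induction r with
  | zero => intro p x _ κ; simp [slotProd]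
  | succ r ih =>
    intro p x hx κ
    rw [slotProd_succ, slotProd_succ, ← mul_assoc, permOp_mul_slot σ (κ 0) (hx 0), mul_assoc,
      ih _ _ (fun l => hx l.succ), ← mul_assoc]
    rfl

theorem permOp_mul_permOp_symm {m n d : ℕ} (σ : Equiv.Perm (Fin d)) :
    permOp m n σ * permOp m n σ⁻¹ = 1 := by
  rw [← Ψ_of, ← Ψ_of, ← map_mul, ← map_mul, mul_inv_cancel, map_one, map_one]

/-- Averaging over `𝔖_d` maps every operator into the image of `Φ_d`. -/
theorem sum_conj_permOp_mem_range {m n d : ℕ} (T : Module.End ℂ (W m n d)) :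
    ∑ σ : Equiv.Perm (Fin d), permOp m n σ * T * permOp m n σ⁻¹ ∈ (Φ m n d).range := by
  rw [eq_sum_elemOp T]
  simp only [Finset.mul_sum, Finset.sum_mul, mul_smul_comm, smul_mul_assoc]
  rw [Finset.sum_comm]
  refine Subalgebra.sum_mem _ fun g _ => ?_
  rw [Finset.sum_comm]
  refine Subalgebra.sum_mem _ fun f _ => ?_
  rw [← Finset.smul_sum]
  refine Subalgebra.smul_mem _ ?_ _
  obtain ⟨c, hc⟩ := exists_elemOp_eq f g
  rw [hc]
  simp only [mul_smul_comm, smul_mul_assoc]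
  rw [← Finset.smul_sum]
  refine Subalgebra.smul_mem _ ?_ _
  have hx : ∀ l, IsHomog (par (f l) + par (g l)) (Matrix.single (f l) (g l) (1 : ℂ)) :=
    fun l => isHomog_single _ _ _
  have h1 : ∀ σ : Equiv.Perm (Fin d), permOp m n σ * slotProd (fun k => par (f k) + par (g k))
      (fun k => Matrix.single (f k) (g k) 1) id * permOp m n σ⁻¹ =
      slotProd (fun k => par (f k) + par (g k)) (fun k => Matrix.single (f k) (g k) 1) σ := by
    intro σ
    rw [permOp_mul_slotProd σ _ _ hx, mul_assoc, permOp_mul_permOp_symm, mul_one]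
    rfl
  rw [Finset.sum_congr rfl fun σ _ => h1 σ]
  convert sum_slotProd_mem_range (d := d) _ _ hx using 1
  -- Injective self-maps of `Fin d` are permutations, so the average is the sum over injective
  -- placements with `r = d`.
  refine Finset.sum_bij (fun σ _ => ⇑σ) ?_ ?_ ?_ ?_
  · intro σ _
    simpa using σ.injective
  · intro σ _ τ _ h
    exact DFunLike.coe_injective h
  · intro κ hκ
    have hκ : Function.Injective κ := by simpa using hκ
    exact ⟨Equiv.ofBijective κ (Finite.injective_iff_bijective.mp hκ), Finset.mem_univ _, rfl⟩
  · intro σ _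
    rfl

/-- Conjugation fixes `T`, so the sum over the group is `d! • T`, and `d!` is invertible. -/
theorem mem_range_Φ_of_commute {m n d : ℕ} (T : Module.End ℂ (W m n d))
    (hT : ∀ σ : Equiv.Perm (Fin d), permOp m n σ * T = T * permOp m n σ) :
    T ∈ (Φ m n d).range := by
  have h := sum_conj_permOp_mem_range T
  have h1 : ∀ σ : Equiv.Perm (Fin d), permOp m n σ * T * permOp m n σ⁻¹ = T := fun σ => by
    rw [hT, mul_assoc, permOp_mul_permOp_symm, mul_one]
  rw [Finset.sum_congr rfl fun σ _ => h1 σ, Finset.sum_const, ← Nat.cast_smul_eq_nsmul ℂ] at h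
  have h2 := Subalgebra.smul_mem _ h ((Finset.univ : Finset (Equiv.Perm (Fin d))).card : ℂ)⁻¹
  rwa [smul_smul, inv_mul_cancel₀, one_smul] at h2
  simp [Fintype.card_perm, Nat.factorial_ne_zero]

theorem range_Φ_eq_centralizer (m n d : ℕ) : (Φ m n d).range =
    Subalgebra.centralizer ℂ ((Ψ m n d).range : Set (Module.End ℂ (W m n d))) := by
  refine le_antisymm ?_ fun T hT => mem_range_Φ_of_commute T fun σ => ?_
  · rintro _ ⟨u, rfl⟩
    rw [Subalgebra.mem_centralizer_iff]
    rintro _ ⟨s, rfl⟩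
    exact Φ_commute_Ψ u s
  · rw [Subalgebra.mem_centralizer_iff] at hT
    exact hT _ ⟨_, Ψ_of σ⟩

/-! ### Commuting actions of a semisimple algebra and of an algebra onto its commutant -/

section Bimodule

variable {A U W : Type*} [Ring A] [Ring U] [AddCommGroup W] [Module A W] [Module U W]

/-- Von Neumann regularity: if `π` projects `A` onto `A c` and `π 1 = x c`, then `c = π c = c π 1 =
c x c`. -/
theorem exists_mul_mul_self_eq [IsSemisimpleRing A] (c : A) : ∃ x : A, c * x * c = c := by
  obtain ⟨q, hq⟩ := exists_isCompl (Submodule.span A {c})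
  obtain ⟨x, hx⟩ := Submodule.mem_span_singleton.mp
    (Submodule.projectionOnto _ q hq 1).2
  refine ⟨x, ?_⟩
  have h1 : Submodule.projectionOnto _ q hq c =
      c • Submodule.projectionOnto (Submodule.span A {c}) q hq 1 := by
    rw [← map_smul, smul_eq_mul, mul_one]
  have h2 := Submodule.projectionOnto_apply_left hq
    ⟨c, Submodule.mem_span_singleton_self c⟩
  rw [h1] at h2
  have h3 := congrArg Subtype.val h2
  rw [Submodule.coe_smul, ← hx] at h3
  simpa [mul_assoc] using h3

/-- The subspace `c W`, a submodule for every action commuting with that of `c`. -/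
def actImage (U W : Type*) {A : Type*} [Ring A] [Ring U] [AddCommGroup W] [Module A W] [Module U W]
    [SMulCommClass A U W] (c : A) : Submodule U W where
  carrier := {w | ∃ w', c • w' = w}
  add_mem' := by
    rintro _ _ ⟨v, rfl⟩ ⟨w, rfl⟩
    exact ⟨v + w, smul_add c v w⟩
  zero_mem' := ⟨0, smul_zero c⟩
  smul_mem' := by
    rintro u _ ⟨w, rfl⟩
    exact ⟨u • w, smul_comm c u w⟩

theorem smul_eq_of_mem_actImage [SMulCommClass A U W] {c x : A} (hx : c * x * c = c) {w : W}
    (hw : w ∈ actImage U W c) :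
    c • x • w = w := by
  obtain ⟨w, rfl⟩ := hw
  rw [smul_smul, smul_smul, hx]

/-- The complement of the part of `W` generated by the images of the `c i` is cut out by an element
of the commutant. -/
theorem exists_projector [IsSemisimpleRing A] {Λ : Type*} (c : Λ → A)
    (hU : ∀ β : Module.End A W, ∃ u : U, ∀ w : W, u • w = β w) :
    ∃ u : U, (∀ w : W, (∀ i (a : A), c i • a • w = 0) → u • w = w) ∧
      (∀ i (w : W), u • c i • w = 0) ∧
      ((∀ w : W, (∀ i (a : A), c i • a • w = 0) → w = 0) →
        Submodule.span A {v : W | ∃ i w, v = c i • w} = ⊤) := by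
  set N := Submodule.span A {v : W | ∃ i w, v = c i • w} with hN
  let N' : Submodule A W :=
    { carrier := {w | ∀ i (a : A), c i • a • w = 0}
      add_mem' := fun {v w} hv hw i a => by rw [smul_add, smul_add, hv, hw, add_zero]
      zero_mem' := fun i a => by rw [smul_zero, smul_zero]
      smul_mem' := fun b w hw i a => by rw [smul_smul a b]; exact hw i (a * b) }
  have hcompl : IsCompl N N' := by
    constructor
    -- An `A`-linear projection `π` onto `N ⊓ N'` satisfies `π (c i • w) = c i • π w = 0`, so it
    -- kills `N`; yet it is the identity on `N ⊓ N'`.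
    · rw [disjoint_iff]
      obtain ⟨q, hq⟩ := exists_isCompl (N ⊓ N')
      set π : W →ₗ[A] W := (N ⊓ N').subtype ∘ₗ Submodule.projectionOnto _ q hq with hπ
      have hmem : ∀ w, π w ∈ N ⊓ N' := fun w => (Submodule.projectionOnto _ q hq w).2
      have hπN : N ≤ LinearMap.ker π := by
        rw [hN, Submodule.span_le]
        rintro _ ⟨i, w, rfl⟩
        have := (hmem w).2 i 1
        rw [one_smul] at this
        simpa using this
      rw [eq_bot_iff]
      intro w hw
      have h1 : π w = w := by
        exact congrArg Subtype.val (Submodule.projectionOnto_apply_left hq ⟨w, hw⟩)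
      have h2 : π w = 0 := hπN hw.1
      rw [Submodule.mem_bot, ← h1, h2]
    -- Any complement `q` of `N` lies in `N'`, because `c i • a • w` is in both `N` and `q` for `w ∈
    -- q`.
    · obtain ⟨q, hq⟩ := exists_isCompl N
      refine hq.codisjoint.mono_right fun w hw i a => ?_
      have h1 : c i • a • w ∈ N ⊓ q :=
        ⟨Submodule.subset_span ⟨i, a • w, rfl⟩, q.smul_mem _ (q.smul_mem _ hw)⟩
      rwa [hq.inf_eq_bot, Submodule.mem_bot] at h1
  obtain ⟨u, hu⟩ := hU (N'.subtype ∘ₗ Submodule.projectionOnto _ _ hcompl.symm)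
  refine ⟨u, fun w hw => ?_, fun i w => ?_, fun h => ?_⟩
  · rw [hu]
    exact congrArg Subtype.val (Submodule.projectionOnto_apply_left hcompl.symm ⟨w, hw⟩)
  · rw [hu, LinearMap.comp_apply, Submodule.projectionOnto_apply_of_mem_right hcompl.symm
      (Submodule.subset_span ⟨i, w, rfl⟩), map_zero]
  · have hN' : N' = ⊥ := by
      rw [eq_bot_iff]
      exact fun w hw => h w hw
    have := hcompl.sup_eq_top
    rwa [hN', sup_bot_eq] at this

/-- The elements `c i * y` kill every summand but the `i`-th and jointly detect zero there, which
gives injectivity. The image is stable under `A` and contains every `c i • w`, which gives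
surjectivity. -/
theorem exists_directSum_equiv [Module ℂ W] {Λ : Type*} [DecidableEq Λ] (c : Λ → A) {X : Λ → Type*}
    [∀ i, AddCommGroup (X i)] [∀ i, Module ℂ (X i)] (ev : ∀ i, X i →ₗ[ℂ] W)
    (act : U → A → ∀ i, X i →ₗ[ℂ] X i) (hact : ∀ u s i z, ev i (act u s i z) = u • s • ev i z)
    (horth : ∀ i j, i ≠ j → ∀ y z, (c i * y) • ev j z = 0)
    (hinj : ∀ i z, (∀ y, (c i * y) • ev i z = 0) → z = 0)
    (hsurj : ∀ i (w : W), ∃ z, ev i z = c i • w)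
    (hspan : Submodule.span A {v : W | ∃ i w, v = c i • w} = ⊤) :
    ∃ e : W ≃ₗ[ℂ] ⨁ i, X i, ∀ (u : U) (s : A) (w : W),
      e (u • s • w) = DirectSum.lmap (act u s) (e w) := by
  let E : (⨁ i, X i) →ₗ[ℂ] W := DirectSum.toModule ℂ Λ W ev
  have hE : ∀ i z, E (DirectSum.lof ℂ Λ X i z) = ev i z := fun i z => by
    simp only [E, DirectSum.toModule_lof]
  have hequiv : ∀ (u : U) (s : A) z, E (DirectSum.lmap (act u s) z) = u • s • E z := by
    intro u s z
    induction z using DirectSum.induction_on with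
    | zero => simp
    | add a b ha hb => rw [map_add, map_add, ha, hb, map_add, smul_add, smul_add]
    | of i z =>
      change E (DirectSum.lmap _ (DirectSum.lof ℂ Λ X i z)) = u • s • E (DirectSum.lof ℂ Λ X i z)
      rw [DirectSum.lmap_lof, hE, hE, hact]
  have hsurjE : Function.Surjective E := by
    have hr : ∀ w : W, w ∈ LinearMap.range E := by
      intro w
      have hw : w ∈ Submodule.span A {v : W | ∃ i w, v = c i • w} := by rw [hspan]; trivial
      induction hw using Submodule.span_induction with
      | mem w hw =>
        obtain ⟨i, w, rfl⟩ := hw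
        obtain ⟨z, hz⟩ := hsurj i w
        exact ⟨DirectSum.lof ℂ Λ X i z, (hE i z).trans hz⟩
      | zero => exact zero_mem _
      | add v w _ _ hv hw => exact add_mem hv hw
      | smul a w _ hw =>
        obtain ⟨z, rfl⟩ := hw
        exact ⟨_, (hequiv 1 a z).trans (one_smul _ _)⟩
    exact hr
  have hinjE : Function.Injective E := by
    rw [injective_iff_map_eq_zero]
    intro z hz
    -- Acting by `c i * y` isolates the `i`-th component of `z`.
    have hproj : ∀ i (y : A), (c i * y) • E z = (c i * y) • ev i (z i) := by
      intro i y
      clear hz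
      induction z using DirectSum.induction_on with
      | zero => simp
      | add a b ha hb => rw [map_add, smul_add, ha, hb, DirectSum.add_apply, map_add, smul_add]
      | of j t =>
        have h1 : E (DirectSum.of _ j t) = ev j t := hE j t
        rw [h1]
        rcases eq_or_ne j i with rfl | hj
        · rw [DirectSum.of_eq_same]
        · rw [DirectSum.of_eq_of_ne _ _ _ hj.symm, map_zero, smul_zero, horth i j hj.symm]
    ext i
    exact hinj i _ fun y => by rw [← hproj, hz, smul_zero]
  obtain ⟨e, he⟩ : ∃ e : (⨁ i, X i) ≃ₗ[ℂ] W, ∀ z, e z = E z :=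
    ⟨LinearEquiv.ofBijective E (And.intro hinjE hsurjE), fun _ => rfl⟩
  refine ⟨e.symm, fun u s w => ?_⟩
  rw [LinearEquiv.symm_apply_eq, he, hequiv, ← he, LinearEquiv.apply_symm_apply]

/-! ### Elements with scalar corner and their simple modules -/

variable [Algebra ℂ A]

/-- `c` spans its corner: `c A c = ℂ c`. -/
def ScalarCorner (c : A) : Prop := ∀ y : A, ∃ z : ℂ, c * y * c = z • c

/-- Regularity of `y c` gives `y c t y c = y c ≠ 0`. The inner factor `c t y c` lies in the corner,
so it is a nonzero multiple of `c`; rescaling `t` finishes. -/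
theorem ScalarCorner.exists_mul_eq [IsSemisimpleRing A] {c : A} (h : ScalarCorner c) {y : A}
    (hy : y * c ≠ 0) : ∃ t : A, c * t * y * c = c := by
  obtain ⟨t, ht⟩ := exists_mul_mul_self_eq (y * c)
  obtain ⟨z, hz⟩ := h (t * y)
  have hz0 : z ≠ 0 := by
    rintro rfl
    apply hy
    rw [← ht]
    calc y * c * t * (y * c) = y * (c * (t * y) * c) := by simp only [mul_assoc]
      _ = 0 := by rw [hz, zero_smul, mul_zero]
  refine ⟨z⁻¹ • t, ?_⟩
  calc c * (z⁻¹ • t) * y * c = z⁻¹ • (c * (t * y) * c) := by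
        simp only [mul_assoc, mul_smul_comm, smul_mul_assoc]
    _ = c := by rw [hz, smul_smul, inv_mul_cancel₀ hz0, one_smul]

/-- Every nonzero `y c` can be multiplied back to `c`, so it generates `A c`. -/
theorem ScalarCorner.isSimpleModule_span [IsSemisimpleRing A] {c : A} (h : ScalarCorner c)
    (hc : c ≠ 0) : IsSimpleModule A (Submodule.span A {c}) := by
  rw [isSimpleModule_iff_toSpanSingleton_surjective]
  refine ⟨⟨⟨c, Submodule.mem_span_singleton_self c⟩, 0, fun h0 => hc (congrArg Subtype.val h0)⟩, ?_⟩
  rintro ⟨s, hs⟩ hs0 ⟨r, hr⟩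
  obtain ⟨y, rfl⟩ := Submodule.mem_span_singleton.mp hs
  obtain ⟨r, rfl⟩ := Submodule.mem_span_singleton.mp hr
  obtain ⟨t, ht⟩ := h.exists_mul_eq (y := y) fun h0 => hs0 (Subtype.ext h0)
  refine ⟨r * (c * t), Subtype.ext ?_⟩
  change r * (c * t) * (y * c) = r * c
  rw [mul_assoc, ← mul_assoc (c * t), ht]

variable [SMulCommClass A U W]

/-- If `c w ≠ 0`, its annihilator is that of `c`, so `c w ↦ c w'` is a well-defined `A`-map on `A c
w`. Semisimplicity extends it to `W`, and the extension is the action of an element of `U`. -/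
theorem ScalarCorner.isSimpleModule_actImage [IsSemisimpleRing A] {c : A} (h : ScalarCorner c)
    (hU : ∀ β : Module.End A W, ∃ u : U, ∀ w : W, u • w = β w) (hne : ∃ w : W, c • w ≠ 0) :
    IsSimpleModule U (actImage U W c) := by
  rw [isSimpleModule_iff_toSpanSingleton_surjective]
  obtain ⟨w₀, hw₀⟩ := hne
  refine ⟨⟨⟨c • w₀, w₀, rfl⟩, 0, fun h0 => hw₀ (congrArg Subtype.val h0)⟩, ?_⟩
  rintro ⟨_, w, rfl⟩ hw ⟨_, w', rfl⟩
  have hw : c • w ≠ 0 := fun h0 => hw (Subtype.ext h0)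
  set f := LinearMap.toSpanSingleton A W (c • w)
  set f' := LinearMap.toSpanSingleton A W (c • w')
  have hker : LinearMap.ker f ≤ LinearMap.ker f' := by
    intro y hy
    have hy : y • c • w = 0 := by simpa [f] using hy
    suffices hyc : y * c = 0 by simp [f', smul_smul, hyc]
    by_contra hyc
    obtain ⟨t, ht⟩ := h.exists_mul_eq hyc
    apply hw
    rw [← ht, mul_smul, mul_smul, hy, smul_zero]
  -- The cyclic module `A c w` appears as the quotient of `A` by `ker f`, embedded in `W`.
  obtain ⟨β, hβ⟩ := IsSemisimpleModule.extension_property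
    ((LinearMap.ker f).liftQ f le_rfl) (LinearMap.ker_eq_bot.mp (Submodule.ker_liftQ_eq_bot' _ _ rfl))
    ((LinearMap.ker f).liftQ f' hker)
  obtain ⟨u, hu⟩ := hU β
  refine ⟨u, Subtype.ext ?_⟩
  have h1 := LinearMap.congr_fun hβ (Submodule.Quotient.mk 1)
  simp only [LinearMap.comp_apply, Submodule.liftQ_apply] at h1
  simpa [hu, f, f'] using h1

/-- Linked idempotent-like elements have isomorphic images. -/
theorem ScalarCorner.nonempty_actImage_equiv [IsSemisimpleRing A] {c c' : A}
    (h : ScalarCorner c) (h' : ScalarCorner c')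
    (hU : ∀ β : Module.End A W, ∃ u : U, ∀ w : W, u • w = β w) (hne : ∃ w : W, c • w ≠ 0)
    (hne' : ∃ w : W, c' • w ≠ 0) {y : A} (hy : c' * y * c ≠ 0) :
    Nonempty (actImage U W c ≃ₗ[U] actImage U W c') := by
  have := h.isSimpleModule_actImage hU hne
  have := h'.isSimpleModule_actImage hU hne'
  -- The action of `c' y` commutes with `U`. It is nonzero on `c W` because some multiple of `c' y
  -- c` equals `c`; Schur's lemma makes it bijective.
  let φ : actImage U W c →ₗ[U] actImage U W c' :=
    { toFun := fun w => ⟨c' • y • (w : W), y • (w : W), rfl⟩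
      map_add' := fun v w => Subtype.ext (by simp)
      map_smul' := fun u w => Subtype.ext (by
        simp only [Submodule.coe_smul, RingHom.id_apply]
        rw [smul_comm y u, smul_comm c' u]) }
  have hφ : φ ≠ 0 := by
    obtain ⟨w, hw⟩ := hne
    obtain ⟨t, ht⟩ := h.exists_mul_eq hy
    intro h0
    have h1 : c' • y • c • w = 0 :=
      congrArg Subtype.val (LinearMap.congr_fun h0 (⟨c • w, w, rfl⟩ : actImage U W c))
    apply hw
    calc c • w = (c * t * (c' * y) * c) • w := by rw [ht]
      _ = (c * t) • c' • y • c • w := by simp only [mul_smul]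
      _ = 0 := by rw [h1, smul_zero]
  exact ⟨LinearEquiv.ofBijective φ (LinearMap.bijective_of_ne_zero hφ)⟩

/-! ### The pairing of `c W` with `A c` -/

variable [Module ℂ W] [IsScalarTower ℂ A W] [Algebra ℂ U] [IsScalarTower ℂ U W]

section Pairing

variable {c : A} {L : Type*} [AddCommGroup L] [Module ℂ L] [Module U L] [IsScalarTower ℂ U L]
  (θ : L ≃ₗ[U] actImage U W c) (x : A)

set_option linter.unusedSectionVars false in
theorem coe_equiv_smul (z : ℂ) (l : L) : ((θ (z • l) : actImage U W c) : W) = z • (θ l : W) := by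
  rw [← algebraMap_smul U z l, map_smul, Submodule.coe_smul, algebraMap_smul]

theorem smul_smul_comm_of_tower (a : A) (z : ℂ) (w : W) : a • z • w = z • a • w := by
  rw [← algebraMap_smul A z w, smul_smul, ← Algebra.commutes, ← smul_smul, algebraMap_smul]

/-- The map `l ⊗ s ↦ s x l` from `c W ⊗ A c` to `W`. -/
def evalPairing : L ⊗[ℂ] Submodule.span A {c} →ₗ[ℂ] W :=
  TensorProduct.lift (LinearMap.mk₂ ℂ
    (fun (l : L) (s : Submodule.span A {c}) => (s : A) • x • (θ l : W))
    (fun l l' s => by simp)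
    (fun z l s => by rw [coe_equiv_smul, smul_smul_comm_of_tower, smul_smul_comm_of_tower])
    (fun l s s' => by simp [add_smul]) (fun z l s => by simp))

theorem evalPairing_tmul (l : L) (s : Submodule.span A {c}) :
    evalPairing θ x (l ⊗ₜ s) = (s : A) • x • (θ l : W) := by
  simp [evalPairing]

theorem evalPairing_map (u : U) (s : A) (z : L ⊗[ℂ] Submodule.span A {c}) :
    evalPairing θ x (TensorProduct.map (Algebra.lsmul ℂ ℂ L u)
      (Algebra.lsmul ℂ ℂ (Submodule.span A {c}) s) z) = u • s • evalPairing θ x z := by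
  induction z using TensorProduct.induction_on with
  | zero => simp
  | add a b ha hb => rw [map_add, map_add, ha, hb, map_add, smul_add, smul_add]
  | tmul l t =>
    rw [TensorProduct.map_tmul, evalPairing_tmul, evalPairing_tmul]
    simp only [Algebra.lsmul_coe, map_smul, Submodule.coe_smul, smul_eq_mul]
    rw [smul_comm x u, smul_comm _ u, mul_smul]

theorem smul_evalPairing_eq_zero {c' : A} (h : ∀ y, c' * y * c = 0) (y : A)
    (z : L ⊗[ℂ] Submodule.span A {c}) : (c' * y) • evalPairing θ x z = 0 := by
  induction z using TensorProduct.induction_on with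
  | zero => simp
  | add a b ha hb => rw [map_add, smul_add, ha, hb, add_zero]
  | tmul l s =>
    obtain ⟨r, hr⟩ := Submodule.mem_span_singleton.mp s.2
    rw [evalPairing_tmul, smul_smul, ← hr, smul_eq_mul,
      show c' * y * (r * c) = c' * (y * r) * c by simp only [mul_assoc], h, zero_smul]

/-- Write `t = ∑ b_k ⊗ s_k` over a basis of `L`. Each `c y s_k` is a scalar `ζ_k c`, and `c x` is
the identity on `c W`, so acting by `c y` gives `θ (∑ ζ_k b_k)`. Independence forces all `ζ_k = 0`.
-/
theorem eq_zero_of_smul_evalPairing [IsSemisimpleRing A] (hc : ScalarCorner c)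
    (hx : c * x * c = c) (t : L ⊗[ℂ] Submodule.span A {c})
    (hi : ∀ y, (c * y) • evalPairing θ x t = 0) : t = 0 := by
  let b := Module.Basis.ofVectorSpace ℂ L
  obtain ⟨s, rfl⟩ := TensorProduct.eq_repr_basis_left b t
  suffices hs : s = 0 by simp [hs]
  ext j
  have hcs : ∀ y, c * y * (s j : A) = 0 := by
    intro y
    have hsc : ∀ k, ∃ z : ℂ, c * y * (s k : A) = z • c := by
      intro k
      obtain ⟨r, hr⟩ := Submodule.mem_span_singleton.mp (s k).2
      obtain ⟨z, hz⟩ := hc (y * r)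
      refine ⟨z, ?_⟩
      rw [← hz, ← hr, smul_eq_mul]
      simp only [mul_assoc]
    choose ζ hζ using hsc
    have h1 := hi y
    rw [Finsupp.sum, map_sum, Finset.smul_sum] at h1
    have h2 : ∀ k ∈ s.support, (c * y) • evalPairing θ x (b k ⊗ₜ s k) = (θ (ζ k • b k) : W) := by
      intro k _
      rw [evalPairing_tmul, smul_smul, hζ, smul_assoc,
        smul_eq_of_mem_actImage (U := U) hx (θ (b k)).2, coe_equiv_smul]
    rw [Finset.sum_congr rfl h2, ← Submodule.coe_sum, ← map_sum, ZeroMemClass.coe_eq_zero,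
      LinearEquiv.map_eq_zero_iff] at h1
    by_cases hj : j ∈ s.support
    · rw [hζ, linearIndependent_iff'.mp b.linearIndependent _ _ h1 j hj, zero_smul]
    · rw [Finsupp.notMem_support_iff.mp hj]
      simp
  -- With `s_j = r c` and `c A s_j = 0`, regularity yields `s_j = s_j t s_j = r (c t s_j) = 0`.
  obtain ⟨t, ht⟩ := exists_mul_mul_self_eq (s j : A)
  obtain ⟨r, hr⟩ := Submodule.mem_span_singleton.mp (s j).2
  change (s j : A) = 0
  rw [← ht]
  nth_rewrite 1 [← hr]
  rw [smul_eq_mul, mul_assoc r, mul_assoc r, hcs, mul_zero]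

end Pairing

/-- A bimodule is the direct sum of the tensor products `c W ⊗ A c`. -/
theorem exists_bimodule_decomposition [IsSemisimpleRing A] {Λ : Type*} [DecidableEq Λ]
    (c : Λ → A) (hcorner : ∀ i, ScalarCorner (c i))
    (horth : ∀ i j, i ≠ j → ∀ y, c i * y * c j = 0)
    (hspan : Submodule.span A {v : W | ∃ i w, v = c i • w} = ⊤)
    (L : Λ → Type*) [∀ i, AddCommGroup (L i)] [∀ i, Module ℂ (L i)] [∀ i, Module U (L i)]
    [∀ i, IsScalarTower ℂ U (L i)] (θ : ∀ i, L i ≃ₗ[U] actImage U W (c i)) :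
    ∃ e : W ≃ₗ[ℂ] ⨁ i, L i ⊗[ℂ] Submodule.span A {c i}, ∀ (u : U) (s : A) (w : W),
      e (u • s • w) = DirectSum.lmap (fun i => TensorProduct.map (Algebra.lsmul ℂ ℂ (L i) u)
        (Algebra.lsmul ℂ ℂ (Submodule.span A {c i}) s)) (e w) := by
  choose x hx using fun i => exists_mul_mul_self_eq (c i)
  refine exists_directSum_equiv c (fun i => evalPairing (θ i) (x i))
    (fun u s i => TensorProduct.map (Algebra.lsmul ℂ ℂ (L i) u)
        (Algebra.lsmul ℂ ℂ (Submodule.span A {c i}) s))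
    (fun u s i z => evalPairing_map (θ i) (x i) u s z)
    (fun i j hij y z => smul_evalPairing_eq_zero (θ j) (x j) (horth i j hij) y z)
    (fun i z h => eq_zero_of_smul_evalPairing (θ i) (x i) (hcorner i) (hx i) z h)
    (fun i w => ⟨(θ i).symm ⟨c i • w, w, rfl⟩ ⊗ₜ ⟨c i, Submodule.mem_span_singleton_self _⟩, ?_⟩)
    hspan
  -- The chosen preimage of `c w` is `θ⁻¹ (c w) ⊗ c`; it evaluates to `c x c w = c w`.
  rw [evalPairing_tmul, LinearEquiv.apply_symm_apply]
  exact smul_eq_of_mem_actImage (U := U) (hx i) ⟨w, rfl⟩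

/-- The double commutant of a semisimple algebra acting on a finite-dimensional space. -/
theorem exists_smul_eq_of_commute [IsSemisimpleRing A] [Module.Finite ℂ W] (T : Module.End ℂ W)
    (hT : ∀ (β : Module.End A W) (w : W), T (β w) = β (T w)) : ∃ a : A, ∀ w, a • w = T w := by
  let f : Module.End (Module.End A W) W :=
    { toFun := T
      map_add' := map_add T
      map_smul' := fun β w => hT β w }
  obtain ⟨s, hs⟩ := Module.Finite.fg_top (R := ℂ) (M := W)
  obtain ⟨a, ha⟩ := jacobson_density f s
  refine ⟨a, fun w => ?_⟩
  have hw : w ∈ Submodule.span ℂ (s : Set W) := by rw [hs]; trivial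
  -- Density matches `a` with `T` on a finite spanning set; both actions are `ℂ`-linear, so they
  -- agree everywhere.
  induction hw using Submodule.span_induction with
  | mem w hw => exact (ha w hw).symm
  | zero => simp
  | add v w _ _ hv hw => rw [smul_add, hv, hw, map_add]
  | smul z w _ hw =>
    rw [← algebraMap_smul A z w, smul_smul, ← Algebra.commutes, ← smul_smul, hw, algebraMap_smul,
      algebraMap_smul, map_smul]

end Bimodule

/-! ### Highest weight modules -/

theorem UEA.ι_mul_ι {m n : ℕ} {p q : ZMod 2} {x y : SuperGL m n} (hx : IsHomog p x)
    (hy : IsHomog q y) : UEA.ι m n x * UEA.ι m n y =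
      UEA.ι m n (superBracket p q x y) + ksign p q • (UEA.ι m n y * UEA.ι m n x) := by
  have h := RingQuot.mkAlgHom_rel ℂ (UEA.Rel.bracket (m := m) (n := n) p q x y hx hy)
  rw [map_mul, map_add, map_smul, map_mul] at h
  exact h

/-- The matrix unit `E_ij` in the enveloping algebra. -/
def unitE {m n : ℕ} (i j : Idx m n) : UEA m n := UEA.ι m n (Matrix.single i j 1)

/-- The position of an index in the total order of `I(m|n)`. -/
def pos {m n : ℕ} : Idx m n → ℕ
  | .inl i => i
  | .inr j => m + j

theorem toLex_lt_iff {m n : ℕ} {i j : Idx m n} : toLex i < toLex j ↔ pos i < pos j := by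
  rcases i with i | i <;> rcases j with j | j
  · simp [pos]
  · simp only [Sum.Lex.inl_lt_inr, pos, true_iff]; omega
  · simp only [Sum.Lex.not_inr_lt_inl, pos, false_iff]; omega
  · simp [pos]

theorem pos_injective {m n : ℕ} : Function.Injective (pos : Idx m n → ℕ) := by
  intro i j h
  rcases i with i | i <;> rcases j with j | j <;> simp only [pos] at h
  · exact congrArg _ (Fin.ext h)
  · omega
  · omega
  · exact congrArg _ (Fin.ext (by omega))

theorem unitE_mul_unitE {m n : ℕ} (i j k l : Idx m n) :
    unitE i j * unitE k l = (if j = k then unitE i l else 0) -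
      ksign (par i + par j) (par k + par l) • (if l = i then unitE k j else 0) +
      ksign (par i + par j) (par k + par l) • (unitE k l * unitE i j) := by
  rw [unitE, unitE, UEA.ι_mul_ι (isHomog_single i j 1) (isHomog_single k l 1), superBracket, map_sub,
    map_smul]
  congr 2
  · split_ifs with h
    · subst h; simp [unitE]
    · simp [h]
  · split_ifs with h
    · subst h; simp [unitE]
    · simp [h]

theorem UEA.ι_eq_sum {m n : ℕ} (x : SuperGL m n) :
    UEA.ι m n x = ∑ i, ∑ j, x i j • unitE i j := by
  conv_lhs => rw [Matrix.matrix_eq_sum_single x]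
  simp only [map_sum, unitE]
  refine Finset.sum_congr rfl fun i _ => Finset.sum_congr rfl fun j _ => ?_
  rw [← map_smul, Matrix.smul_single, smul_eq_mul, mul_one]

/-- The grading element `∑ pos(i) E_ii`. -/
def gradE (m n : ℕ) : UEA m n := ∑ i, (pos i : ℂ) • unitE i i

theorem ksign_self_add_left (p q : ZMod 2) : ksign (p + p) q = 1 := by
  rw [CharTwo.add_self_eq_zero, ksign_zero_left]

/-- The diagonal units are even, so no sign enters. Lower triangular units raise the eigenvalue of
this one operator, which serves in place of a full weight grading. -/
theorem gradE_mul_unitE {m n : ℕ} (i j : Idx m n) :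
    gradE m n * unitE i j = unitE i j * gradE m n + ((pos i : ℂ) - pos j) • unitE i j := by
  have h : ∀ k : Idx m n, (pos k : ℂ) • unitE k k * unitE i j = unitE i j * ((pos k : ℂ) • unitE k k)
      + ((if k = i then (pos i : ℂ) • unitE i j else 0) -
        (if k = j then (pos j : ℂ) • unitE i j else 0)) := by
    intro k
    rw [smul_mul_assoc, unitE_mul_unitE, ksign_self_add_left, one_smul, one_smul, mul_smul_comm,
      smul_add, smul_sub, add_comm]
    congr 2
    · split_ifs with h
      · rw [h]
      · rw [smul_zero]
    · rcases eq_or_ne k j with rfl | h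
      · rw [if_pos rfl, if_pos rfl]
      · rw [if_neg h, if_neg h.symm, smul_zero]
  rw [gradE, Finset.sum_mul, Finset.mul_sum, Finset.sum_congr rfl fun k _ => h k,
    Finset.sum_add_distrib, Finset.sum_sub_distrib, Finset.sum_ite_eq', Finset.sum_ite_eq',
    if_pos (Finset.mem_univ _), if_pos (Finset.mem_univ _), sub_smul]

section HighestWeight

variable {m n : ℕ} {M : Type*} [AddCommGroup M] [Module ℂ M] [Module (UEA m n) M]
  [IsScalarTower ℂ (UEA m n) M]

/-- `v` is a singular vector of weight `wt` for the standard Borel subalgebra. -/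
structure IsSingular (wt : Idx m n → ℂ) (v : M) : Prop where
  upper : ∀ i j : Idx m n, toLex i < toLex j → unitE i j • v = 0
  weight : ∀ i : Idx m n, unitE i i • v = wt i • v

/-- The value of a weight on the grading element. -/
def gradVal (wt : Idx m n → ℂ) : ℂ := ∑ i, (pos i : ℂ) * wt i

theorem gradE_smul {wt : Idx m n → ℂ} {v : M} (hv : ∀ i : Idx m n, unitE i i • v = wt i • v) :
    gradE m n • v = gradVal wt • v := by
  rw [gradE, gradVal, Finset.sum_smul, Finset.sum_smul]
  refine Finset.sum_congr rfl fun i _ => ?_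
  rw [smul_assoc, hv, smul_smul]

/-- The vectors obtained from `v` by applying `k` (counted with their heights) lower triangular
matrix units. -/
inductive IsLowerMonomial (m n : ℕ) {M : Type*} [AddCommGroup M] [Module (UEA m n) M] (v : M) :
    ℕ → M → Prop
  | base : IsLowerMonomial m n v 0 v
  | step {k : ℕ} {w : M} (i j : Idx m n) (hw : IsLowerMonomial m n v k w) (h : pos j < pos i) :
      IsLowerMonomial m n v (k + (pos i - pos j)) (unitE i j • w)

set_option linter.unusedSectionVars false in
theorem IsLowerMonomial.eq_of_zero {v w : M} (h : IsLowerMonomial m n v 0 w) : w = v := by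
  generalize hk : 0 = k at h
  cases h with
  | base => rfl
  | step i j hw h => omega

theorem IsLowerMonomial.gradE_smul {wt : Idx m n → ℂ} {v : M} (hv : IsSingular wt v) {k : ℕ} {w : M}
    (h : IsLowerMonomial m n v k w) : gradE m n • w = (gradVal wt + k) • w := by
  induction h with
  | base => rw [SchurSergeev.gradE_smul hv.weight, Nat.cast_zero, add_zero]
  | step i j hw h ih =>
    rw [smul_smul, gradE_mul_unitE, add_smul, mul_smul, ih, smul_assoc,
      smul_algebra_smul_comm, ← add_smul, Nat.cast_add, Nat.cast_sub h.le, add_assoc]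

/-- Commute `E_ij` past the outermost lower unit: the bracket terms are matrix units on a shorter
monomial, handled by induction. This spanning argument is the only trace of PBW. -/
theorem IsSingular.ι_smul_lowerMonomial_mem {wt : Idx m n → ℂ} {v : M} (hv : IsSingular wt v)
    {k : ℕ} {w : M} (h : IsLowerMonomial m n v k w) (x : SuperGL m n) :
    UEA.ι m n x • w ∈ Submodule.span ℂ {w : M | ∃ k, IsLowerMonomial m n v k w} := by
  set S := Submodule.span ℂ {w : M | ∃ k, IsLowerMonomial m n v k w} with hS
  have hlow : ∀ i j : Idx m n, pos j < pos i → ∀ w ∈ S, unitE i j • w ∈ S := by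
    intro i j hij w hw
    induction hw using Submodule.span_induction with
    | mem w hw => obtain ⟨k, hk⟩ := hw; exact Submodule.subset_span ⟨_, hk.step i j hij⟩
    | zero => rw [smul_zero]; exact zero_mem _
    | add a b _ _ ha hb => rw [smul_add]; exact add_mem ha hb
    | smul c a _ ha => rw [smul_algebra_smul_comm]; exact S.smul_mem c ha
  suffices hE : ∀ i j : Idx m n, unitE i j • w ∈ S by
    rw [UEA.ι_eq_sum, Finset.sum_smul]
    refine sum_mem fun i _ => ?_
    rw [Finset.sum_smul]
    refine sum_mem fun j _ => ?_
    rw [smul_assoc]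
    exact S.smul_mem _ (hE i j)
  induction h with
  | base =>
    intro i j
    have hvS : v ∈ S := Submodule.subset_span ⟨0, .base⟩
    rcases lt_trichotomy (pos i) (pos j) with h | h | h
    · rw [hv.upper i j (toLex_lt_iff.mpr h)]; exact zero_mem _
    · rw [pos_injective h, hv.weight]; exact S.smul_mem _ hvS
    · exact hlow i j h v hvS
  | @step k w a b hw hab ih =>
    intro i j
    rw [smul_smul, unitE_mul_unitE, add_smul, sub_smul, smul_assoc, smul_assoc, mul_smul]
    refine add_mem (sub_mem ?_ (S.smul_mem _ ?_)) (S.smul_mem _ (hlow a b hab _ (ih i j)))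
    · split_ifs
      · exact ih _ _
      · rw [zero_smul]; exact zero_mem _
    · split_ifs
      · exact ih _ _
      · rw [zero_smul]; exact zero_mem _

theorem IsSingular.span_lowerMonomial {wt : Idx m n → ℂ} {v : M} (hv : IsSingular wt v)
    (hgen : Submodule.span (UEA m n) {v} = ⊤) :
    Submodule.span ℂ {w : M | ∃ k, IsLowerMonomial m n v k w} = ⊤ := by
  rw [eq_top_iff]
  set S := Submodule.span ℂ {w : M | ∃ k, IsLowerMonomial m n v k w} with hS
  have hstab : ∀ u : UEA m n, ∀ w ∈ S, u • w ∈ S := by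
    intro u
    induction u using UEA.induction with
    | hι x =>
      intro w hw
      induction hw using Submodule.span_induction with
      | mem w hw => obtain ⟨k, hk⟩ := hw; exact hv.ι_smul_lowerMonomial_mem hk x
      | zero => rw [smul_zero]; exact zero_mem _
      | add a b _ _ ha hb => rw [smul_add]; exact add_mem ha hb
      | smul c a _ ha => rw [smul_algebra_smul_comm]; exact S.smul_mem c ha
    | halg c => intro w hw; rw [algebraMap_smul]; exact S.smul_mem c hw
    | hadd a b ha hb => intro w hw; rw [add_smul]; exact add_mem (ha w hw) (hb w hw)
    | hmul a b ha hb => intro w hw; rw [mul_smul]; exact ha _ (hb w hw)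
  intro w _
  have hw : w ∈ Submodule.span (UEA m n) {v} := by rw [hgen]; trivial
  obtain ⟨u, rfl⟩ := Submodule.mem_span_singleton.mp hw
  exact hstab u v (Submodule.subset_span ⟨0, .base⟩)

/-! ### Separating the highest weight vector by polynomials in the grading element -/

theorem aeval_smul_of_eigen {u : UEA m n} {z : ℂ} {w : M} (h : u • w = z • w)
    (p : Polynomial ℂ) : Polynomial.aeval u p • w = p.eval z • w := by
  induction p using Polynomial.induction_on' with
  | add p q hp hq => rw [map_add, add_smul, hp, hq, Polynomial.eval_add, add_smul]
  | monomial k a =>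
    rw [Polynomial.aeval_monomial, mul_smul, algebraMap_smul, Polynomial.eval_monomial, mul_smul]
    congr 1
    induction k with
    | zero => simp
    | succ k ih => rw [pow_succ, mul_smul, h, smul_algebra_smul_comm, ih, smul_smul, pow_succ, mul_comm]

/-- The polynomial with roots `z + 1, …, z + k`. -/
def shiftPoly (z : ℂ) (k : ℕ) : Polynomial ℂ :=
  ∏ l ∈ Finset.range k, (Polynomial.X - Polynomial.C (z + (l + 1 : ℕ)))

/-- At the grading element, `shiftPoly` kills the eigenvalues `z + 1, …, z + k` of lower monomials
but acts by a nonzero scalar on the highest weight vector. -/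
theorem shiftPoly_eval_ne_zero (z : ℂ) (k : ℕ) : (shiftPoly z k).eval z ≠ 0 := by
  rw [shiftPoly, Polynomial.eval_prod, Finset.prod_ne_zero_iff]
  intro l _
  simp only [Polynomial.eval_sub, Polynomial.eval_X, Polynomial.eval_C, sub_add_cancel_left]
  exact neg_ne_zero.mpr (Nat.cast_ne_zero.mpr l.succ_ne_zero)

theorem shiftPoly_eval_eq_zero (z : ℂ) {k : ℕ} (hk : k ≠ 0) :
    (shiftPoly z k).eval (z + k) = 0 := by
  rw [shiftPoly, Polynomial.eval_prod, Finset.prod_eq_zero (i := k - 1)]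
  · simp; omega
  · simp [Nat.sub_add_cancel (Nat.one_le_iff_ne_zero.mpr hk)]

theorem shiftPoly_dvd (z : ℂ) {k l : ℕ} (h : k ≤ l) : shiftPoly z k ∣ shiftPoly z l :=
  Finset.prod_dvd_prod_of_subset _ _ _ (Finset.range_mono h)

set_option linter.unusedSectionVars false in
theorem aeval_shiftPoly_smul_mono {z : ℂ} {k l : ℕ} (h : k ≤ l) {u : UEA m n} {w : M}
    (hw : Polynomial.aeval u (shiftPoly z k) • w = 0) :
    Polynomial.aeval u (shiftPoly z l) • w = 0 := by
  obtain ⟨q, hq⟩ := shiftPoly_dvd z h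
  rw [hq, mul_comm, map_mul, mul_smul, hw, smul_zero]

/-- Every vector of a highest weight module is a multiple of the highest weight vector up to
vectors of lower weights. -/
theorem IsSingular.exists_decomp {wt : Idx m n → ℂ} {v : M} (hv : IsSingular wt v)
    (hgen : Submodule.span (UEA m n) {v} = ⊤) (w : M) : ∃ (a : ℂ) (k : ℕ),
      Polynomial.aeval (gradE m n) (shiftPoly (gradVal wt) k) • (w - a • v) = 0 := by
  have hw : w ∈ Submodule.span ℂ {w : M | ∃ k, IsLowerMonomial m n v k w} := by
    rw [hv.span_lowerMonomial hgen]; trivial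
  induction hw using Submodule.span_induction with
  | mem w hw =>
    obtain ⟨k, hk⟩ := hw
    rcases eq_or_ne k 0 with rfl | hk0
    · exact ⟨1, 0, by rw [hk.eq_of_zero, one_smul, sub_self, smul_zero]⟩
    · refine ⟨0, k, ?_⟩
      rw [zero_smul, sub_zero, aeval_smul_of_eigen (hk.gradE_smul hv), shiftPoly_eval_eq_zero _ hk0,
        zero_smul]
  | zero => exact ⟨0, 0, by simp⟩
  | add x y _ _ hx hy =>
    obtain ⟨a, k, ha⟩ := hx
    obtain ⟨b, l, hb⟩ := hy
    refine ⟨a + b, max k l, ?_⟩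
    rw [add_smul, add_sub_add_comm, smul_add, aeval_shiftPoly_smul_mono (le_max_left k l) ha,
      aeval_shiftPoly_smul_mono (le_max_right k l) hb, add_zero]
  | smul c x _ hx =>
    obtain ⟨a, k, ha⟩ := hx
    refine ⟨c * a, k, ?_⟩
    rw [mul_smul, ← smul_sub, smul_algebra_smul_comm, ha, smul_zero]

/-- Write `w` as `a • v` plus lower terms killed by the polynomial. If `a ≠ 0`, the polynomial maps
`w` to a nonzero multiple of `v`, which would put the generator in `N`. -/
theorem IsSingular.aeval_smul_eq_zero_of_mem {wt : Idx m n → ℂ} {v : M} (hv : IsSingular wt v)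
    (hgen : Submodule.span (UEA m n) {v} = ⊤) {N : Submodule (UEA m n) M} (hN : N ≠ ⊤) {w : M}
    (hw : w ∈ N) :
    ∃ k, Polynomial.aeval (gradE m n) (shiftPoly (gradVal wt) k) • w = 0 := by
  obtain ⟨a, k, h⟩ := hv.exists_decomp hgen w
  refine ⟨k, ?_⟩
  have h1 : Polynomial.aeval (gradE m n) (shiftPoly (gradVal wt) k) • w =
      ((shiftPoly (gradVal wt) k).eval (gradVal wt) * a) • v := by
    rw [smul_sub, sub_eq_zero] at h
    rw [h, smul_algebra_smul_comm, aeval_smul_of_eigen (gradE_smul hv.weight), smul_smul, mul_comm]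
  have ha : (shiftPoly (gradVal wt) k).eval (gradVal wt) * a = 0 := by
    by_contra ha
    apply hN
    rw [eq_top_iff, ← hgen, Submodule.span_singleton_le_iff_mem]
    have h2 : algebraMap ℂ (UEA m n) ((shiftPoly (gradVal wt) k).eval (gradVal wt) * a)⁻¹ •
        Polynomial.aeval (gradE m n) (shiftPoly (gradVal wt) k) • w ∈ N :=
      N.smul_mem _ (N.smul_mem _ hw)
    rwa [h1, algebraMap_smul, smul_smul, inv_mul_cancel₀ ha, one_smul] at h2
  rw [h1, ha, zero_smul]

/-- The sum of the proper submodules of a highest weight module is proper. -/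
theorem IsSingular.isCoatom_sSup {wt : Idx m n → ℂ} {v : M} (hv : IsSingular wt v)
    (hgen : Submodule.span (UEA m n) {v} = ⊤) (hv0 : v ≠ 0) :
    IsCoatom (sSup {N : Submodule (UEA m n) M | N ≠ ⊤}) := by
  constructor
  · intro htop
    have hmem : v ∈ sSup {N : Submodule (UEA m n) M | N ≠ ⊤} := by rw [htop]; trivial
    -- Being killed by some `shiftPoly` passes to sums, hence to the whole supremum; the vector `v`
    -- itself is never killed.
    have key : ∀ w ∈ sSup {N : Submodule (UEA m n) M | N ≠ ⊤},
        ∃ k, Polynomial.aeval (gradE m n) (shiftPoly (gradVal wt) k) • w = 0 := by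
      intro w hmem
      rw [sSup_eq_iSup'] at hmem
      induction hmem using Submodule.iSup_induction' with
      | mem N x hx => exact hv.aeval_smul_eq_zero_of_mem hgen N.2 hx
      | zero => exact ⟨0, smul_zero _⟩
      | add x y _ _ hx hy =>
        obtain ⟨k, hk⟩ := hx
        obtain ⟨l, hl⟩ := hy
        exact ⟨max k l, by rw [smul_add, aeval_shiftPoly_smul_mono (le_max_left k l) hk,
          aeval_shiftPoly_smul_mono (le_max_right k l) hl, add_zero]⟩
    obtain ⟨k, hk⟩ := key v hmem
    rw [aeval_smul_of_eigen (gradE_smul hv.weight)] at hk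
    exact (smul_ne_zero (shiftPoly_eval_ne_zero _ k) hv0) hk
  · intro N hN
    by_contra hne
    exact hN.not_ge (le_sSup hne)

/-- The weights of a highest weight module are bounded by the highest weight. -/
theorem IsSingular.weight_le {wt : Idx m n → ℂ} {v : M} (hv : IsSingular wt v)
    (hgen : Submodule.span (UEA m n) {v} = ⊤) {wt' : Idx m n → ℂ} {w : M} (hw0 : w ≠ 0)
    (hw : ∀ i : Idx m n, unitE i i • w = wt' i • w) :
    (gradVal wt' = gradVal wt ∧ wt' = wt) ∨ ∃ k : ℕ, k ≠ 0 ∧ gradVal wt' = gradVal wt + k := by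
  obtain ⟨a, k, h⟩ := hv.exists_decomp hgen w
  rw [smul_sub, sub_eq_zero, smul_algebra_smul_comm, aeval_smul_of_eigen (gradE_smul hv.weight),
    aeval_smul_of_eigen (gradE_smul hw)] at h
  -- Either the grading of `w` is one of the roots, strictly beyond that of `v`, or the polynomial
  -- can be inverted on `w`, making `w` a multiple of `v`.
  by_cases hq : (shiftPoly (gradVal wt) k).eval (gradVal wt') = 0
  · right
    rw [shiftPoly, Polynomial.eval_prod, Finset.prod_eq_zero_iff] at hq
    obtain ⟨l, -, hl⟩ := hq
    refine ⟨l + 1, l.succ_ne_zero, ?_⟩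
    simpa [sub_eq_zero] using hl
  · left
    obtain ⟨b, rfl⟩ : ∃ b : ℂ, w = b • v := by
      refine ⟨((shiftPoly (gradVal wt) k).eval (gradVal wt'))⁻¹ *
        (a * (shiftPoly (gradVal wt) k).eval (gradVal wt)), ?_⟩
      rw [mul_smul, mul_smul, ← h, smul_smul, inv_mul_cancel₀ hq, one_smul]
    have : wt' = wt := by
      funext i
      have h1 := hw i
      rw [smul_algebra_smul_comm, hv.weight, smul_comm] at h1
      exact (smul_left_injective ℂ hw0 h1).symm
    exact ⟨by rw [this], this⟩

end HighestWeight

/-! ### The simple modules `L(wt)` -/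

section Simple

variable {m n : ℕ} {M : Type*} [AddCommGroup M] [Module ℂ M] [Module (UEA m n) M]
  [IsScalarTower ℂ (UEA m n) M]

theorem isSingular_mk_one (wt : Idx m n → ℂ) :
    IsSingular wt (Submodule.Quotient.mk 1 : Verma wt) := by
  constructor
  · intro i j h
    rw [← Submodule.Quotient.mk_smul, smul_eq_mul, mul_one, Submodule.Quotient.mk_eq_zero]
    exact Submodule.subset_span (Or.inl ⟨i, j, h, rfl⟩)
  · intro i
    rw [← algebraMap_smul (UEA m n) (wt i), ← Submodule.Quotient.mk_smul,
      ← Submodule.Quotient.mk_smul, smul_eq_mul, mul_one, smul_eq_mul, mul_one,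
      Submodule.Quotient.eq]
    exact Submodule.subset_span (Or.inr ⟨i, rfl⟩)

theorem span_mk_one (I : Submodule (UEA m n) (UEA m n)) :
    Submodule.span (UEA m n) {(Submodule.Quotient.mk 1 : UEA m n ⧸ I)} = ⊤ := by
  rw [eq_top_iff]
  rintro ⟨u⟩ _
  refine Submodule.mem_span_singleton.mpr ⟨u, ?_⟩
  rw [← Submodule.Quotient.mk_smul, smul_eq_mul, mul_one]
  rfl

/-- A singular vector is the image of the generator of a Verma module. -/
theorem IsSingular.exists_vermaHom {wt : Idx m n → ℂ} {v : M} (hv : IsSingular wt v) :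
    ∃ φ : Verma wt →ₗ[UEA m n] M, φ (Submodule.Quotient.mk 1) = v := by
  refine ⟨(vermaIdeal wt).liftQ (LinearMap.toSpanSingleton (UEA m n) M v) ?_, ?_⟩
  · rw [vermaIdeal, Submodule.span_le]
    rintro _ (⟨i, j, h, rfl⟩ | ⟨i, rfl⟩)
    · simpa [unitE] using hv.upper i j h
    · simpa [sub_smul, sub_eq_zero, unitE] using hv.weight i
  · rw [Submodule.liftQ_apply]
    simp

/-- A nonzero singular vector in any module is enough to show that the Verma module is nonzero. -/
theorem mk_one_ne_zero_of_singular {wt : Idx m n → ℂ} {v : M} (hv : IsSingular wt v) (hv0 : v ≠ 0) :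
    (Submodule.Quotient.mk 1 : Verma wt) ≠ 0 := by
  obtain ⟨φ, hφ⟩ := hv.exists_vermaHom
  intro h
  rw [h, map_zero] at hφ
  exact hv0 hφ.symm

theorem IsSingular.isSimpleModule_L {wt : Idx m n → ℂ} {v : M} (hv : IsSingular wt v)
    (hv0 : v ≠ 0) : IsSimpleModule (UEA m n) (L wt) := by
  rw [isSimpleModule_iff_isCoatom]
  exact (isSingular_mk_one wt).isCoatom_sSup (span_mk_one _) (mk_one_ne_zero_of_singular hv hv0)

/-- The module `L(wt)` is a quotient of every module generated by a singular vector of weight `wt`. -/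
theorem IsSingular.exists_surjective {wt : Idx m n → ℂ} {v : M} (hv : IsSingular wt v)
    (hv0 : v ≠ 0) (hgen : Submodule.span (UEA m n) {v} = ⊤) :
    ∃ φ : M →ₗ[UEA m n] L wt, Function.Surjective φ := by
  obtain ⟨φ, hφ⟩ := hv.exists_vermaHom
  have hsurj : Function.Surjective φ := by
    rw [← LinearMap.range_eq_top, eq_top_iff, ← hgen, Submodule.span_singleton_le_iff_mem]
    exact ⟨_, hφ⟩
  -- The kernel is a proper submodule, so it is one of those summed in the definition of `L`.
  have hker : LinearMap.ker φ ≤ sSup {N : Submodule (UEA m n) (Verma wt) | N ≠ ⊤} := by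
    refine le_sSup fun htop => hv0 ?_
    rw [← hφ]
    exact LinearMap.congr_fun (LinearMap.ker_eq_top.mp htop) _
  refine ⟨Submodule.factor hker ∘ₗ (φ.quotKerEquivOfSurjective hsurj).symm.toLinearMap, ?_⟩
  rw [LinearMap.coe_comp]
  exact (Submodule.factor_surjective hker).comp (LinearEquiv.surjective _)

theorem IsSingular.nonempty_equiv_L {wt : Idx m n → ℂ} {v : M} (hv : IsSingular wt v)
    (hv0 : v ≠ 0) [IsSimpleModule (UEA m n) M] : Nonempty (L wt ≃ₗ[UEA m n] M) := by
  have := hv.isSimpleModule_L hv0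
  obtain ⟨φ, hφ⟩ := hv.exists_surjective hv0 (IsSimpleModule.span_singleton_eq_top _ hv0)
  have h0 : φ ≠ 0 := by
    rintro rfl
    have := IsSimpleModule.nontrivial (UEA m n) (L wt)
    obtain ⟨l, hl⟩ := exists_ne (0 : L wt)
    obtain ⟨w, hw⟩ := hφ l
    exact hl hw.symm
  exact ⟨(LinearEquiv.ofBijective φ (LinearMap.bijective_of_ne_zero h0)).symm⟩

theorem IsSingular.map {M' : Type*} [AddCommGroup M'] [Module ℂ M'] [Module (UEA m n) M']
    [IsScalarTower ℂ (UEA m n) M'] {wt : Idx m n → ℂ} {v : M} (hv : IsSingular wt v)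
    (φ : M →ₗ[UEA m n] M') : IsSingular wt (φ v) := by
  constructor
  · intro i j h
    rw [← map_smul, hv.upper i j h, map_zero]
  · intro i
    rw [← map_smul, hv.weight i, ← algebraMap_smul (UEA m n) (wt i) v, map_smul, algebraMap_smul]

/-- Simple modules of different highest weights are not isomorphic. -/
theorem weight_eq_of_equiv {M' : Type*} [AddCommGroup M'] [Module ℂ M'] [Module (UEA m n) M']
    [IsScalarTower ℂ (UEA m n) M'] [IsSimpleModule (UEA m n) M] [IsSimpleModule (UEA m n) M']
    {wt wt' : Idx m n → ℂ} {v : M} {v' : M'} (hv : IsSingular wt v) (hv0 : v ≠ 0)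
    (hv' : IsSingular wt' v') (hv0' : v' ≠ 0) (e : M ≃ₗ[UEA m n] M') : wt = wt' := by
  have hgen := IsSimpleModule.span_singleton_eq_top (UEA m n) hv0
  have hgen' := IsSimpleModule.span_singleton_eq_top (UEA m n) hv0'
  have h1 := hv'.weight_le hgen' (w := e v) (by simpa using hv0) (hv.map e.toLinearMap).weight
  have h2 := hv.weight_le hgen (w := e.symm v') (by simpa using hv0')
    (hv'.map e.symm.toLinearMap).weight
  rcases h1 with ⟨-, h1⟩ | ⟨k, hk, h1⟩
  · exact h1
  rcases h2 with ⟨-, h2⟩ | ⟨l, hl, h2⟩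
  · exact h2.symm
  -- Otherwise each of the two grading values exceeds the other by a positive integer.
  exfalso
  rw [h2, add_assoc, left_eq_add] at h1
  have : (l + k : ℕ) = 0 := by exact_mod_cast h1
  omega

end Simple

/-! ### Tensor space as a module over both algebras -/

instance (m n d : ℕ) : Module (UEA m n) (W m n d) :=
  Module.compHom (W m n d) (Φ m n d).toRingHom

instance (m n d : ℕ) : Module (GroupAlg d) (W m n d) :=
  Module.compHom (W m n d) (Ψ m n d).toRingHom

theorem UEA_smul_def {m n d : ℕ} (u : UEA m n) (w : W m n d) : u • w = Φ m n d u w := rfl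

theorem groupAlg_smul_def {m n d : ℕ} (s : GroupAlg d) (w : W m n d) : s • w = Ψ m n d s w := rfl

instance (m n d : ℕ) : IsScalarTower ℂ (UEA m n) (W m n d) where
  smul_assoc z u w := by rw [UEA_smul_def, map_smul]; rfl

instance (m n d : ℕ) : IsScalarTower ℂ (GroupAlg d) (W m n d) where
  smul_assoc z u w := by rw [groupAlg_smul_def, map_smul]; rfl

instance (m n d : ℕ) : SMulCommClass (GroupAlg d) (UEA m n) (W m n d) where
  smul_comm s u w := LinearMap.congr_fun (Φ_commute_Ψ u s) w

instance (m n d : ℕ) : Module.Finite ℂ (W m n d) := Module.Finite.of_basis (tensorBasis m n d)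

theorem mem_range_Φ_of_linear {m n d : ℕ} (β : Module.End (GroupAlg d) (W m n d)) :
    ∃ u : UEA m n, ∀ w : W m n d, u • w = β w := by
  let β' : Module.End ℂ (W m n d) := β.restrictScalars ℂ
  obtain ⟨u, hu⟩ := mem_range_Φ_of_commute β' fun σ => by
    refine LinearMap.ext fun w => ?_
    rw [← Ψ_of]
    exact (β.map_smul (MonoidAlgebra.of ℂ _ σ) w).symm
  exact ⟨u, fun w => LinearMap.congr_fun hu w⟩

theorem unitE_smul_basis {m n d : ℕ} (i j : Idx m n) (f : Fin d → Idx m n) :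
    unitE i j • tensorBasis m n d f = ∑ k : Fin d, if f k = j then
      slotSign (par i + par j) k f • tensorBasis m n d (Function.update f k i) else 0 := by
  rw [UEA_smul_def, unitE, Φ_ι, glAct_of_isHomog d (isHomog_single i j 1), LinearMap.sum_apply]
  exact Finset.sum_congr rfl fun k _ => slot_single_basis _ k i j f

/-- The number of occurrences of a letter. -/
def content {m n d : ℕ} (f : Fin d → Idx m n) (i : Idx m n) : ℕ :=
  (Finset.univ.filter fun k => f k = i).card

theorem unitE_self_smul_basis {m n d : ℕ} (i : Idx m n) (f : Fin d → Idx m n) :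
    unitE i i • tensorBasis m n d f = (content f i : ℂ) • tensorBasis m n d f := by
  rw [unitE_smul_basis, content, Finset.cast_card, Finset.sum_smul, Finset.sum_filter]
  refine Finset.sum_congr rfl fun k _ => ?_
  split_ifs with h
  · rw [← h, Function.update_eq_self, CharTwo.add_self_eq_zero, slotSign]
    simp [ksign_zero_left]
  · rfl

theorem repr_unitE_self_smul {m n d : ℕ} (i : Idx m n) (w : W m n d) (f : Fin d → Idx m n) :
    (tensorBasis m n d).repr (unitE i i • w) f = content f i * (tensorBasis m n d).repr w f := by
  have h1 : unitE i i • w =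
      ∑ g, ((tensorBasis m n d).repr w g * content g i) • tensorBasis m n d g := by
    conv_lhs => rw [← (tensorBasis m n d).sum_repr w]
    rw [Finset.smul_sum]
    refine Finset.sum_congr rfl fun g _ => ?_
    rw [smul_algebra_smul_comm, unitE_self_smul_basis, smul_smul]
  rw [h1, Module.Basis.repr_sum_self, mul_comm]

/-- The weights of tensor space are the contents of words. -/
theorem exists_content_eq {m n d : ℕ} {wt : Idx m n → ℂ} {w : W m n d} (hw0 : w ≠ 0)
    (hw : ∀ i : Idx m n, unitE i i • w = wt i • w) :
    ∃ f : Fin d → Idx m n, ∀ i, wt i = content f i := by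
  obtain ⟨f, hf⟩ : ∃ f, (tensorBasis m n d).repr w f ≠ 0 := by
    by_contra! h
    exact hw0 ((tensorBasis m n d).ext_elem fun f => by simp [h f])
  refine ⟨f, fun i => ?_⟩
  have h1 := repr_unitE_self_smul i w f
  rw [hw i, map_smul, Finsupp.smul_apply, smul_eq_mul] at h1
  exact mul_right_cancel₀ hf h1

theorem sum_content {m n d : ℕ} (f : Fin d → Idx m n) : ∑ i, content f i = d := by
  have := Finset.card_eq_sum_card_fiberwise (f := f) (s := Finset.univ) (t := Finset.univ)
    (fun _ _ => Finset.mem_coe.mpr (Finset.mem_univ _))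
  simpa [content] using this.symm

theorem content_comp_perm {m n d : ℕ} (f : Fin d → Idx m n) (σ : Equiv.Perm (Fin d)) :
    content (f ∘ σ) = content f := by
  funext i
  refine Finset.card_bij (fun k _ => σ k) ?_ ?_ ?_
  · intro k hk; simpa using hk
  · intro k _ l _ h; exact σ.injective h
  · intro k hk; exact ⟨σ.symm k, by simpa using hk, by simp⟩

theorem unitE_smul_weight {m n : ℕ} {M : Type*} [AddCommGroup M] [Module ℂ M] [Module (UEA m n) M]
    [IsScalarTower ℂ (UEA m n) M] {wt : Idx m n → ℂ} {w : M}
    (hw : ∀ i : Idx m n, unitE i i • w = wt i • w) (a b i : Idx m n) :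
    unitE i i • unitE a b • w =
      (wt i + (if i = a then 1 else 0) - (if i = b then 1 else 0)) • unitE a b • w := by
  rw [smul_smul, unitE_mul_unitE, ksign_self_add_left, one_smul, one_smul, add_smul, mul_smul, hw,
    smul_algebra_smul_comm, sub_smul, sub_smul, add_smul, add_comm, add_sub_assoc]
  congr 2
  · split_ifs with h
    · rw [h, one_smul]
    · rw [zero_smul, zero_smul]
  · rcases eq_or_ne i b with rfl | h
    · rw [if_pos rfl, if_pos rfl, one_smul]
    · rw [if_neg h, if_neg h.symm, zero_smul, zero_smul]

/-- A nonzero submodule of tensor space contains a singular vector. -/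
theorem exists_isSingular_mem {m n d : ℕ} (N : Submodule (UEA m n) (W m n d)) (hN : N ≠ ⊥) :
    ∃ (wt : Idx m n → ℂ) (v : W m n d), v ∈ N ∧ v ≠ 0 ∧ IsSingular wt v := by
  classical
  -- The singular vector will be a weight vector of `N` with least grading value, a natural number
  -- since weights are contents of words.
  have hex : ∃ s : ℕ, ∃ (wt : Idx m n → ℂ) (w : W m n d), w ∈ N ∧ w ≠ 0 ∧
      (∀ i : Idx m n, unitE i i • w = wt i • w) ∧ gradVal wt = s := by
    obtain ⟨w, hwN, hw0⟩ := N.ne_bot_iff.mp hN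
    obtain ⟨f, hf⟩ : ∃ f, (tensorBasis m n d).repr w f ≠ 0 := by
      by_contra! h
      exact hw0 ((tensorBasis m n d).ext_elem fun f => by simp [h f])
    let P : Module.End ℂ (W m n d) := (tensorBasis m n d).constr ℂ fun g =>
      if content g = content f then tensorBasis m n d g else 0
    have hP : ∀ g, P (tensorBasis m n d g) =
        if content g = content f then tensorBasis m n d g else 0 :=
      fun g => (tensorBasis m n d).constr_basis ℂ _ g
    -- The projection to one content commutes with `𝔖_d`, so it comes from `U` and preserves `N`:
    -- thus `N` contains weight vectors.
    obtain ⟨u, hu⟩ := mem_range_Φ_of_commute P fun σ => by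
      refine (tensorBasis m n d).ext fun g => ?_
      rw [Module.End.mul_apply, Module.End.mul_apply, permOp_basis, map_smul, hP, hP,
        content_comp_perm]
      split_ifs
      · rw [permOp_basis]
      · rw [map_zero, smul_zero]
    have hPw : P w = ∑ g, (if content g = content f then (tensorBasis m n d).repr w g else 0) •
        tensorBasis m n d g := by
      conv_lhs => rw [← (tensorBasis m n d).sum_repr w]
      rw [map_sum]
      refine Finset.sum_congr rfl fun g _ => ?_
      rw [map_smul, hP]
      split_ifs <;> simp
    refine ⟨∑ i, pos i * content f i, fun i => content f i, P w, ?_, ?_, ?_, ?_⟩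
    · have h1 : P w = u • w := LinearMap.congr_fun hu.symm w
      rw [h1]
      exact N.smul_mem u hwN
    · intro h0
      have h1 := congrArg (fun v => (tensorBasis m n d).repr v f) h0
      simp only [hPw, Module.Basis.repr_sum_self] at h1
      simp [hf] at h1
    · intro i
      rw [hPw, Finset.smul_sum, Finset.smul_sum]
      refine Finset.sum_congr rfl fun g _ => ?_
      rw [smul_algebra_smul_comm, unitE_self_smul_basis]
      split_ifs with h
      · rw [h, smul_comm]
      · rw [zero_smul, zero_smul, smul_zero]
    · simp [gradVal, -Fintype.sum_sum_type]
  obtain ⟨wt, w, hwN, hw0, hw, hs⟩ := Nat.find_spec hex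
  refine ⟨wt, w, hwN, hw0, fun i j hij => ?_, hw⟩
  by_contra h0
  have hij : pos i < pos j := toLex_lt_iff.mp hij
  have hw' := unitE_smul_weight hw i j
  obtain ⟨f, hf⟩ := exists_content_eq h0 hw'
  have hgr : gradVal (fun l => wt l + (if l = i then 1 else 0) - (if l = j then 1 else 0)) =
      gradVal wt + pos i - pos j := by
    simp only [gradVal, mul_sub, mul_add, Finset.sum_sub_distrib, Finset.sum_add_distrib]
    simp [-Fintype.sum_sum_type]
  have hs' : gradVal (fun l => wt l + (if l = i then 1 else 0) - (if l = j then 1 else 0)) =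
      (∑ l, pos l * content f l : ℕ) := by
    rw [funext hf]
    simp [gradVal, -Fintype.sum_sum_type]
  -- An upper unit `E_ij` changes the grading by `pos i - pos j < 0`, against minimality.
  have hlt : ∑ l, pos l * content f l < Nat.find hex := by
    rw [hgr, hs] at hs'
    have h1 : Nat.find hex + pos i = (∑ l, pos l * content f l) + pos j := by
      have : (Nat.find hex : ℂ) + pos i = (∑ l, pos l * content f l : ℕ) + pos j := by
        rw [← hs']; ring
      exact_mod_cast this
    omega
  exact Nat.find_min hex hlt ⟨_, _, N.smul_mem _ hwN, h0, hw', hs'⟩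

/-! ### The highest weights of tensor space -/

theorem ksign_one_one : ksign 1 1 = -1 := by
  simp [ksign, ZMod.val_one]

/-- Equal parities make `E_ij`, `E_ji` even, so the usual `sl_2` computation applies without signs.
-/
theorem IsSingular.unitE_smul_pow {m n : ℕ} {M : Type*} [AddCommGroup M] [Module ℂ M]
    [Module (UEA m n) M] [IsScalarTower ℂ (UEA m n) M] {wt : Idx m n → ℂ} {v : M}
    (hv : IsSingular wt v) {i j : Idx m n} (hij : pos i < pos j) (hpar : par i = par j) (k : ℕ) :
    unitE j j • unitE j i ^ k • v = (wt j + k) • unitE j i ^ k • v ∧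
    unitE i i • unitE j i ^ k • v = (wt i - k) • unitE j i ^ k • v ∧
    unitE i j • unitE j i ^ (k + 1) • v =
      ((k + 1) * (wt i - wt j - k) : ℂ) • unitE j i ^ k • v := by
  have hne : i ≠ j := fun h => hij.ne (congrArg pos h)
  have hef : unitE i j * unitE j i = unitE i i - unitE j j + unitE j i * unitE i j := by
    rw [unitE_mul_unitE, if_pos rfl, if_pos rfl, hpar, ksign_self_add_left, one_smul, one_smul]
  have hjf : unitE j j * unitE j i = unitE j i + unitE j i * unitE j j := by
    rw [unitE_mul_unitE, if_pos rfl, if_neg hne, ksign_self_add_left, one_smul, one_smul, sub_zero]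
  have hif : unitE i i * unitE j i = unitE j i * unitE i i - unitE j i := by
    rw [unitE_mul_unitE, if_neg hne, if_pos rfl, ksign_self_add_left, one_smul, one_smul]
    abel
  induction k with
  | zero =>
    refine ⟨by simpa using hv.weight j, by simpa using hv.weight i, ?_⟩
    rw [zero_add, pow_one, pow_zero, one_smul, smul_smul, hef, add_smul, sub_smul, mul_smul,
      hv.upper i j (toLex_lt_iff.mpr hij), hv.weight, hv.weight, smul_zero, add_zero, ← sub_smul]
    simp
  | succ k ih =>
    obtain ⟨h1, h2, h3⟩ := ih
    have h1' : unitE j j • unitE j i ^ (k + 1) • v =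
        (wt j + (k + 1 : ℕ)) • unitE j i ^ (k + 1) • v := by
      rw [pow_succ', mul_smul, smul_smul (unitE j j), hjf, add_smul, mul_smul, h1,
        smul_algebra_smul_comm]
      generalize unitE j i • unitE j i ^ k • v = y
      push_cast
      module
    have h2' : unitE i i • unitE j i ^ (k + 1) • v =
        (wt i - (k + 1 : ℕ)) • unitE j i ^ (k + 1) • v := by
      rw [pow_succ', mul_smul, smul_smul (unitE i i), hif, sub_smul, mul_smul, h2,
        smul_algebra_smul_comm]
      generalize unitE j i • unitE j i ^ k • v = y
      push_cast
      module
    refine ⟨h1', h2', ?_⟩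
    rw [pow_succ' _ (k + 1), mul_smul, smul_smul (unitE i j), hef, add_smul, sub_smul, mul_smul, h3,
      h1', h2', smul_algebra_smul_comm, smul_smul (unitE j i), ← pow_succ']
    generalize unitE j i ^ (k + 1) • v = y
    push_cast
    module

theorem weight_ne_neg_one {m n d : ℕ} {wt : Idx m n → ℂ} {w : W m n d} {i : Idx m n} (hw0 : w ≠ 0)
    (hw : ∀ i : Idx m n, unitE i i • w = wt i • w) : wt i ≠ -1 := by
  obtain ⟨f, hf⟩ := exists_content_eq hw0 hw
  rw [hf]
  intro h
  have : (content f i + 1 : ℕ) = 0 := by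
    have : ((content f i + 1 : ℕ) : ℂ) = 0 := by push_cast; rw [h]; ring
    exact_mod_cast this
  omega

theorem unitE_pow_smul_weight {m n : ℕ} {M : Type*} [AddCommGroup M] [Module ℂ M]
    [Module (UEA m n) M] [IsScalarTower ℂ (UEA m n) M] {wt : Idx m n → ℂ} {w : M}
    (hw : ∀ i : Idx m n, unitE i i • w = wt i • w) (a b : Idx m n) (k : ℕ) (i : Idx m n) :
    unitE i i • unitE a b ^ k • w =
      (wt i + k * (if i = a then 1 else 0) - k * (if i = b then 1 else 0)) • unitE a b ^ k • w := by
  induction k generalizing i with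
  | zero => simpa using hw i
  | succ k ih =>
    rw [pow_succ', mul_smul, unitE_smul_weight ih]
    congr 1
    push_cast
    ring

/-- The highest weights of tensor space are dominant for the even part. -/
theorem IsSingular.content_le {m n d : ℕ} {f : Fin d → Idx m n} {v : W m n d}
    (hv : IsSingular (fun i => (content f i : ℂ)) v) (hv0 : v ≠ 0) {i j : Idx m n}
    (hij : pos i < pos j) (hpar : par i = par j) : content f j ≤ content f i := by
  by_contra! hlt
  -- If `wt i < wt j`, the scalar `(k + 1) (wt i - wt j - k)` never vanishes. After `content f i +
  -- 1` steps the weight at `i` would then be `-1`, which no word has.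
  have hne : ∀ k : ℕ, unitE j i ^ k • v ≠ 0 := by
    intro k
    induction k with
    | zero => simpa using hv0
    | succ k ih =>
      intro h0
      have h1 := (hv.unitE_smul_pow hij hpar k).2.2
      rw [h0, smul_zero] at h1
      refine (smul_ne_zero (mul_ne_zero ?_ ?_) ih) h1.symm
      · exact_mod_cast k.succ_ne_zero
      · intro h2
        have h3 : (content f i : ℂ) = (content f j + k : ℕ) := by
          push_cast; linear_combination h2
        have : content f i = content f j + k := by exact_mod_cast h3
        omega
  refine weight_ne_neg_one (i := i) (hne (content f i + 1)) (unitE_pow_smul_weight hv.weight j i _) ?_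
  have : i ≠ j := fun h => hij.ne (congrArg pos h)
  simp [this]

/-- The vectors `E_{k-1, i} ⋯ E_{0, i} v` for an even index `i` and odd indices `0, …, k - 1`. -/
def oddString {m n : ℕ} {M : Type*} [AddCommGroup M] [Module (UEA m n) M] (i : Fin m) (v : M) :
    ℕ → M
  | 0 => v
  | k + 1 => if h : k < n then
      (unitE (.inr ⟨k, h⟩) (.inl i) : UEA m n) • oddString (n := n) i v k else 0

theorem IsSingular.oddString_weight {m n : ℕ} {M : Type*} [AddCommGroup M] [Module ℂ M]
    [Module (UEA m n) M] [IsScalarTower ℂ (UEA m n) M] {wt : Idx m n → ℂ} {v : M}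
    (hv : IsSingular wt v) (i : Fin m) (k : ℕ) (l : Idx m n) :
    unitE l l • oddString (n := n) i v k = (wt l + (match l with
      | .inl i' => if i' = i then -(k : ℂ) else 0
      | .inr j => if (j : ℕ) < k then 1 else 0)) • oddString (n := n) i v k := by
  induction k generalizing l with
  | zero => rcases l with i' | j <;> simpa [oddString] using hv.weight _
  | succ k ih =>
    rw [oddString]
    split_ifs with h
    · rw [unitE_smul_weight ih]
      congr 1
      rcases l with i' | j
      · by_cases h' : i' = i
        · simp [h']; ring
        · simp [h']
      · simp only [Sum.inr.injEq, reduceCtorEq, if_false, sub_zero, add_assoc, Fin.ext_iff]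
        congr 1
        rcases lt_trichotomy (j : ℕ) k with h' | h' | h'
        · rw [if_pos h', if_neg h'.ne, if_pos (by omega), add_zero]
        · rw [if_neg (by omega), if_pos h', if_pos (by omega), zero_add]
        · rw [if_neg (by omega), if_neg h'.ne', if_neg (by omega), add_zero]
    · rw [smul_zero, smul_zero]

/-- Moving `E_ij` past `E_ki` leaves the even unit `E_kj`, so the induction must also carry
vanishing under such units. -/
theorem IsSingular.unitE_smul_oddString {m n : ℕ} {M : Type*} [AddCommGroup M] [Module ℂ M]
    [Module (UEA m n) M] [IsScalarTower ℂ (UEA m n) M] {wt : Idx m n → ℂ} {v : M}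
    (hv : IsSingular wt v) (i : Fin m) (k : ℕ) (j : Fin n) (hj : k ≤ j) :
    (unitE (.inl i) (.inr j) : UEA m n) • oddString (n := n) i v k = 0 ∧
    ∀ l : Fin n, l < j → (unitE (.inr l) (.inr j) : UEA m n) • oddString (n := n) i v k = 0 := by
  induction k generalizing j with
  | zero =>
    refine ⟨hv.upper _ _ (toLex_lt_iff.mpr ?_), fun l hl => hv.upper _ _ (toLex_lt_iff.mpr ?_)⟩
    · simp only [pos]; omega
    · simp only [pos]; omega
  | succ k ih =>
    rw [oddString]
    split_ifs with h
    · have hne : j ≠ ⟨k, h⟩ := by rintro rfl; simp at hj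
      obtain ⟨h1, h2⟩ := ih j (by omega)
      constructor
      · rw [smul_smul, unitE_mul_unitE, if_neg (by simpa using hne), if_pos rfl]
        simp only [par, zero_add, add_zero, ksign_one_one]
        rw [add_smul, sub_smul, zero_smul, smul_assoc, smul_assoc, mul_smul, h1,
          h2 _ (Fin.lt_def.mpr (by simpa using hj))]
        simp
      · intro l hl
        rw [smul_smul, unitE_mul_unitE, if_neg (by simpa using hne), if_neg (by simp)]
        rw [add_smul, sub_smul, zero_smul, smul_assoc, smul_assoc, mul_smul, h2 l hl]
        simp
    · simp

/-- The superbracket of `E_ik` and `E_ki` is `E_ii + E_kk`. The string has lowered weight `i` by `k`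
and not yet touched index `k`. -/
theorem IsSingular.unitE_smul_unitE_smul_oddString {m n : ℕ} {M : Type*} [AddCommGroup M] [Module ℂ M]
    [Module (UEA m n) M] [IsScalarTower ℂ (UEA m n) M] {wt : Idx m n → ℂ} {v : M}
    (hv : IsSingular wt v) (i : Fin m) (k : Fin n) :
    (unitE (.inl i) (.inr k) : UEA m n) • (unitE (.inr k) (.inl i) : UEA m n) •
      oddString (n := n) i v k = (wt (.inl i) - (k : ℕ) + wt (.inr k)) •
        oddString (n := n) i v k := by
  rw [smul_smul, unitE_mul_unitE, if_pos rfl, if_pos rfl]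
  simp only [par, zero_add, add_zero, ksign_one_one]
  rw [add_smul, sub_smul, smul_assoc, smul_assoc, mul_smul,
    (hv.unitE_smul_oddString i k k le_rfl).1, hv.oddString_weight, hv.oddString_weight]
  simp only [if_true, lt_irrefl, if_false]
  rw [smul_zero]
  module

/-- The highest weights of tensor space satisfy the hook condition. -/
theorem IsSingular.lt_content {m n d : ℕ} {f : Fin d → Idx m n} {v : W m n d}
    (hv : IsSingular (fun i => (content f i : ℂ)) v) (hv0 : v ≠ 0) (i : Fin m) (j : Fin n)
    (hj : 0 < content f (.inr j)) : (j : ℕ) < content f (.inl i) := by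
  by_contra! hle
  -- The scalar `wt i - k + wt k` is positive for `k ≤ wt i ≤ j`, since the odd weight at `k` is at
  -- least the one at `j`. Hence `wt i + 1` steps survive and weight `i` becomes `-1`.
  have hne : ∀ k : ℕ, k ≤ content f (.inl i) + 1 → oddString (n := n) i v k ≠ 0 := by
    intro k
    induction k with
    | zero => intro _; exact hv0
    | succ k ih =>
      intro hk
      have hkn : k < n := by omega
      have hpos : 0 < content f (.inr ⟨k, hkn⟩) := by
        rcases eq_or_lt_of_le (show k ≤ j by omega) with h | h
        · subst h; exact hj
        · exact hj.trans_le (hv.content_le hv0 (by simp only [pos]; omega) rfl)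
      rw [oddString, dif_pos hkn]
      intro h0
      have h1 : (unitE (.inl i) (.inr ⟨k, hkn⟩) : UEA m n) •
          (unitE (.inr ⟨k, hkn⟩) (.inl i) : UEA m n) • oddString (n := n) i v k = 0 := by
        rw [h0, smul_zero]
      rw [hv.unitE_smul_unitE_smul_oddString i ⟨k, hkn⟩] at h1
      refine smul_ne_zero ?_ (ih (by omega)) h1
      have h2 : ((content f (.inl i) : ℂ) - (k : ℂ) + content f (.inr ⟨k, hkn⟩)) =
          ((content f (.inl i) - k + content f (.inr ⟨k, hkn⟩) : ℕ) : ℂ) := by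
        rw [Nat.cast_add, Nat.cast_sub (by omega)]
      rw [h2, Nat.cast_ne_zero]
      omega
  refine weight_ne_neg_one (i := .inl i) (hne _ le_rfl) (hv.oddString_weight i _) ?_
  simp

/-! ### Hook partitions and highest weights -/

theorem mem_lowerPart {m : ℕ} {μ : YoungDiagram} {a b : ℕ} :
    (a, b) ∈ lowerPart m μ ↔ (m + a, b) ∈ μ := by
  rw [← YoungDiagram.mem_cells, ← YoungDiagram.mem_cells]
  simp only [lowerPart, Finset.mem_image, Finset.mem_filter, Prod.exists, Prod.mk.injEq]
  constructor
  · rintro ⟨a', b', ⟨h, hm⟩, rfl, rfl⟩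
    rwa [Nat.add_sub_cancel' hm]
  · intro h
    exact ⟨m + a, b, ⟨h, by omega⟩, by omega, rfl⟩

theorem lt_lowerPart_transpose_rowLen {m : ℕ} {μ : YoungDiagram} {a b : ℕ} :
    a < (lowerPart m μ).transpose.rowLen b ↔ (m + a, b) ∈ μ := by
  rw [YoungDiagram.rowLen_transpose, ← YoungDiagram.mem_iff_lt_colLen, mem_lowerPart]

/-- The weight `μ^♮` with natural number coefficients. -/
def natWeight (m n : ℕ) (μ : YoungDiagram) : Idx m n → ℕ
  | .inl i => μ.rowLen i
  | .inr j => (lowerPart m μ).transpose.rowLen j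

theorem natural_eq (m n : ℕ) (μ : YoungDiagram) (i : Idx m n) :
    natural m n μ i = natWeight m n μ i := by
  rcases i with i | j <;> rfl

theorem HookPartition.snd_lt {d m n : ℕ} (μ : HookPartition d m n) {a b : ℕ} (h : (a, b) ∈ μ.1)
    (ha : m ≤ a) : b < n :=
  (YoungDiagram.mem_iff_lt_rowLen.mp (μ.1.up_left_mem ha le_rfl h)).trans_le μ.2.2

/-- The even coordinates give the first `m` rows. Below them the hook condition leaves only columns
before `n`, whose heights are the odd coordinates. -/
theorem natural_injective {d m n : ℕ} {μ ν : HookPartition d m n}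
    (h : natural m n μ.1 = natural m n ν.1) : μ = ν := by
  have h' : ∀ i, natWeight m n μ.1 i = natWeight m n ν.1 i := by
    intro i
    have := congrFun h i
    rw [natural_eq, natural_eq] at this
    exact_mod_cast this
  have key : ∀ {μ ν : HookPartition d m n}, (∀ i, natWeight m n μ.1 i = natWeight m n ν.1 i) →
      ∀ a b, (a, b) ∈ μ.1 → (a, b) ∈ ν.1 := by
    intro μ ν h a b hab
    by_cases ha : a < m
    · have h1 : μ.1.rowLen a = ν.1.rowLen a := h (.inl ⟨a, ha⟩)
      rwa [YoungDiagram.mem_iff_lt_rowLen, ← h1, ← YoungDiagram.mem_iff_lt_rowLen]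
    · have hb := μ.snd_lt hab (by omega)
      have h1 : (lowerPart m μ.1).transpose.rowLen b = (lowerPart m ν.1).transpose.rowLen b :=
        h (.inr ⟨b, hb⟩)
      obtain ⟨a, rfl⟩ := Nat.exists_eq_add_of_le (show m ≤ a by omega)
      rwa [← lt_lowerPart_transpose_rowLen, ← h1, lt_lowerPart_transpose_rowLen]
  refine Subtype.ext (YoungDiagram.ext ?_)
  ext ⟨a, b⟩
  exact ⟨key h' a b, key (fun i => (h' i).symm) a b⟩

/-- The boxes of the hook partition with a given weight. -/
def hookCell {m n : ℕ} : (Σ _ : Idx m n, ℕ) → ℕ × ℕ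
  | ⟨.inl i, b⟩ => (i, b)
  | ⟨.inr j, a⟩ => (m + a, j)

theorem hookCell_injective {m n : ℕ} :
    Function.Injective (hookCell : (Σ _ : Idx m n, ℕ) → ℕ × ℕ) := by
  rintro ⟨i | i, a⟩ ⟨j | j, b⟩ h <;> simp only [hookCell, Prod.mk.injEq] at h
  · obtain ⟨h1, rfl⟩ := h
    rw [Fin.ext h1]
  · omega
  · omega
  · obtain ⟨h1, h2⟩ := h
    rw [Fin.ext h2, show a = b by omega]

/-- Stack `m` rows of lengths `κ (.inl i)` over columns of heights `κ (.inr j)`. By `hhook`, a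
nonempty column lies below boxes of all `m` rows, so the shape is a diagram. -/
theorem exists_hookPartition {d m n : ℕ} (κ : Idx m n → ℕ) (hd : ∑ i, κ i = d)
    (hκ : ∀ i j, pos i < pos j → par i = par j → κ j ≤ κ i)
    (hhook : ∀ (i : Fin m) (j : Fin n), 0 < κ (.inr j) → (j : ℕ) < κ (.inl i)) :
    ∃ μ : HookPartition d m n, ∀ i, natural m n μ.1 i = κ i := by
  classical
  set C : Finset (ℕ × ℕ) :=
    ((Finset.univ : Finset (Idx m n)).sigma fun i => Finset.range (κ i)).image hookCell with hC
  have hmem : ∀ a b, (a, b) ∈ C ↔ (∃ h : a < m, b < κ (.inl ⟨a, h⟩)) ∨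
      (m ≤ a ∧ ∃ h : b < n, a - m < κ (.inr ⟨b, h⟩)) := by
    intro a b
    simp only [hC, Finset.mem_image, Finset.mem_sigma, Finset.mem_univ, true_and, Finset.mem_range]
    constructor
    · rintro ⟨⟨i | j, c⟩, hc, h⟩ <;> simp only [hookCell, Prod.mk.injEq] at h
      · obtain ⟨rfl, rfl⟩ := h
        exact Or.inl ⟨i.2, hc⟩
      · obtain ⟨rfl, rfl⟩ := h
        exact Or.inr ⟨by omega, j.2, by simpa using hc⟩
    · rintro (⟨h, hb⟩ | ⟨ha, h, hb⟩)
      · exact ⟨⟨.inl ⟨a, h⟩, b⟩, hb, rfl⟩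
      · exact ⟨⟨.inr ⟨b, h⟩, a - m⟩, hb, by simp [hookCell, Nat.add_sub_cancel' ha]⟩
  have hle : ∀ i j : Idx m n, pos i ≤ pos j → par i = par j → κ j ≤ κ i := by
    intro i j h hp
    rcases h.eq_or_lt with h | h
    · rw [pos_injective h]
    · exact hκ i j h hp
  let μ : YoungDiagram :=
    { cells := C
      isLowerSet := by
        rintro ⟨a, b⟩ ⟨a', b'⟩ hab h
        obtain ⟨ha, hb⟩ := Prod.mk_le_mk.mp hab
        rw [Finset.mem_coe, hmem] at h ⊢
        rcases h with ⟨h, hlt⟩ | ⟨hma, h, hlt⟩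
        · exact Or.inl ⟨by omega, (hb.trans_lt hlt).trans_le
            (hle (.inl ⟨a', by omega⟩) (.inl ⟨a, h⟩) ha rfl)⟩
        · by_cases ha' : a' < m
          · refine Or.inl ⟨ha', hb.trans_lt (hhook ⟨a', ha'⟩ ⟨b, h⟩ (by omega))⟩
          · refine Or.inr ⟨by omega, by omega, ?_⟩
            have := hle (.inr ⟨b', by omega⟩) (.inr ⟨b, h⟩) (by simp only [pos]; omega) rfl
            omega }
  have hμ : ∀ a b, (a, b) ∈ μ ↔ (∃ h : a < m, b < κ (.inl ⟨a, h⟩)) ∨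
      (m ≤ a ∧ ∃ h : b < n, a - m < κ (.inr ⟨b, h⟩)) := hmem
  refine ⟨⟨μ, ?_, ?_⟩, ?_⟩
  · change C.card = d
    rw [hC, Finset.card_image_of_injective _ hookCell_injective, Finset.card_sigma, ← hd]
    simp [-Fintype.sum_sum_type]
  · by_contra! h
    rw [← YoungDiagram.mem_iff_lt_rowLen, hμ] at h
    rcases h with ⟨h, -⟩ | ⟨-, h, -⟩ <;> omega
  · intro i
    rw [natural_eq]
    congr 1
    rcases i with i | j
    · refine eq_of_forall_lt_iff fun b => ?_
      change b < μ.rowLen i ↔ _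
      rw [← YoungDiagram.mem_iff_lt_rowLen, hμ]
      simp [i.2.not_ge]
    · refine eq_of_forall_lt_iff fun a => ?_
      change a < (lowerPart m μ).transpose.rowLen j ↔ _
      rw [lt_lowerPart_transpose_rowLen, hμ]
      simp

/-- Every highest weight of tensor space comes from a hook partition. -/
theorem IsSingular.exists_hookPartition {m n d : ℕ} {wt : Idx m n → ℂ} {v : W m n d}
    (hv : IsSingular wt v) (hv0 : v ≠ 0) : ∃ μ : HookPartition d m n, natural m n μ.1 = wt := by
  obtain ⟨f, hf⟩ := exists_content_eq hv0 hv.weight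
  obtain rfl := funext hf
  obtain ⟨μ, hμ⟩ := SchurSergeev.exists_hookPartition (content f) (sum_content f)
    (fun i j hij hpar => hv.content_le hv0 hij hpar) (hv.lt_content hv0)
  exact ⟨μ, funext hμ⟩

/-! ### Young symmetrizers -/

section Young

variable {d : ℕ} {μ : YoungDiagram} (T : Fin d ≃ μ.cells)

/-- The Young symmetrizer of a tableau. -/
def youngSymm : GroupAlg d := colAntisymmetrizer T * rowSymmetrizer T

/-- `σ` preserves the rows of `T`. -/
def PreservesRows (σ : Equiv.Perm (Fin d)) : Prop := ∀ a, (T (σ a)).1.1 = (T a).1.1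

/-- `σ` preserves the columns of `T`. -/
def PreservesCols (σ : Equiv.Perm (Fin d)) : Prop := ∀ a, (T (σ a)).1.2 = (T a).1.2

variable {T}

theorem PreservesRows.mul {σ τ : Equiv.Perm (Fin d)} (hσ : PreservesRows T σ)
    (hτ : PreservesRows T τ) : PreservesRows T (σ * τ) := fun a => (hσ (τ a)).trans (hτ a)

theorem PreservesRows.inv {σ : Equiv.Perm (Fin d)} (hσ : PreservesRows T σ) :
    PreservesRows T σ⁻¹ := fun a => by simpa using (hσ (σ⁻¹ a)).symm

theorem PreservesCols.mul {σ τ : Equiv.Perm (Fin d)} (hσ : PreservesCols T σ)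
    (hτ : PreservesCols T τ) : PreservesCols T (σ * τ) := fun a => (hσ (τ a)).trans (hτ a)

theorem PreservesCols.inv {σ : Equiv.Perm (Fin d)} (hσ : PreservesCols T σ) :
    PreservesCols T σ⁻¹ := fun a => by simpa using (hσ (σ⁻¹ a)).symm

theorem preservesRows_swap {x y : Fin d} (h : (T x).1.1 = (T y).1.1) :
    PreservesRows T (Equiv.swap x y) := by
  intro a
  rw [Equiv.swap_apply_def]
  split_ifs with h1 h2
  · rw [h1, h]
  · rw [h2, h]
  · rfl

theorem preservesCols_swap {x y : Fin d} (h : (T x).1.2 = (T y).1.2) :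
    PreservesCols T (Equiv.swap x y) := by
  intro a
  rw [Equiv.swap_apply_def]
  split_ifs with h1 h2
  · rw [h1, h]
  · rw [h2, h]
  · rfl

theorem of_mul_rowSymmetrizer {σ : Equiv.Perm (Fin d)} (hσ : PreservesRows T σ) :
    MonoidAlgebra.of ℂ _ σ * rowSymmetrizer T = rowSymmetrizer T := by
  rw [rowSymmetrizer, Finset.mul_sum]
  refine Finset.sum_nbij' (fun τ => σ * τ) (fun τ => σ⁻¹ * τ) ?_ ?_ ?_ ?_ ?_
  · intro τ hτ
    exact Finset.mem_filter.mpr ⟨Finset.mem_univ _, hσ.mul (Finset.mem_filter.mp hτ).2⟩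
  · intro τ hτ
    exact Finset.mem_filter.mpr ⟨Finset.mem_univ _, hσ.inv.mul (Finset.mem_filter.mp hτ).2⟩
  · intro τ _; simp
  · intro τ _; simp
  · intro τ _; rw [map_mul]

theorem rowSymmetrizer_mul_of {σ : Equiv.Perm (Fin d)} (hσ : PreservesRows T σ) :
    rowSymmetrizer T * MonoidAlgebra.of ℂ _ σ = rowSymmetrizer T := by
  rw [rowSymmetrizer, Finset.sum_mul]
  refine Finset.sum_nbij' (fun τ => τ * σ) (fun τ => τ * σ⁻¹) ?_ ?_ ?_ ?_ ?_
  · intro τ hτ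
    exact Finset.mem_filter.mpr ⟨Finset.mem_univ _,
      PreservesRows.mul (Finset.mem_filter.mp hτ).2 hσ⟩
  · intro τ hτ
    exact Finset.mem_filter.mpr ⟨Finset.mem_univ _,
      PreservesRows.mul (Finset.mem_filter.mp hτ).2 hσ.inv⟩
  · intro τ _; simp
  · intro τ _; simp
  · intro τ _; rw [map_mul]

theorem colAntisymmetrizer_mul_of {σ : Equiv.Perm (Fin d)} (hσ : PreservesCols T σ) :
    colAntisymmetrizer T * MonoidAlgebra.of ℂ _ σ =
      (Equiv.Perm.sign σ : ℤ) • colAntisymmetrizer T := by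
  rw [colAntisymmetrizer, Finset.sum_mul, Finset.smul_sum]
  refine Finset.sum_nbij' (fun τ => τ * σ) (fun τ => τ * σ⁻¹) ?_ ?_ ?_ ?_ ?_
  · intro τ hτ
    exact Finset.mem_filter.mpr ⟨Finset.mem_univ _,
      PreservesCols.mul (Finset.mem_filter.mp hτ).2 hσ⟩
  · intro τ hτ
    exact Finset.mem_filter.mpr ⟨Finset.mem_univ _,
      PreservesCols.mul (Finset.mem_filter.mp hτ).2 hσ.inv⟩
  · intro τ _; simp
  · intro τ _; simp
  · intro τ _
    rw [map_mul, smul_mul_assoc, smul_smul, map_mul, Units.val_mul, mul_left_comm,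
      ← Units.val_mul, Int.units_mul_self, Units.val_one, mul_one]

/-- If no two letters lie in one column of `T` and in one row of `T ∘ g⁻¹`, then moving every letter
within its column to its row in `T ∘ g⁻¹` stays inside the diagram. -/
theorem row_lt_colLen_of_injOn (g : Equiv.Perm (Fin d))
    (h : ∀ x y : Fin d, x ≠ y → (T x).1.2 = (T y).1.2 → (T (g⁻¹ x)).1.1 ≠ (T (g⁻¹ y)).1.1)
    (x₀ : Fin d) : (T (g⁻¹ x₀)).1.1 < μ.colLen (T x₀).1.2 := by
  classical
  set k := μ.colLen (T x₀).1.2 with hk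
  have hcol : ∀ x : Fin d, (T x).1.1 < μ.colLen (T x).1.2 := fun x =>
    YoungDiagram.mem_iff_lt_colLen.mp ((YoungDiagram.mem_cells _).mp (T x).2)
  -- In each column, at most as many letters have new row below `k` as have old row below `k`: new
  -- rows are distinct within a column, and a column shorter than `k` is counted entirely on the
  -- right. The totals agree, so each column has equality; in the column of `x₀` this captures every
  -- letter.
  have hle : ∀ b ∈ Finset.univ.image (fun x : Fin d => (T x).1.2),
      ((Finset.univ.filter fun x : Fin d => (T (g⁻¹ x)).1.1 < k).filter
        fun x => (T x).1.2 = b).card ≤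
      ((Finset.univ.filter fun x : Fin d => (T x).1.1 < k).filter fun x => (T x).1.2 = b).card := by
    intro b _
    rcases le_or_gt k (μ.colLen b) with hkb | hkb
    · refine le_trans (b := k) ?_ ?_
      · rw [← Finset.card_range k]
        refine Finset.card_le_card_of_injOn (fun x => (T (g⁻¹ x)).1.1) ?_ ?_
        · intro x hx
          simp only [Finset.coe_filter, Finset.mem_filter, Finset.mem_univ, true_and] at hx
          simpa using hx.1
        · intro x hx y hy hxy
          simp only [Finset.coe_filter, Finset.mem_filter, Finset.mem_univ, true_and] at hx hy
          by_contra hne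
          exact h x y hne (hx.2.trans hy.2.symm) hxy
      · have hmem : ∀ r : Fin k, ((r : ℕ), b) ∈ μ.cells := fun r =>
          (YoungDiagram.mem_cells _).mpr (YoungDiagram.mem_iff_lt_colLen.mpr (r.2.trans_le hkb))
        have := Finset.card_le_card_of_injOn (s := (Finset.univ : Finset (Fin k)))
          (t := ((Finset.univ.filter fun x : Fin d => (T x).1.1 < k).filter
            fun x => (T x).1.2 = b)) (fun r => T.symm ⟨((r : ℕ), b), hmem r⟩) (by intro r _; simp)
          (by intro r _ r' _ hr; simpa [Fin.ext_iff] using hr)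
        simpa using this
    · refine Finset.card_le_card fun x hx => ?_
      simp only [Finset.mem_filter, Finset.mem_univ, true_and] at hx ⊢
      have := hcol x
      rw [hx.2] at this
      exact ⟨this.trans hkb, hx.2⟩
  have hcard : (Finset.univ.filter fun x : Fin d => (T (g⁻¹ x)).1.1 < k).card =
      (Finset.univ.filter fun x : Fin d => (T x).1.1 < k).card := by
    refine Finset.card_bij (fun x _ => g⁻¹ x) ?_ ?_ ?_
    · intro x hx; simpa using hx
    · intro x _ y _ hxy; exact g⁻¹.injective hxy
    · intro x hx; exact ⟨g x, by simpa using hx, by simp⟩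
  have hmaps : ∀ s : Finset (Fin d), Set.MapsTo (fun x : Fin d => (T x).1.2) (s : Set (Fin d))
      (Finset.univ.image (fun x : Fin d => (T x).1.2) : Finset ℕ) := by
    intro s x _
    simp
  rw [Finset.card_eq_sum_card_fiberwise (hmaps _), Finset.card_eq_sum_card_fiberwise (hmaps _),
    Finset.sum_eq_sum_iff_of_le hle] at hcard
  have h1 := hcard (T x₀).1.2 (Finset.mem_image_of_mem _ (Finset.mem_univ x₀))
  have hsub : ((Finset.univ.filter fun x : Fin d => (T (g⁻¹ x)).1.1 < k).filter
      fun x => (T x).1.2 = (T x₀).1.2) ⊆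
      ((Finset.univ.filter fun x : Fin d => (T x).1.1 < k).filter
        fun x => (T x).1.2 = (T x₀).1.2) := by
    intro x hx
    simp only [Finset.mem_filter, Finset.mem_univ, true_and] at hx ⊢
    have := hcol x
    rw [hx.2] at this
    exact ⟨this, hx.2⟩
  have h2 : x₀ ∈ ((Finset.univ.filter fun x : Fin d => (T x).1.1 < k).filter
      fun x => (T x).1.2 = (T x₀).1.2) := by
    simpa using hcol x₀
  rw [← Finset.eq_of_subset_of_card_le hsub h1.ge] at h2
  simp only [Finset.mem_filter, Finset.mem_univ, true_and] at h2
  exact h2.1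

/-- Let `ρ` move each `x` within its column to the row of `g⁻¹ x`. Then `ρ` preserves columns, `ρ g`
preserves rows, and `g = ρ⁻¹ (ρ g)`. -/
theorem exists_preserves_of_injOn (g : Equiv.Perm (Fin d))
    (h : ∀ x y : Fin d, x ≠ y → (T x).1.2 = (T y).1.2 → (T (g⁻¹ x)).1.1 ≠ (T (g⁻¹ y)).1.1) :
    ∃ τ σ : Equiv.Perm (Fin d), PreservesCols T τ ∧ PreservesRows T σ ∧ g = τ * σ := by
  have hmem : ∀ x : Fin d, ((T (g⁻¹ x)).1.1, (T x).1.2) ∈ μ.cells := fun x =>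
    (YoungDiagram.mem_cells _).mpr (YoungDiagram.mem_iff_lt_colLen.mpr (row_lt_colLen_of_injOn g h x))
  have hinj : Function.Injective fun x : Fin d => T.symm ⟨_, hmem x⟩ := by
    intro x y hxy
    have hxy : (T (g⁻¹ x)).1.1 = (T (g⁻¹ y)).1.1 ∧ (T x).1.2 = (T y).1.2 := by simpa using hxy
    by_contra hne
    exact h x y hne hxy.2 hxy.1
  let ρ : Equiv.Perm (Fin d) := Equiv.ofBijective _ (Finite.injective_iff_bijective.mp hinj)
  have hρ : ∀ x, T (ρ x) = ⟨_, hmem x⟩ := fun x => T.apply_symm_apply _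
  refine ⟨ρ⁻¹, ρ * g, PreservesCols.inv fun x => ?_, fun x => ?_, by group⟩
  · rw [hρ]
  · rw [Equiv.Perm.mul_apply, hρ]
    simp

theorem eq_zero_of_eq_neg_smul {M : Type*} [AddCommMonoid M] [Module ℂ M] {x : M}
    (h : x = (-1 : ℂ) • x) : x = 0 := by
  have h1 : (2 : ℂ) • x = 0 := by
    calc (2 : ℂ) • x = x + x := two_smul ℂ x
      _ = (1 : ℂ) • x + (-1 : ℂ) • x := by rw [one_smul, ← h]
      _ = 0 := by rw [← add_smul, add_neg_cancel, zero_smul]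
  rw [← one_smul ℂ x, show (1 : ℂ) = 2⁻¹ * 2 by norm_num, mul_smul, h1, smul_zero]

/-- For a permutation `g`, either `g` factors as columns times rows and only a sign remains, or a
transposition absorbed by the row symmetrizer crosses `g` to become a column transposition, which
changes the sign of the product and forces it to be 0. -/
theorem colAntisymmetrizer_mul_mul_rowSymmetrizer (y : GroupAlg d) :
    ∃ z : ℂ, colAntisymmetrizer T * y * rowSymmetrizer T = z • youngSymm T := by
  induction y using MonoidAlgebra.induction_on with
  | of g =>
    by_cases h : ∀ x y : Fin d, x ≠ y → (T x).1.2 = (T y).1.2 →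
        (T (g⁻¹ x)).1.1 ≠ (T (g⁻¹ y)).1.1
    · obtain ⟨τ, σ, hτ, hσ, rfl⟩ := exists_preserves_of_injOn g h
      refine ⟨((Equiv.Perm.sign τ : ℤ) : ℂ), ?_⟩
      rw [map_mul, ← mul_assoc, colAntisymmetrizer_mul_of hτ, mul_assoc, of_mul_rowSymmetrizer hσ,
        smul_mul_assoc, youngSymm, Int.cast_smul_eq_zsmul]
    · push Not at h
      obtain ⟨x, y, hxy, hcol, hrow⟩ := h
      refine ⟨0, ?_⟩
      have h1 : Equiv.swap x y * g = g * Equiv.swap (g⁻¹ x) (g⁻¹ y) := by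
        rw [Equiv.swap_mul_eq_mul_swap]
      have h2 : colAntisymmetrizer T * MonoidAlgebra.of ℂ _ g * rowSymmetrizer T =
          (-1 : ℂ) • (colAntisymmetrizer T * MonoidAlgebra.of ℂ _ g * rowSymmetrizer T) := by
        conv_lhs => rw [← of_mul_rowSymmetrizer (preservesRows_swap hrow), mul_assoc,
          ← mul_assoc (MonoidAlgebra.of ℂ _ g), ← map_mul, ← h1, map_mul, mul_assoc, ← mul_assoc,
          colAntisymmetrizer_mul_of (preservesCols_swap hcol), Equiv.Perm.sign_swap hxy]
        simp [mul_assoc]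
      rw [zero_smul]
      exact eq_zero_of_eq_neg_smul h2
  | add a b ha hb =>
    obtain ⟨z, hz⟩ := ha
    obtain ⟨z', hz'⟩ := hb
    exact ⟨z + z', by rw [mul_add, add_mul, hz, hz', add_smul]⟩
  | smul r a ha =>
    obtain ⟨z, hz⟩ := ha
    exact ⟨r * z, by rw [mul_smul_comm, smul_mul_assoc, hz, smul_smul]⟩

theorem scalarCorner_youngSymm : ScalarCorner (youngSymm T) := by
  intro y
  obtain ⟨z, hz⟩ := colAntisymmetrizer_mul_mul_rowSymmetrizer (T := T)
    (rowSymmetrizer T * y * colAntisymmetrizer T)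
  exact ⟨z, by rw [← hz]; simp only [youngSymm, mul_assoc]⟩

end Young

/-! ### Signs of permutations that fix a word -/

theorem permSign_one {m n d : ℕ} (f : Fin d → Idx m n) : permSign 1 f = 1 := by
  rw [permSign, Finset.filter_false_of_mem, Finset.prod_empty]
  rintro ⟨i, j⟩ _ ⟨h1, h2⟩
  exact lt_asymm h1 h2

/-- An adjacent transposition has a single inversion; general ones are reached by conjugation. -/
theorem permSign_swap_zero_one {m n d : ℕ} (hd : 1 < d) (f : Fin d → Idx m n) :
    permSign (Equiv.swap (⟨0, by omega⟩ : Fin d) ⟨1, hd⟩) f =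
      ksign (par (f ⟨0, by omega⟩)) (par (f ⟨1, hd⟩)) := by
  rw [permSign, Finset.prod_eq_single (⟨0, by omega⟩, ⟨1, hd⟩)]
  · rintro ⟨i, j⟩ hij hne
    exfalso
    simp only [Finset.mem_filter, Finset.mem_univ, true_and] at hij
    obtain ⟨h1, h2⟩ := hij
    simp only [Equiv.swap_apply_def] at h2
    apply hne
    rw [Prod.mk.injEq, Fin.ext_iff, Fin.ext_iff]
    split_ifs at h2 <;> simp only [Fin.ext_iff, Fin.lt_def] at * <;> constructor <;> omega
  · intro h
    exfalso
    apply h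
    simp only [Finset.mem_filter, Finset.mem_univ, true_and, Equiv.swap_apply_left,
      Equiv.swap_apply_right, Fin.mk_lt_mk]
    omega

/-- By the cocycle rule the signs of `g` and `g⁻¹` cancel, as `s` fixes the word `f ∘ g`. -/
theorem permSign_conj {m n d : ℕ} (g s : Equiv.Perm (Fin d)) (f : Fin d → Idx m n)
    (h : ∀ x, f (g (s x)) = f (g x)) : permSign (g * s * g⁻¹) f = permSign s (f ∘ g) := by
  have h1 : f ∘ (s * g⁻¹).symm = f ∘ g := by
    funext x
    change f (g (s.symm x)) = f (g x)
    rw [← h (s.symm x), Equiv.apply_symm_apply]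
  have h2 : permSign g (f ∘ g) * permSign g⁻¹ f = 1 := by
    have := permSign_mul g g⁻¹ f
    rw [mul_inv_cancel, permSign_one] at this
    exact this.symm
  rw [mul_assoc, permSign_mul, h1, permSign_mul, mul_left_comm, h2, mul_one]
  rfl

theorem permSign_swap {m n d : ℕ} {x y : Fin d} (hxy : x ≠ y) {f : Fin d → Idx m n}
    (h : f x = f y) : permSign (Equiv.swap x y) f = ksign (par (f x)) (par (f x)) := by
  have hd : 1 < d := by
    have hx := x.2
    have hy := y.2
    have := Fin.val_ne_of_ne hxy
    omega
  set a : Fin d := ⟨0, by omega⟩ with ha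
  set b : Fin d := ⟨1, hd⟩ with hb
  have hab : b ≠ a := by simp [ha, hb]
  -- The permutation `g` must carry `a` to `x` and `b` to `y`: the first swap places `a`, and `c` is
  -- where it leaves `b`.
  let c := Equiv.swap a x b
  have hcx : x ≠ c := by
    intro h
    have : Equiv.swap a x b = Equiv.swap a x a := by
      rw [Equiv.swap_apply_left]; exact h.symm
    exact hab ((Equiv.swap a x).injective this)
  let g := Equiv.swap c y * Equiv.swap a x
  have hga : g a = x := by
    simp only [g, Equiv.Perm.mul_apply, Equiv.swap_apply_left]
    exact Equiv.swap_apply_of_ne_of_ne hcx hxy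
  have hgb : g b = y := by
    simp only [g, Equiv.Perm.mul_apply]
    exact Equiv.swap_apply_left c y
  have hs : Equiv.swap x y = g * Equiv.swap a b * g⁻¹ := by
    rw [Equiv.mul_swap_eq_swap_mul, hga, hgb, mul_inv_cancel_right]
  rw [hs, permSign_conj]
  · rw [permSign_swap_zero_one hd]
    simp only [Function.comp_apply, ← ha, ← hb, hga, hgb, ← h]
  · intro z
    rw [Equiv.swap_apply_def]
    split_ifs with h1 h2
    · rw [h1, hga, hgb, h]
    · rw [h2, hga, hgb, h]
    · rfl

/-- On the stabilizer of `f` the sign is multiplicative. Splitting off `swap x (τ x)`, which also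
fixes `f`, shrinks the support, so transpositions of equal letters determine it. -/
theorem permSign_eq_of_swap {m n d : ℕ} (f : Fin d → Idx m n) (χ : Equiv.Perm (Fin d) →* ℂ)
    (p : ZMod 2) (hχ : ∀ x y, x ≠ y → χ (Equiv.swap x y) = ksign p p) (τ : Equiv.Perm (Fin d))
    (hτ : ∀ x, f (τ x) = f x) (hp : ∀ x, τ x ≠ x → par (f x) = p) : permSign τ f = χ τ := by
  induction hk : τ.support.card using Nat.strong_induction_on generalizing τ with
  | _ k ih =>
    by_cases h1 : τ = 1
    · rw [h1, permSign_one, map_one]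
    · obtain ⟨x, hx⟩ : ∃ x, τ x ≠ x := by
        by_contra! h
        exact h1 (Equiv.ext h)
      set s := Equiv.swap x (τ x) with hs
      have hsf : ∀ y, f (s y) = f y := by
        intro y
        rw [hs, Equiv.swap_apply_def]
        split_ifs with h1 h2
        · rw [h1, hτ]
        · rw [h2, hτ]
        · rfl
      have hdec : τ = s * (s * τ) := by rw [← mul_assoc, Equiv.swap_mul_self, one_mul]
      have hlt := Equiv.Perm.card_support_swap_mul hx
      have hrec := ih _ (hk ▸ hlt) (s * τ) (fun y => by rw [Equiv.Perm.mul_apply, hsf, hτ])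
        (fun y hy => hp y fun hy' => hy (by
          rw [Equiv.Perm.mul_apply, hy', hs]
          refine Equiv.swap_apply_of_ne_of_ne ?_ ?_
          · rintro rfl; exact hx hy'
          · rintro rfl; exact hx (τ.injective hy'))) rfl
      have hcomp : f ∘ (s * τ).symm = f := by
        funext y
        rw [Function.comp_apply, ← hτ ((s * τ).symm y), ← hsf]
        exact congrArg f ((s * τ).apply_symm_apply y)
      have hsχ : permSign s f = χ s := by
        rw [hs, permSign_swap hx.symm (hτ x).symm, hp x hx, hχ x _ hx.symm]
      calc permSign τ f = permSign (s * (s * τ)) f := by rw [← hdec]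
        _ = χ s * χ (s * τ) := by rw [permSign_mul, hcomp, hsχ, hrec]
        _ = χ τ := by rw [← map_mul, ← hdec]

/-! ### The singular vectors of the Young symmetrizers -/

section Vectors

variable {m n d : ℕ} {μ : YoungDiagram} {T : Fin d ≃ μ.cells}

theorem of_smul_basis (σ : Equiv.Perm (Fin d)) (f : Fin d → Idx m n) :
    MonoidAlgebra.of ℂ _ σ • tensorBasis m n d f =
      permSign σ f • tensorBasis m n d (f ∘ σ.symm) := by
  rw [groupAlg_smul_def, Ψ_of, permOp_basis]

theorem swap_smul_basis {x y : Fin d} (hxy : x ≠ y) {f : Fin d → Idx m n} (h : f x = f y) :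
    MonoidAlgebra.of ℂ _ (Equiv.swap x y) • tensorBasis m n d f =
      ksign (par (f x)) (par (f x)) • tensorBasis m n d f := by
  rw [of_smul_basis, permSign_swap hxy h]
  congr 2
  funext z
  rw [Function.comp_apply, Equiv.symm_swap, Equiv.swap_apply_def]
  split_ifs with h1 h2
  · rw [h1, h]
  · rw [h2, h]
  · rfl

/-- Swapping two equal odd letters acts by `-1` on the word, yet the row symmetrizer absorbs the
swap. -/
theorem rowSymmetrizer_smul_eq_zero {x y : Fin d} (hxy : x ≠ y) {f : Fin d → Idx m n}
    (h : f x = f y) (hrow : (T x).1.1 = (T y).1.1) (hodd : par (f x) = 1) :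
    rowSymmetrizer T • tensorBasis m n d f = 0 := by
  apply eq_zero_of_eq_neg_smul
  conv_lhs => rw [← rowSymmetrizer_mul_of (preservesRows_swap hrow), mul_smul,
    swap_smul_basis hxy h, hodd, ksign_one_one, smul_algebra_smul_comm]

theorem colAntisymmetrizer_smul_eq_zero {x y : Fin d} (hxy : x ≠ y) {f : Fin d → Idx m n}
    (h : f x = f y) (hcol : (T x).1.2 = (T y).1.2) (heven : par (f x) = 0) :
    colAntisymmetrizer T • tensorBasis m n d f = 0 := by
  apply eq_zero_of_eq_neg_smul
  have h1 : colAntisymmetrizer T • tensorBasis m n d f =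
      (colAntisymmetrizer T * MonoidAlgebra.of ℂ _ (Equiv.swap x y)) • tensorBasis m n d f := by
    rw [mul_smul, swap_smul_basis hxy h, heven, ksign_zero_left, one_smul]
  rw [colAntisymmetrizer_mul_of (preservesCols_swap hcol), Equiv.Perm.sign_swap hxy,
    ← Int.cast_smul_eq_zsmul ℂ, smul_assoc] at h1
  rw [Units.val_neg, Units.val_one, Int.cast_neg, Int.cast_one] at h1
  exact h1

variable (μ : HookPartition d m n) (T : Fin d ≃ μ.1.cells)

/-- The word whose letter at a box is the row of the box for the first `m` rows, and its column
below them. -/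
def hookWord (x : Fin d) : Idx m n :=
  if h : (T x).1.1 < m then .inl ⟨(T x).1.1, h⟩
  else .inr ⟨(T x).1.2, μ.snd_lt ((YoungDiagram.mem_cells _).mp (T x).2) (not_lt.mp h)⟩

theorem hookWord_eq_inl {x : Fin d} {i : Fin m} : hookWord μ T x = .inl i ↔ (T x).1.1 = i := by
  rw [hookWord]
  split_ifs with h
  · simp [Fin.ext_iff]
  · simp only [false_iff]
    omega

theorem hookWord_eq_inr {x : Fin d} {j : Fin n} :
    hookWord μ T x = .inr j ↔ m ≤ (T x).1.1 ∧ (T x).1.2 = j := by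
  rw [hookWord]
  split_ifs with h
  · simp only [false_iff]
    omega
  · simp only [Sum.inr.injEq, Fin.ext_iff]
    omega

theorem content_hookWord (i : Idx m n) : content (hookWord μ T) i = natWeight m n μ.1 i := by
  symm
  rw [← Finset.card_range (natWeight m n μ.1 i), content]
  rcases i with i | j
  · have hmem : ∀ b ∈ Finset.range (natWeight m n μ.1 (.inl i)), ((i : ℕ), b) ∈ μ.1.cells :=
      fun b hb => (YoungDiagram.mem_cells _).mpr
        (YoungDiagram.mem_iff_lt_rowLen.mpr (Finset.mem_range.mp hb))
    refine Finset.card_bij (fun b hb => T.symm ⟨_, hmem b hb⟩) ?_ ?_ ?_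
    · intro b hb
      simp [hookWord_eq_inl]
    · intro b hb b' hb' h
      simpa using h
    · intro x hx
      have hx : (T x).1.1 = i := by simpa [hookWord_eq_inl] using hx
      refine ⟨(T x).1.2, ?_, ?_⟩
      · rw [Finset.mem_range]
        refine YoungDiagram.mem_iff_lt_rowLen.mp ?_
        rw [← hx]
        exact (YoungDiagram.mem_cells _).mp (T x).2
      · rw [Equiv.symm_apply_eq]
        exact Subtype.ext (Prod.ext hx.symm rfl)
  · have hmem : ∀ a ∈ Finset.range (natWeight m n μ.1 (.inr j)), (m + a, (j : ℕ)) ∈ μ.1.cells :=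
      fun a ha => (YoungDiagram.mem_cells _).mpr
        (lt_lowerPart_transpose_rowLen.mp (Finset.mem_range.mp ha))
    refine Finset.card_bij (fun a ha => T.symm ⟨_, hmem a ha⟩) ?_ ?_ ?_
    · intro b hb
      simp [hookWord_eq_inr]
    · intro b hb b' hb' h
      simpa using h
    · intro x hx
      have hx : m ≤ (T x).1.1 ∧ (T x).1.2 = j := by simpa [hookWord_eq_inr] using hx
      have hx' : (T x).1 = (m + ((T x).1.1 - m), (j : ℕ)) :=
        Prod.ext (Nat.add_sub_cancel' hx.1).symm hx.2
      refine ⟨(T x).1.1 - m, ?_, ?_⟩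
      · rw [Finset.mem_range]
        refine lt_lowerPart_transpose_rowLen.mpr ?_
        rw [← hx']
        exact (YoungDiagram.mem_cells _).mp (T x).2
      · rw [Equiv.symm_apply_eq]
        exact Subtype.ext hx'.symm

/-- The vector obtained from the word `hookWord` by the Young symmetrizer. -/
def hookVector : W m n d := youngSymm T • tensorBasis m n d (hookWord μ T)

/-- The new letter `i` duplicates one already present. For `i` even, after any row permutation a box
in row `i` of the same column carries `i`, and the column antisymmetrizer kills the word. For `i`
odd, so is `j`, the box in column `i` of the same row carries `i`, and the row symmetrizer kills it.
-/
theorem youngSymm_smul_update_eq_zero {i j : Idx m n} (hij : pos i < pos j) {k : Fin d}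
    (hk : hookWord μ T k = j) :
    youngSymm T • tensorBasis m n d (Function.update (hookWord μ T) k i) = 0 := by
  rw [youngSymm, mul_smul]
  rcases i with i | i
  · have hrow : (i : ℕ) < (T k).1.1 := by
      rcases j with j | j
      · rw [(hookWord_eq_inl μ T).mp hk]; exact hij
      · have := (hookWord_eq_inr μ T).mp hk
        omega
    rw [rowSymmetrizer, Finset.sum_smul, Finset.smul_sum]
    refine Finset.sum_eq_zero fun σ hσ => ?_
    have hσ : PreservesRows T σ := (Finset.mem_filter.mp hσ).2
    rw [of_smul_basis, smul_algebra_smul_comm]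
    have hmem : ((i : ℕ), (T (σ k)).1.2) ∈ μ.1.cells := by
      have h1 : ((T (σ k)).1.1, (T (σ k)).1.2) ∈ μ.1 := (YoungDiagram.mem_cells _).mp (T (σ k)).2
      exact (YoungDiagram.mem_cells _).mpr
        (μ.1.up_left_mem (by rw [hσ k]; exact hrow.le) le_rfl h1)
    set z := T.symm ⟨_, hmem⟩ with hz
    have hTz : (T z).1 = ((i : ℕ), (T (σ k)).1.2) := by rw [hz, Equiv.apply_symm_apply]
    have hσz : (T (σ.symm z)).1.1 = i := by
      have := hσ (σ.symm z)
      rw [Equiv.apply_symm_apply] at this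
      rw [← this, hTz]
    have hne : σ.symm z ≠ k := by
      intro h
      rw [h] at hσz
      omega
    have hgk : (Function.update (hookWord μ T) k (.inl i) ∘ σ.symm) (σ k) = .inl i := by simp
    have hgz : (Function.update (hookWord μ T) k (.inl i) ∘ σ.symm) z = .inl i := by
      rw [Function.comp_apply, Function.update_of_ne hne, hookWord_eq_inl, hσz]
    rw [colAntisymmetrizer_smul_eq_zero (x := σ k) (y := z), smul_zero]
    · intro h
      rw [← h] at hne
      exact hne (σ.symm_apply_apply k)
    · rw [hgk, hgz]
    · rw [hTz]
    · rw [hgk]; rfl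
  · rcases j with j | j
    · simp only [pos] at hij
      omega
    · obtain ⟨hrow, hcol⟩ := (hookWord_eq_inr μ T).mp hk
      have hij : (i : ℕ) < j := by simpa [pos] using hij
      have hmem : ((T k).1.1, (i : ℕ)) ∈ μ.1.cells := by
        have h1 : ((T k).1.1, (T k).1.2) ∈ μ.1 := (YoungDiagram.mem_cells _).mp (T k).2
        exact (YoungDiagram.mem_cells _).mpr (μ.1.up_left_mem le_rfl (by omega) h1)
      set z := T.symm ⟨_, hmem⟩ with hz
      have hTz : (T z).1 = ((T k).1.1, (i : ℕ)) := by rw [hz, Equiv.apply_symm_apply]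
      have hne : z ≠ k := by
        intro h
        rw [h] at hTz
        have : (T k).1.2 = i := congrArg Prod.snd hTz
        omega
      have hfz : Function.update (hookWord μ T) k (.inr i) z = .inr i := by
        rw [Function.update_of_ne hne, hookWord_eq_inr, hTz]
        exact ⟨hrow, rfl⟩
      rw [rowSymmetrizer_smul_eq_zero (x := z) (y := k) hne, smul_zero]
      · rw [hfz, Function.update_self]
      · rw [hTz]
      · rw [hfz]; rfl

theorem isSingular_hookVector : IsSingular (natural m n μ.1) (hookVector μ T) := by
  constructor
  · intro i j hij
    rw [hookVector, ← smul_comm (youngSymm T), unitE_smul_basis, Finset.smul_sum]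
    refine Finset.sum_eq_zero fun k _ => ?_
    split_ifs with h
    · rw [smul_algebra_smul_comm, youngSymm_smul_update_eq_zero μ T (toLex_lt_iff.mp hij) h,
        smul_zero]
    · rw [smul_zero]
  · intro i
    rw [hookVector, ← smul_comm (youngSymm T), unitE_self_smul_basis, smul_algebra_smul_comm, content_hookWord,
      natural_eq]

/-- If `τ σ` fixes the word, `σ` moves only even letters and `τ` only odd ones. So `σ` has Koszul
sign 1, and that of `τ` cancels its ordinary sign. -/
theorem sign_mul_permSign_eq_one {τ σ : Equiv.Perm (Fin d)} (hτ : PreservesCols T τ)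
    (hσ : PreservesRows T σ) (h : ∀ x, hookWord μ T (τ (σ x)) = hookWord μ T x) :
    ((Equiv.Perm.sign τ : ℤ) : ℂ) * permSign (τ * σ) (hookWord μ T) = 1 := by
  have hext : ∀ x y : Fin d, (T x).1.1 = (T y).1.1 → (T x).1.2 = (T y).1.2 → x = y := fun x y h1 h2 =>
    T.injective (Subtype.ext (Prod.ext h1 h2))
  have hcases : ∀ x, (∃ i, hookWord μ T x = .inl i) ∨ ∃ j, hookWord μ T x = .inr j := by
    intro x
    rcases hookWord μ T x with i | j
    · exact Or.inl ⟨i, rfl⟩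
    · exact Or.inr ⟨j, rfl⟩
  -- The odd letter records the column, which `τ` cannot alter; so `σ x` has both the row and the
  -- column of `x`.
  have hσfix : ∀ x j, hookWord μ T x = .inr j → σ x = x := by
    intro x j hj
    have h1 := h x
    rw [hj, hookWord_eq_inr] at h1
    rw [hookWord_eq_inr] at hj
    refine hext _ _ (hσ x) ?_
    rw [← hτ (σ x), h1.2, hj.2]
  have hσf : ∀ x, hookWord μ T (σ x) = hookWord μ T x := by
    intro x
    rcases hcases x with ⟨i, hi⟩ | ⟨j, hj⟩
    · rw [hi, hookWord_eq_inl, hσ x, ← hookWord_eq_inl, hi]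
    · rw [hσfix x j hj]
  have hτf : ∀ y, hookWord μ T (τ y) = hookWord μ T y := by
    intro y
    have := h (σ.symm y)
    rw [Equiv.apply_symm_apply] at this
    rw [this, ← hσf, Equiv.apply_symm_apply]
  have hτfix : ∀ y i, hookWord μ T y = .inl i → τ y = y := by
    intro y i hi
    have h1 := hτf y
    rw [hi, hookWord_eq_inl] at h1
    rw [hookWord_eq_inl] at hi
    exact hext _ _ (h1.trans hi.symm) (hτ y)
  have hcomp : hookWord μ T ∘ σ.symm = hookWord μ T := by
    funext x
    rw [Function.comp_apply, ← hσf, Equiv.apply_symm_apply]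
  have h1 : permSign σ (hookWord μ T) = 1 := by
    refine permSign_eq_of_swap _ 1 0 (fun x y _ => (ksign_zero_left 0).symm) σ hσf fun x hx => ?_
    rcases hcases x with ⟨i, hi⟩ | ⟨j, hj⟩
    · rw [hi]; rfl
    · exact absurd (hσfix x j hj) hx
  have h2 : permSign τ (hookWord μ T) = ((Equiv.Perm.sign τ : ℤ) : ℂ) := by
    refine permSign_eq_of_swap _ (((Int.castRingHom ℂ : ℤ →* ℂ).comp (Units.coeHom ℤ)).comp
      Equiv.Perm.sign) 1 (fun x y hxy => ?_) τ hτf fun x hx => ?_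
    · simp [Equiv.Perm.sign_swap hxy, ksign_one_one]
    · rcases hcases x with ⟨i, hi⟩ | ⟨j, hj⟩
      · exact absurd (hτfix x i hi) hx
      · rw [hj]; rfl
  rw [permSign_mul, hcomp, h1, mul_one, h2, ← Int.cast_mul, ← Units.val_mul, Int.units_mul_self]
  simp

/-- The coefficient of the hook word counts the pairs `(τ, σ)` whose product fixes it: each
contributes `+1`, and `(1, 1)` is one of them. -/
theorem hookVector_ne_zero : hookVector μ T ≠ 0 := by
  classical
  set f := hookWord μ T with hf
  have hexp : hookVector μ T = ∑ τ : Equiv.Perm (Fin d) with PreservesCols T τ,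
      ∑ σ : Equiv.Perm (Fin d) with PreservesRows T σ,
        (((Equiv.Perm.sign τ : ℤ) : ℂ) * permSign (τ * σ) f) •
          tensorBasis m n d (f ∘ (τ * σ).symm) := by
    rw [hookVector, youngSymm, colAntisymmetrizer, rowSymmetrizer, Finset.sum_mul, Finset.sum_smul]
    refine Finset.sum_congr (by ext; rw [Finset.mem_filter, Finset.mem_filter]; rfl) fun τ _ => ?_
    rw [Finset.mul_sum, Finset.sum_smul]
    refine Finset.sum_congr (by ext; rw [Finset.mem_filter, Finset.mem_filter]; rfl) fun σ _ => ?_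
    rw [smul_mul_assoc, ← map_mul, ← Int.cast_smul_eq_zsmul ℂ, smul_assoc, of_smul_basis, smul_smul]
  intro h0
  have h1 := congrArg (fun w => (tensorBasis m n d).repr w f) h0
  simp only [hexp, map_sum, map_smul, Module.Basis.repr_self, map_zero, Finsupp.coe_zero,
    Pi.zero_apply, Finsupp.finsetSum_apply, Finsupp.smul_apply, Finsupp.single_apply,
    smul_eq_mul] at h1
  have h2 : ∀ τ ∈ Finset.univ.filter (fun τ : Equiv.Perm (Fin d) => PreservesCols T τ),
      ∀ σ ∈ Finset.univ.filter (fun σ : Equiv.Perm (Fin d) => PreservesRows T σ),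
      ((Equiv.Perm.sign τ : ℤ) : ℂ) * permSign (τ * σ) f *
        (if f ∘ (τ * σ).symm = f then 1 else 0) =
      ((if f ∘ (τ * σ).symm = f then 1 else 0 : ℕ) : ℂ) := by
    intro τ hτ σ hσ
    split_ifs with h
    · rw [mul_one, Nat.cast_one]
      refine sign_mul_permSign_eq_one μ T (Finset.mem_filter.mp hτ).2 (Finset.mem_filter.mp hσ).2
        fun x => ?_
      exact (congrFun h (τ (σ x))).symm.trans (congrArg f ((τ * σ).symm_apply_apply x))
    · simp
  rw [Finset.sum_congr rfl fun τ hτ => Finset.sum_congr rfl (h2 τ hτ)] at h1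
  have h3 : ∑ τ : Equiv.Perm (Fin d) with PreservesCols T τ,
      ∑ σ : Equiv.Perm (Fin d) with PreservesRows T σ,
        (if f ∘ (τ * σ).symm = f then 1 else 0 : ℕ) = 0 := by exact_mod_cast h1
  rw [Finset.sum_eq_zero_iff] at h3
  have h4 := h3 1 (Finset.mem_filter.mpr ⟨Finset.mem_univ _, fun _ => rfl⟩)
  rw [Finset.sum_eq_zero_iff] at h4
  have h5 := h4 1 (Finset.mem_filter.mpr ⟨Finset.mem_univ _, fun _ => rfl⟩)
  rw [if_pos] at h5
  · exact one_ne_zero h5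
  · rfl

end Vectors

/-! ### Schur–Sergeev duality -/

/-- Commuting with `Φ` means commuting with every `𝔖_d`-endomorphism, so the double commutant of the
semisimple group algebra applies. -/
theorem centralizer_range_Φ (m n d : ℕ) :
    Subalgebra.centralizer ℂ ((Φ m n d).range : Set (Module.End ℂ (W m n d))) =
      (Ψ m n d).range := by
  refine le_antisymm (fun T hT => ?_) ?_
  · rw [Subalgebra.mem_centralizer_iff] at hT
    obtain ⟨a, ha⟩ := exists_smul_eq_of_commute (A := GroupAlg d) T fun β w => by
      obtain ⟨u, hu⟩ := mem_range_Φ_of_linear β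
      rw [← hu, ← hu]
      exact (LinearMap.congr_fun (hT _ ⟨u, rfl⟩) w).symm
    exact ⟨a, LinearMap.ext ha⟩
  · rintro _ ⟨s, rfl⟩
    rw [Subalgebra.mem_centralizer_iff]
    rintro _ ⟨u, rfl⟩
    exact (Φ_commute_Ψ u s).symm

section Hook

variable {m n d : ℕ} (μ : HookPartition d m n)

/-- The Young symmetrizer whose left ideal is the Specht module. -/
def hookSymm : GroupAlg d := youngSymm (tableau μ.1 μ.2.1)

theorem scalarCorner_hookSymm : ScalarCorner (hookSymm μ) := scalarCorner_youngSymm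

theorem exists_hookSymm_smul_ne_zero : ∃ w : W m n d, hookSymm μ • w ≠ 0 :=
  ⟨_, hookVector_ne_zero μ (tableau μ.1 μ.2.1)⟩

theorem hookSymm_ne_zero : hookSymm μ ≠ 0 := by
  intro h
  obtain ⟨w, hw⟩ := exists_hookSymm_smul_ne_zero μ
  rw [h, zero_smul] at hw
  exact hw rfl

instance isSimpleModule_hookImage :
    IsSimpleModule (UEA m n) (actImage (UEA m n) (W m n d) (hookSymm μ)) :=
  (scalarCorner_hookSymm μ).isSimpleModule_actImage mem_range_Φ_of_linear
    (exists_hookSymm_smul_ne_zero μ)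

theorem exists_isSingular_hookImage :
    ∃ v : actImage (UEA m n) (W m n d) (hookSymm μ), v ≠ 0 ∧ IsSingular (natural m n μ.1) v := by
  have hv := isSingular_hookVector μ (tableau μ.1 μ.2.1)
  refine ⟨⟨hookVector μ (tableau μ.1 μ.2.1), _, rfl⟩, fun h => ?_, fun i j hij => ?_, fun i => ?_⟩
  · exact hookVector_ne_zero μ _ (congrArg Subtype.val h)
  · exact Subtype.ext (hv.upper i j hij)
  · exact Subtype.ext (hv.weight i)

theorem nonempty_L_equiv_hookImage :
    Nonempty (L (natural m n μ.1) ≃ₗ[UEA m n] actImage (UEA m n) (W m n d) (hookSymm μ)) := by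
  obtain ⟨v, hv0, hv⟩ := exists_isSingular_hookImage μ
  exact hv.nonempty_equiv_L hv0

theorem isSimpleModule_L_natural : IsSimpleModule (UEA m n) (L (natural m n μ.1)) :=
  (isSingular_hookVector μ (tableau μ.1 μ.2.1)).isSimpleModule_L (hookVector_ne_zero μ _)

theorem isSimpleModule_specht : IsSimpleModule (GroupAlg d) (Specht μ.1 μ.2.1) :=
  (scalarCorner_hookSymm μ).isSimpleModule_span (hookSymm_ne_zero μ)

variable {μ} {ν : HookPartition d m n}

theorem eq_of_hookImage_equiv (e : actImage (UEA m n) (W m n d) (hookSymm μ) ≃ₗ[UEA m n]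
    actImage (UEA m n) (W m n d) (hookSymm ν)) : μ = ν := by
  obtain ⟨v, hv0, hv⟩ := exists_isSingular_hookImage μ
  obtain ⟨v', hv0', hv'⟩ := exists_isSingular_hookImage ν
  exact natural_injective (weight_eq_of_equiv hv hv0 hv' hv0' e)

theorem isEmpty_L_equiv (h : μ ≠ ν) :
    IsEmpty (L (natural m n μ.1) ≃ₗ[UEA m n] L (natural m n ν.1)) := by
  obtain ⟨θ⟩ := nonempty_L_equiv_hookImage μ
  obtain ⟨θ'⟩ := nonempty_L_equiv_hookImage ν
  exact ⟨fun e => h (eq_of_hookImage_equiv ((θ.symm.trans e).trans θ'))⟩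

/-- A nonzero product would link the two images of tensor space by an isomorphism, contradicting
their different highest weights. -/
theorem hookSymm_mul_mul_eq_zero (h : μ ≠ ν) (y : GroupAlg d) :
    hookSymm μ * y * hookSymm ν = 0 := by
  by_contra hy
  obtain ⟨e⟩ := (scalarCorner_hookSymm ν).nonempty_actImage_equiv (scalarCorner_hookSymm μ)
    mem_range_Φ_of_linear (exists_hookSymm_smul_ne_zero ν) (exists_hookSymm_smul_ne_zero μ) hy
  exact h (eq_of_hookImage_equiv e).symm

/-- For `x` with `c_μ x c_μ = c_μ`, the element `c_μ x` fixes the generator `c_μ` of the first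
module but kills the second by orthogonality. -/
theorem isEmpty_specht_equiv (h : μ ≠ ν) :
    IsEmpty (Specht μ.1 μ.2.1 ≃ₗ[GroupAlg d] Specht ν.1 ν.2.1) := by
  refine ⟨fun e => ?_⟩
  let e' : Submodule.span (GroupAlg d) {hookSymm μ} ≃ₗ[GroupAlg d]
    Submodule.span (GroupAlg d) {hookSymm ν} := e
  obtain ⟨x, hx⟩ := exists_mul_mul_self_eq (hookSymm μ)
  set s : Submodule.span (GroupAlg d) {hookSymm μ} :=
    ⟨hookSymm μ, Submodule.mem_span_singleton_self _⟩ with hs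
  have h1 : (hookSymm μ * x) • s = s := Subtype.ext hx
  obtain ⟨r, hr⟩ := Submodule.mem_span_singleton.mp (e' s).2
  have h2 : e' s = 0 := by
    rw [← h1, map_smul]
    refine Subtype.ext ?_
    rw [Submodule.coe_smul, ← hr, smul_eq_mul, smul_eq_mul, mul_assoc _ x, ← mul_assoc x,
      ← mul_assoc, hookSymm_mul_mul_eq_zero h]
    rfl
  rw [LinearEquiv.map_eq_zero_iff] at h2
  exact hookSymm_ne_zero μ (congrArg Subtype.val h2)

end Hook

theorem span_hookSymm_smul_eq_top (m n d : ℕ) :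
    Submodule.span (GroupAlg d)
      {v : W m n d | ∃ (μ : HookPartition d m n) (w : W m n d), v = hookSymm μ • w} = ⊤ := by
  obtain ⟨u, hu1, hu0, hspan⟩ := exists_projector (W := W m n d)
    (fun μ : HookPartition d m n => hookSymm μ) mem_range_Φ_of_linear
  refine hspan ?_
  by_contra! hne
  obtain ⟨w, hw, hw0⟩ := hne
  let N : Submodule (UEA m n) (W m n d) :=
    { carrier := {w | ∀ (μ : HookPartition d m n) (a : GroupAlg d), hookSymm μ • a • w = 0}
      add_mem' := fun {v w} hv hw i a => by rw [smul_add, smul_add, hv, hw, add_zero]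
      zero_mem' := fun i a => by rw [smul_zero, smul_zero]
      smul_mem' := fun b w hw i a => by
        rw [smul_comm a b, smul_comm (hookSymm i) b, hw, smul_zero] }
  obtain ⟨wt, v, hvN, hv0, hv⟩ := exists_isSingular_mem N (N.ne_bot_iff.mpr ⟨w, hw, hw0⟩)
  obtain ⟨μ, rfl⟩ := hv.exists_hookPartition hv0
  set v' : Submodule.span (UEA m n) {v} := ⟨v, Submodule.mem_span_singleton_self v⟩ with hv'
  have hsing : IsSingular (natural m n μ.1) v' :=
    ⟨fun i j hij => Subtype.ext (hv.upper i j hij), fun i => Subtype.ext (hv.weight i)⟩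
  obtain ⟨φ, hφ⟩ := hsing.exists_surjective (fun h => hv0 (congrArg Subtype.val h))
    (eq_top_iff.mpr fun x _ => by
      obtain ⟨a, ha⟩ := Submodule.mem_span_singleton.mp x.2
      exact Submodule.mem_span_singleton.mpr ⟨a, Subtype.ext ha⟩)
  obtain ⟨θ⟩ := nonempty_L_equiv_hookImage μ
  obtain ⟨z, hz0, -⟩ := exists_isSingular_hookImage μ
  obtain ⟨y, hy⟩ := hφ (θ.symm z)
  -- The projector `u` acts by 1 on the span of `v` and by 0 on the image of the symmetrizer, yet
  -- the first maps onto the second with `y` over `z ≠ 0`.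
  have h1 : u • y = y := by
    refine Subtype.ext (hu1 _ ?_)
    exact (Submodule.span_singleton_le_iff_mem v N).mpr hvN y.2
  have h2 : u • z = 0 := by
    obtain ⟨w, hw⟩ := z.2
    refine Subtype.ext ?_
    rw [Submodule.coe_smul, ← hw, hu0]
    rfl
  apply hz0
  rw [← θ.apply_symm_apply z, ← hy, ← h1, map_smul, map_smul, hy, θ.apply_symm_apply, h2]

theorem exists_decomposition (m n d : ℕ) :
    ∃ e : W m n d ≃ₗ[ℂ] Decomp m n d, ∀ (u : UEA m n) (s : GroupAlg d) (w : W m n d),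
      e (Φ m n d u (Ψ m n d s w)) = decompAct m n d u s (e w) := by
  classical
  exact exists_bimodule_decomposition (U := UEA m n) (W := W m n d)
    (fun μ : HookPartition d m n => hookSymm μ) scalarCorner_hookSymm
    (fun μ ν h => hookSymm_mul_mul_eq_zero h) (span_hookSymm_smul_eq_top m n d)
    (fun μ => L (natural m n μ.1)) (fun μ => (nonempty_L_equiv_hookImage μ).some)

end SchurSergeev

end

open SchurSergeev in
theorem theorem3p1 (m n d : ℕ) :
    -- the double centralizer property
    ((Φ m n d).range = Subalgebra.centralizer ℂ ((Ψ m n d).range : Set (Module.End ℂ (W m n d))) ∧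
      Subalgebra.centralizer ℂ ((Φ m n d).range : Set (Module.End ℂ (W m n d))) =
        (Ψ m n d).range) ∧
    -- the decomposition, as modules over `U(gl(m|n)) ⊗ ℂ𝔖_d`
    (∃ e : W m n d ≃ₗ[ℂ] Decomp m n d, ∀ (u : UEA m n) (s : GroupAlg d) (w : W m n d),
      e (Φ m n d u (Ψ m n d s w)) = decompAct m n d u s (e w)) ∧
    -- it is multiplicity-free: the factors are simple and pairwise non-isomorphic
    (∀ μ : HookPartition d m n, IsSimpleModule (UEA m n) (L (natural m n μ.1)) ∧
      IsSimpleModule (GroupAlg d) (Specht μ.1 μ.2.1)) ∧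
    (∀ μ ν : HookPartition d m n, μ ≠ ν →
      IsEmpty (L (natural m n μ.1) ≃ₗ[UEA m n] L (natural m n ν.1)) ∧
      IsEmpty (Specht μ.1 μ.2.1 ≃ₗ[GroupAlg d] Specht ν.1 ν.2.1)) :=
  ⟨⟨range_Φ_eq_centralizer m n d, centralizer_range_Φ m n d⟩, exists_decomposition m n d,
    fun μ => ⟨isSimpleModule_L_natural μ, isSimpleModule_specht μ⟩,
    fun _ _ h => ⟨isEmpty_L_equiv h, isEmpty_specht_equiv h⟩⟩
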